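/- Let $W$ be an entire function with $W(z+1)=W(z)$ for all $z\in\mathbb C$. Fix $k\in\mathbb C$, $h>0$ and $z_0\in\mathbb C$. For $\alpha\in\mathbb C$ put $P(\alpha,h)=(hD_z)^2-\alpha^2W(z)^2$, $D_z=\frac1i\partial_z$. For an entire function $u$ write $\mathbf u(z)=(u(z),hD_zu(z))\in\mathbb C^2$. Let $\mathcal M(\alpha)=\mathcal M_{z_0+1\leftarrow z_0}(\alpha,h)$ be the $2\times 2$ transition matrix, that is, the unique matrix with $\mathbf u(z_0+1)=\mathcal M(\alpha)\,\mathbf u(z_0)$ for every entire solution $u$ of $P(\alpha,h)u=0$; this matrix exists, is unique and is an entire function of $\alpha$. For $s\ge 0$ let $H^s_k=\{w\in H^s_{\rm loc}(\mathbb R): w(x+1)=e^{ik/h}w(x)\}$, $L^2_k=H^0_k$, with the norms over one period, and let $P_k(\alpha,h)=(hD_x)^2-\alpha^2W(x)^2:H^2_k\to L^2_k$. A family of operators on $\mathbb C$, defined off a discrete set, is called meromorphic if near each point it is the sum of a holomorphic family of bounded operators and a finite principal part whose coefficients have finite rank. Then $$\alpha\mapsto P_k(\alpha,h)^{-1}:L^2_k\to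 H^2_k\ \text{ is meromorphic on }\mathbb C\iff \det\big(\mathcal M(\alpha)-e^{ik/h}\big)\not\equiv 0$$ (the left-hand side includes that $P_k(\alpha,h)$ is invertible for all $\alpha$ outside a discrete set). Suppose that $\det(\mathcal M(\alpha)-e^{ik/h})\not\equiv0$. Then for every $\alpha\in\mathbb C$ the integral $$\frac1{2\pi i}\oint_\alpha P_k(\beta,h)^{-1}\partial_\beta P_k(\beta,h)\,d\beta,$$ taken over any positively oriented circle that encloses $\alpha$ and for which $P_k(\beta,h)$ is invertible at every point $\beta\ne\alpha$ of the closed disc (such circles exist), is an operator of finite rank on $L^2_k$, and its trace $m_h(\alpha,k)$ satisfies $$m_h(\alpha,k)=\frac1{2\pi i}\operatorname{tr}_{\mathbb C^2}\oint_\alpha\big(\mathcal M(\beta)-e^{ik/h}\big)^{-1}\partial_\beta\mathcal M(\beta)\,d\beta ,$$ where the last integral is over any positively oriented circle that encloses $\alpha$ and for which $\mathcal M(\beta)-e^{ik/h}$ is invertible at every point $\beta\neq\alpha$ of the closed disc (such circles exist). Moreover $m_h(\alpha,k)$ equals the (finite) order of vanishing of $\beta\mapsto\det(\mathcal M(\beta)-e^{ik/h})$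 at $\beta=\alpha$. -/

import Mathlib

open MeasureTheory Filter Topology
open scoped ContDiff ENNReal Matrix

noncomputable section

namespace PeriodicTransition

/-! ### Holomorphic solutions and the transition matrix -/

/-- `h D_z u = (h / i) ∂_z u` for holomorphic `u`. -/
def hD (h : ℝ) (u : ℂ → ℂ) (z : ℂ) : ℂ := ((h : ℂ) / Complex.I) * deriv u z

/-- `u` is an entire solution of `P(α,h) u = (h D_z)² u - α² W² u = 0`. -/
def IsEntireSolution (W : ℂ → ℂ) (α : ℂ) (h : ℝ) (u : ℂ → ℂ) : Prop :=
  Differentiable ℂ u ∧ ∀ z, hD h (hD h u) z - α ^ 2 * W z ^ 2 * u z = 0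

/-- The Cauchy data `(u(z), h D_z u(z)) ∈ ℂ²`. -/
def cauchyData (h : ℝ) (u : ℂ → ℂ) (z : ℂ) : Fin 2 → ℂ := ![u z, hD h u z]

/-- `M` maps the Cauchy data at `z₀` to the Cauchy data at `z₁`, for every entire solution. -/
def IsTransitionMatrix (W : ℂ → ℂ) (α : ℂ) (h : ℝ) (z₁ z₀ : ℂ) (M : Matrix (Fin 2) (Fin 2) ℂ) :
    Prop :=
  ∀ u : ℂ → ℂ, IsEntireSolution W α h u → cauchyData h u z₁ = M *ᵥ cauchyData h u z₀

/-- The transition matrix `ℳ_{z₁ ← z₀}(α,h)`: the matrix with the property `IsTransitionMatrix`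
(there is exactly one, by the well-posedness of the holomorphic Cauchy problem). -/
def transitionMatrix (W : ℂ → ℂ) (α : ℂ) (h : ℝ) (z₁ z₀ : ℂ) : Matrix (Fin 2) (Fin 2) ℂ :=
  Classical.epsilon (IsTransitionMatrix W α h z₁ z₀)

/-- `ℳ_{z₀ + 1 ← z₀}(β,h) - e^{ik/h}`. -/
def shiftedMonodromy (W : ℂ → ℂ) (k : ℂ) (h : ℝ) (z₀ β : ℂ) : Matrix (Fin 2) (Fin 2) ℂ :=
  transitionMatrix W β h (z₀ + 1) z₀ -
    Complex.exp (Complex.I * k / h) • (1 : Matrix (Fin 2) (Fin 2) ℂ)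

/-- The entrywise derivative `∂_β ℳ_{z₀ + 1 ← z₀}(β,h)`. -/
def derivMonodromy (W : ℂ → ℂ) (h : ℝ) (z₀ β : ℂ) : Matrix (Fin 2) (Fin 2) ℂ :=
  Matrix.of fun i j => deriv (fun b => transitionMatrix W b h (z₀ + 1) z₀ i j) β

/-- `tr_{ℂ²} (1 / 2πi) ∮ (ℳ(β) - e^{ik/h})⁻¹ ∂_β ℳ(β) dβ` over the circle with centre `c` and
radius `r`, the integral of a matrix being taken entry by entry. -/
def monodromyTrace (W : ℂ → ℂ) (k : ℂ) (h : ℝ) (z₀ c : ℂ) (r : ℝ) : ℂ :=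
  Matrix.trace (Matrix.of fun i j => (2 * Real.pi * Complex.I : ℂ)⁻¹ *
    ∮ β in C(c, r), ((shiftedMonodromy W k h z₀ β)⁻¹ * derivMonodromy W h z₀ β) i j)

/-! ### Quasi-periodic Sobolev spaces -/

/-- `w(x + 1) = e^{ik/h} w(x)` on the real line. -/
def IsQuasiPeriodic (k : ℂ) (h : ℝ) (w : ℝ → ℂ) : Prop :=
  ∀ x, w (x + 1) = Complex.exp (Complex.I * k / h) * w x

/-- `w ∈ L²_loc(ℝ)`. -/
def IsL2loc (w : ℝ → ℂ) : Prop :=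
  ∀ K : Set ℝ, IsCompact K → MemLp w 2 (volume.restrict K)

/-- `w, w' ∈ L²_loc(ℝ)` and `w'` is the weak derivative of `w`. -/
def HasWeakDerivL2loc (w w' : ℝ → ℂ) : Prop :=
  IsL2loc w ∧ IsL2loc w' ∧ ∀ φ : ℝ → ℂ, ContDiff ℝ ∞ φ → HasCompactSupport φ →
    ∫ x, deriv φ x * w x = -∫ x, φ x * w' x

/-- Lebesgue measure on the period cell `[0,1)`. -/
abbrev cell : Measure ℝ := volume.restrict (Set.Ico (0 : ℝ) 1)

/-- The Hilbert space `L²_k`. A function `w ∈ L²_loc(ℝ)` with `w(x + 1) = e^{ik/h} w(x)` is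
determined by its restriction to `[0,1)`, which is an arbitrary element of `L²(0,1)`: the space
`L²_k` of such functions is represented by these restrictions. -/
abbrev L2k : Type := Lp ℂ 2 cell

theorem IsL2loc.locallyIntegrable {w : ℝ → ℂ} (hw : IsL2loc w) : LocallyIntegrable w := by
  rw [locallyIntegrable_iff]
  intro K hK
  have : IsFiniteMeasure (volume.restrict K) := ⟨by simpa using hK.measure_lt_top⟩
  exact (hw K hK).integrable (by norm_num)

theorem HasWeakDerivL2loc.zero : HasWeakDerivL2loc (fun _ => 0) (fun _ => 0) :=
  ⟨fun _ _ => MemLp.zero', fun _ _ => MemLp.zero', by intros; simp⟩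

theorem HasWeakDerivL2loc.add {v v' w w' : ℝ → ℂ} (hv : HasWeakDerivL2loc v v')
    (hw : HasWeakDerivL2loc w w') : HasWeakDerivL2loc (v + w) (v' + w') := by
  refine ⟨fun K hK => (hv.1 K hK).add (hw.1 K hK), fun K hK => (hv.2.1 K hK).add (hw.2.1 K hK),
    fun φ hφ hc => ?_⟩
  have hd : Continuous (deriv φ) := hφ.continuous_deriv (by simp)
  have i1 := hv.1.locallyIntegrable.integrable_smul_left_of_hasCompactSupport hd hc.deriv
  have i2 := hw.1.locallyIntegrable.integrable_smul_left_of_hasCompactSupport hd hc.deriv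
  have i3 := hv.2.1.locallyIntegrable.integrable_smul_left_of_hasCompactSupport hφ.continuous hc
  have i4 := hw.2.1.locallyIntegrable.integrable_smul_left_of_hasCompactSupport hφ.continuous hc
  simp only [smul_eq_mul] at i1 i2 i3 i4
  simp only [Pi.add_apply, mul_add]
  rw [integral_add i1 i2, integral_add i3 i4, hv.2.2 φ hφ hc, hw.2.2 φ hφ hc]
  ring

theorem HasWeakDerivL2loc.const_smul {w w' : ℝ → ℂ} (c : ℂ) (hw : HasWeakDerivL2loc w w') :
    HasWeakDerivL2loc (c • w) (c • w') := by
  refine ⟨fun K hK => (hw.1 K hK).const_smul c, fun K hK => (hw.2.1 K hK).const_smul c,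
    fun φ hφ hc => ?_⟩
  have e1 : ∀ f g : ℝ → ℂ, ∫ x, f x * (c • g) x = c * ∫ x, f x * g x := fun f g => by
    rw [← integral_const_mul]
    congr 1
    funext x
    simp only [Pi.smul_apply, smul_eq_mul]
    ring
  rw [e1, e1, hw.2.2 φ hφ hc]
  ring

/-- The Sobolev space `H²_k = {w ∈ H²_loc(ℝ) : w(x + 1) = e^{ik/h} w(x)}`. Its element `w` is
represented by the triple `(w, w', w'')` of weak derivatives restricted to `[0,1)`, so that the norm
inherited from the product `L2k × L2k × L2k` is (equivalent to) the `H²` norm over a period. -/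
def H2kSubmodule (k : ℂ) (h : ℝ) : Submodule ℂ (L2k × L2k × L2k) where
  carrier := {p | ∃ w w' w'' : ℝ → ℂ,
    IsQuasiPeriodic k h w ∧ HasWeakDerivL2loc w w' ∧ HasWeakDerivL2loc w' w'' ∧
    p.1 =ᵐ[cell] w ∧ p.2.1 =ᵐ[cell] w' ∧ p.2.2 =ᵐ[cell] w''}
  zero_mem' := ⟨fun _ => 0, fun _ => 0, fun _ => 0, fun _ => by simp, .zero, .zero,
    Lp.coeFn_zero _ _ _, Lp.coeFn_zero _ _ _, Lp.coeFn_zero _ _ _⟩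
  add_mem' := by
    rintro p q ⟨v, v', v'', h1, h2, h3, h4, h5, h6⟩ ⟨w, w', w'', g1, g2, g3, g4, g5, g6⟩
    exact ⟨v + w, v' + w', v'' + w'', fun x => by simp only [Pi.add_apply, h1 x, g1 x]; ring,
      h2.add g2, h3.add g3, (Lp.coeFn_add _ _).trans (h4.add g4),
      (Lp.coeFn_add _ _).trans (h5.add g5), (Lp.coeFn_add _ _).trans (h6.add g6)⟩
  smul_mem' := by
    rintro c p ⟨v, v', v'', h1, h2, h3, h4, h5, h6⟩
    exact ⟨c • v, c • v', c • v'',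
      fun x => by simp only [Pi.smul_apply, smul_eq_mul, h1 x]; ring,
      h2.const_smul c, h3.const_smul c, (Lp.coeFn_smul _ _).trans (h4.const_smul c),
      (Lp.coeFn_smul _ _).trans (h5.const_smul c), (Lp.coeFn_smul _ _).trans (h6.const_smul c)⟩

/-- The Sobolev space `H²_k` as a normed space, see `H2kSubmodule`. -/
def H2k (k : ℂ) (h : ℝ) : Type := H2kSubmodule k h

instance (k : ℂ) (h : ℝ) : NormedAddCommGroup (H2k k h) :=
  inferInstanceAs (NormedAddCommGroup (H2kSubmodule k h))

instance (k : ℂ) (h : ℝ) : NormedSpace ℂ (H2k k h) :=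
  inferInstanceAs (NormedSpace ℂ (H2kSubmodule k h))

/-- The map `w ↦ (w, w', w'')`. -/
def H2k.triple (k : ℂ) (h : ℝ) : H2k k h →L[ℂ] L2k × L2k × L2k :=
  (H2kSubmodule k h).subtypeL

/-- The inclusion `H²_k → L²_k`, `w ↦ w`. -/
def incl (k : ℂ) (h : ℝ) : H2k k h →L[ℂ] L2k :=
  ContinuousLinearMap.fst ℂ L2k (L2k × L2k) ∘L H2k.triple k h

/-- The second derivative `H²_k → L²_k`, `w ↦ w''`. -/
def secondDeriv (k : ℂ) (h : ℝ) : H2k k h →L[ℂ] L2k :=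
  ContinuousLinearMap.snd ℂ L2k L2k ∘L ContinuousLinearMap.snd ℂ L2k (L2k × L2k) ∘L
    H2k.triple k h

/-! ### The operator `P_k(α,h)` -/

theorem memLp_potential {W : ℂ → ℂ} (hW : Differentiable ℂ W) :
    MemLp (fun x : ℝ => W (x : ℂ) ^ 2) ∞ cell := by
  have hc : Continuous fun x : ℝ => W (x : ℂ) ^ 2 :=
    (hW.continuous.comp Complex.continuous_ofReal).pow 2
  obtain ⟨C, hC⟩ := (isCompact_Icc (a := (0 : ℝ)) (b := 1)).exists_bound_of_continuousOn
    hc.continuousOn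
  refine memLp_top_of_bound hc.aestronglyMeasurable C ?_
  filter_upwards [ae_restrict_mem measurableSet_Ico] with x hx
  exact hC x ⟨hx.1, hx.2.le⟩

/-- Multiplication by the function `x ↦ W(x)²` on `L²_k`. -/
def mulPotential {W : ℂ → ℂ} (hW : Differentiable ℂ W) : L2k →L[ℂ] L2k :=
  (ContinuousLinearMap.mul ℂ ℂ).holderL cell ∞ 2 2 ((memLp_potential hW).toLp _)

/-- `P_k(α,h) = (h D_x)² - α² W² : H²_k → L²_k`, where `(h D_x)² w = -h² w''`. -/
def opP {W : ℂ → ℂ} (hW : Differentiable ℂ W) (k : ℂ) (h : ℝ) (α : ℂ) : H2k k h →L[ℂ] L2k :=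
  (-(h : ℂ) ^ 2) • secondDeriv k h - α ^ 2 • (mulPotential hW ∘L incl k h)

/-- `∂_β P_k(β,h) = -2 β W²`, as a bounded operator on `L²_k`. -/
def derivOpP {W : ℂ → ℂ} (hW : Differentiable ℂ W) (β : ℂ) : L2k →L[ℂ] L2k :=
  (-(2 * β)) • mulPotential hW

theorem mulPotential_apply {W : ℂ → ℂ} (hW : Differentiable ℂ W) (u : L2k) :
    mulPotential hW u =ᵐ[cell] fun x => W (x : ℂ) ^ 2 * u x := by
  have h1 := (ContinuousLinearMap.mul ℂ ℂ).coeFn_holder (r := 2) ((memLp_potential hW).toLp _) u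
  filter_upwards [h1, (memLp_potential hW).coeFn_toLp] with x hx hx'
  rw [← hx']
  exact hx

theorem hasDerivAt_opP {W : ℂ → ℂ} (hW : Differentiable ℂ W) (k : ℂ) (h : ℝ) (β : ℂ) :
    HasDerivAt (opP hW k h) (derivOpP hW β ∘L incl k h) β := by
  have h1 := ((hasDerivAt_pow 2 β).smul_const (mulPotential hW ∘L incl k h)).const_sub
    ((-(h : ℂ) ^ 2) • secondDeriv k h)
  refine h1.congr_deriv ?_
  simp [derivOpP, ContinuousLinearMap.smul_comp, neg_smul]

/-! ### Meromorphic families of operators, finite-rank traces, multiplicities -/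

/-- `B` is a meromorphic family of operators on `ℂ`: near each point it is the sum of a holomorphic
family and of a principal part with finitely many terms, all of finite rank. -/
def IsMeromorphicFamily {E F : Type*} [NormedAddCommGroup E] [NormedSpace ℂ E]
    [NormedAddCommGroup F] [NormedSpace ℂ F] (B : ℂ → E →L[ℂ] F) : Prop :=
  ∀ a : ℂ, ∃ (N : ℕ) (A : Fin N → E →L[ℂ] F) (B₀ : ℂ → E →L[ℂ] F),
    (∀ j, FiniteDimensional ℂ (LinearMap.range (A j : E →ₗ[ℂ] F))) ∧ AnalyticAt ℂ B₀ a ∧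
    ∀ᶠ z in 𝓝[≠] a, B z = B₀ z + ∑ j : Fin N, ((z - a) ^ ((j : ℕ) + 1))⁻¹ • A j

/-- `α ↦ P_k(α,h)⁻¹ : L²_k → H²_k` is meromorphic: `P_k(α,h)` is invertible off a discrete set and
the inverse is a meromorphic family of operators. -/
def InverseIsMeromorphic {W : ℂ → ℂ} (hW : Differentiable ℂ W) (k : ℂ) (h : ℝ) : Prop :=
  (∀ a : ℂ, ∀ᶠ z in 𝓝[≠] a, (opP hW k h z).IsInvertible) ∧
    IsMeromorphicFamily fun z => (opP hW k h z).inverse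

/-- The trace of an operator of finite rank: the trace of its restriction to its range. -/
def finiteRankTrace {E : Type*} [AddCommGroup E] [Module ℂ E] (T : E →ₗ[ℂ] E) : ℂ :=
  LinearMap.trace ℂ (LinearMap.range T) (T.rangeRestrict ∘ₗ (LinearMap.range T).subtype)

/-- `P_k(β,h)⁻¹ ∂_β P_k(β,h)` as an operator on `L²_k`. -/
def logDerivOp {W : ℂ → ℂ} (hW : Differentiable ℂ W) (k : ℂ) (h : ℝ) (β : ℂ) : L2k →L[ℂ] L2k :=
  incl k h ∘L (opP hW k h β).inverse ∘L derivOpP hW β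

/-- `(1 / 2πi) ∮ P_k(β,h)⁻¹ ∂_β P_k(β,h) dβ` over the circle with centre `c` and radius `r`. -/
def contourOp {W : ℂ → ℂ} (hW : Differentiable ℂ W) (k : ℂ) (h : ℝ) (c : ℂ) (r : ℝ) :
    L2k →L[ℂ] L2k :=
  (2 * Real.pi * Complex.I : ℂ)⁻¹ • ∮ β in C(c, r), logDerivOp hW k h β

/-- The circle with centre `c` and radius `r` encloses `α`, and the closed disc that it bounds
contains no point other than `α` at which `Good` fails. -/
def IsolatingCircle (Good : ℂ → Prop) (α c : ℂ) (r : ℝ) : Prop :=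
  α ∈ Metric.ball c r ∧ ∀ β ∈ Metric.closedBall c r, β ≠ α → Good β

/-- `m_h(α,k) = m`, where
`m_h(α,k) = (1 / 2πi) tr_{L²_k} ∮_α P_k(β,h)⁻¹ ∂_β P_k(β,h) dβ`:
circles enclosing `α` as the only possible pole exist, and for each of them the integral exists, is
an operator of finite rank and has trace `m`. -/
def HasOperatorMultiplicity {W : ℂ → ℂ} (hW : Differentiable ℂ W) (k : ℂ) (h : ℝ) (α m : ℂ) :
    Prop :=
  (∃ c r, IsolatingCircle (fun β => (opP hW k h β).IsInvertible) α c r) ∧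
  ∀ c r, IsolatingCircle (fun β => (opP hW k h β).IsInvertible) α c r →
    CircleIntegrable (logDerivOp hW k h) c r ∧
    FiniteDimensional ℂ (LinearMap.range (contourOp hW k h c r : L2k →ₗ[ℂ] L2k)) ∧
    finiteRankTrace (contourOp hW k h c r : L2k →ₗ[ℂ] L2k) = m

/-- `(1 / 2πi) tr_{ℂ²} ∮_α (ℳ_{z₀+1←z₀}(β,h) - e^{ik/h})⁻¹ ∂_β ℳ_{z₀+1←z₀}(β,h) dβ = m`:
circles enclosing `α` as the only possible pole exist, and for each of them the integral exists and
has trace `m`. -/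
def HasMonodromyMultiplicity (W : ℂ → ℂ) (k : ℂ) (h : ℝ) (z₀ α m : ℂ) : Prop :=
  (∃ c r, IsolatingCircle (fun β => (shiftedMonodromy W k h z₀ β).det ≠ 0) α c r) ∧
  ∀ c r, IsolatingCircle (fun β => (shiftedMonodromy W k h z₀ β).det ≠ 0) α c r →
    (∀ i j, CircleIntegrable
      (fun β => ((shiftedMonodromy W k h z₀ β)⁻¹ * derivMonodromy W h z₀ β) i j) c r) ∧
    monodromyTrace W k h z₀ c r = m

end PeriodicTransition

end

noncomputable section

namespace PeriodicTransition

/-! ### Dyson series for `u'' = μ q u` -/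

/-! Put q = W², μ = -β²/h² and ρ = e^{ik/h}. The equation P(β)u = 0 reads u'' = μqu; let Φ be its
fundamental matrix with Φ(0) = 1. Since q has period 1, the matrix C(z) of Cauchy data of the
fundamental solutions satisfies C(z+1) = C(z)Φ(1). Hence ℳ = C(z₀)Φ(1)C(z₀)⁻¹, and det(ℳ - ρ) =
det(Φ(1) - ρ) =: d(β) is an entire function that does not depend on z₀ (`det_shiftedMonodromy`).
Both sides of each assertion are expressed through d.

The problem w'' = μqw + g is solved by variation of constants. If c is the Cauchy data at 0 and ℓ(g)
the increment of the varied constants over one period, then w is quasi-periodic precisely when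
Φ(1)(c + ℓ(g)) = ρc, which for d ≠ 0 means c = -d⁻¹ adj(Φ(1) - ρ) Φ(1) ℓ(g). So P_k is invertible
exactly where d ≠ 0 (`isInvertible_opP_iff`), and there its inverse, regarded as an operator on
L²_k, is -h⁻²(V + d⁻¹ ∑ sᵢ ⊗ φᵢ), with a Volterra operator V, functionals sᵢ and fundamental
solutions φᵢ that are all entire in β (`incl_comp_inverse`). Thus all poles have finite rank; a
resolvent identity carries this over to values in H²_k (`inverse_eq_resolvent`).

For the multiplicities, P⁻¹∂P is, up to an entire summand, again of the form d⁻¹ ∑ sᵢ ⊗ φᵢ with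
modified sᵢ. The trace of its contour integral is the contour integral of d⁻¹ ∑ sᵢ(φᵢ)
(`hasFiniteRankTrace_circleIntegral`). Duhamel's formula for ∂_μ Φ(1) (`hasDerivAt_monodromy`) and
Jacobi's formula for the determinant give ∑ sᵢ(φᵢ) = d' (`sum_numerator_eq_deriv`). On the matrix
side Jacobi's formula gives tr((ℳ - ρ)⁻¹∂ℳ) = d'/d. By the argument principle
(`circleIntegral_deriv_div`) both traces equal the order of vanishing of d. -/

theorem exists_primitive {f : ℂ → ℂ} (hf : Differentiable ℂ f) :
    ∃ g : ℂ → ℂ, g 0 = 0 ∧ ∀ z, HasDerivAt g (f z) z := by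
  obtain ⟨g, h0, h1⟩ := hf.isExactOn_univ.with_val_at 0 0
  exact ⟨g, h0, fun z => h1 z (Set.mem_univ z)⟩

open Classical in
/-- The primitive of an entire function that vanishes at `0`. -/
def primitive (f : ℂ → ℂ) : ℂ → ℂ :=
  if hf : Differentiable ℂ f then (exists_primitive hf).choose else 0

section primitive

variable {f : ℂ → ℂ} (hf : Differentiable ℂ f)

include hf

theorem primitive_zero : primitive f 0 = 0 := by
  rw [primitive, dif_pos hf]
  exact (exists_primitive hf).choose_spec.1

theorem hasDerivAt_primitive (z : ℂ) : HasDerivAt (primitive f) (f z) z := by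
  rw [primitive, dif_pos hf]
  exact (exists_primitive hf).choose_spec.2 z

theorem differentiable_primitive : Differentiable ℂ (primitive f) :=
  fun z => (hasDerivAt_primitive hf z).differentiableAt

theorem deriv_primitive : deriv (primitive f) = f :=
  funext fun z => (hasDerivAt_primitive hf z).deriv

/-- Integration along the segment from 0 to z gains a factor 1/L in the norm with weight e^{-L|z|}.
With L large, each step of the Dyson series then contracts on a disc of any radius, and no
factorials have to be tracked. -/
theorem norm_primitive_le {K L R : ℝ} (hK : 0 ≤ K) (hL : 0 < L)
    (hb : ∀ z, ‖z‖ ≤ R → ‖f z‖ ≤ K * Real.exp (L * ‖z‖)) (z : ℂ) (hz : ‖z‖ ≤ R) :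
    ‖primitive f z‖ ≤ K / L * Real.exp (L * ‖z‖) := by
  have hder : ∀ t : ℝ, HasDerivAt (fun t : ℝ => primitive f (t * z)) (f (t * z) * z) t := by
    intro t
    have h1 : HasDerivAt (fun t : ℝ => (t : ℂ) * z) z t := by
      simpa using (Complex.ofRealCLM.hasDerivAt (x := t)).mul_const z
    exact (hasDerivAt_primitive hf (t * z)).comp t h1
  have hB : ∀ t : ℝ, HasDerivAt (fun t : ℝ => K / L * Real.exp (L * (t * ‖z‖)))
      (K * Real.exp (L * (t * ‖z‖)) * ‖z‖) t := by
    intro t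
    have h1 : HasDerivAt (fun t : ℝ => L * (t * ‖z‖)) (L * ‖z‖) t := by
      simpa using ((hasDerivAt_id t).mul_const ‖z‖).const_mul L
    refine (h1.exp.const_mul (K / L)).congr_deriv ?_
    field_simp
  have := image_norm_le_of_norm_deriv_right_le_deriv_boundary (a := 0) (b := 1)
    (f := fun t : ℝ => primitive f (t * z)) (f' := fun t : ℝ => f (t * z) * z)
    (fun t _ => (hder t).continuousAt.continuousWithinAt)
    (fun t _ => (hder t).hasDerivWithinAt)
    (by simp only [Complex.ofReal_zero, zero_mul, primitive_zero hf, norm_zero]; positivity) hB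
    (fun t ht => by
      have hn : ‖(t : ℂ) * z‖ = t * ‖z‖ := by simp [abs_of_nonneg ht.1]
      rw [norm_mul]
      gcongr
      rw [← hn]
      refine hb _ (le_trans ?_ hz)
      rw [hn]
      exact mul_le_of_le_one_left (norm_nonneg z) ht.2.le) (x := 1) (by simp)
  simpa using this

end primitive

/-- The terms of the Dyson series with initial term `u₀`. -/
def dyson (q u₀ : ℂ → ℂ) : ℕ → ℂ → ℂ
  | 0 => u₀
  | n + 1 => primitive (primitive fun z => q z * dyson q u₀ n z)

/-- The solution of `u'' = μ q u` with the initial data of the affine function `u₀` at `0`. -/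
def sol (q u₀ : ℂ → ℂ) (μ z : ℂ) : ℂ := ∑' n, μ ^ n * dyson q u₀ n z

section dyson

variable {q u₀ : ℂ → ℂ} (hq : Differentiable ℂ q) (hu : Differentiable ℂ u₀)

include hq hu

theorem differentiable_dyson (n : ℕ) : Differentiable ℂ (dyson q u₀ n) := by
  induction n with
  | zero => exact hu
  | succ n ih => exact differentiable_primitive (differentiable_primitive (hq.fun_mul ih))

theorem deriv_dyson_succ (n : ℕ) :
    deriv (dyson q u₀ (n + 1)) = primitive fun z => q z * dyson q u₀ n z :=
  deriv_primitive (differentiable_primitive (hq.fun_mul (differentiable_dyson hq hu n)))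

theorem differentiable_deriv_dyson (n : ℕ) : Differentiable ℂ (deriv (dyson q u₀ n)) :=
  fun z => ((differentiable_dyson hq hu n).analyticAt z).deriv.differentiableAt

theorem deriv_deriv_dyson_succ (n : ℕ) :
    deriv (deriv (dyson q u₀ (n + 1))) = fun z => q z * dyson q u₀ n z := by
  rw [deriv_dyson_succ hq hu n]
  exact deriv_primitive (hq.fun_mul (differentiable_dyson hq hu n))

theorem exists_dyson_bound (R m : ℝ) (hm : 0 ≤ m) : ∃ K : ℝ, ∀ n z, ‖z‖ ≤ R →
    m ^ n * ‖dyson q u₀ n z‖ ≤ K * (1 / 2) ^ n ∧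
    m ^ n * ‖deriv (dyson q u₀ n) z‖ ≤ K * (1 / 2) ^ n := by
  have hbd : ∀ f : ℂ → ℂ, Continuous f → ∃ C : ℝ, 0 ≤ C ∧ ∀ z, ‖z‖ ≤ R → ‖f z‖ ≤ C := by
    intro f hf
    obtain ⟨C, hC⟩ := (isCompact_closedBall (0 : ℂ) R).exists_bound_of_continuousOn hf.continuousOn
    exact ⟨max C 0, le_max_right _ _, fun z hz =>
      (hC z (by simpa using hz)).trans (le_max_left _ _)⟩
  obtain ⟨C, hC0, hC⟩ := hbd q hq.continuous
  obtain ⟨A, hA0, hA⟩ := hbd u₀ hu.continuous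
  obtain ⟨B, hB0, hB⟩ := hbd (deriv u₀) (differentiable_deriv_dyson hq hu 0).continuous
  -- One step of the series costs mC ≤ L/2 and gains 1/L twice. The first gain yields the factor
  -- 1/2; the second is discarded, since L ≥ 1.
  set L : ℝ := 2 * m * C + 1 with hLdef
  have hmC : 0 ≤ m * C := mul_nonneg hm hC0
  have hL1 : 1 ≤ L := by rw [hLdef]; nlinarith
  have hL0 : 0 < L := by linarith
  have hmain : ∀ n z, ‖z‖ ≤ R → m ^ n * ‖dyson q u₀ n z‖ ≤ A * (1 / 2) ^ n * Real.exp (L * ‖z‖) ∧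
      m ^ (n + 1) * ‖deriv (dyson q u₀ (n + 1)) z‖ ≤
        L * A * (1 / 2) ^ (n + 1) * Real.exp (L * ‖z‖) := by
    have step : ∀ n, (∀ z, ‖z‖ ≤ R →
        m ^ n * ‖dyson q u₀ n z‖ ≤ A * (1 / 2) ^ n * Real.exp (L * ‖z‖)) → ∀ z, ‖z‖ ≤ R →
        m ^ (n + 1) * ‖deriv (dyson q u₀ (n + 1)) z‖ ≤
          L * A * (1 / 2) ^ (n + 1) * Real.exp (L * ‖z‖) ∧
        m ^ (n + 1) * ‖dyson q u₀ (n + 1) z‖ ≤ A * (1 / 2) ^ (n + 1) * Real.exp (L * ‖z‖) := by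
      intro n ih
      have hf : Differentiable ℂ fun z => (m : ℂ) ^ (n + 1) * (q z * dyson q u₀ n z) :=
        (hq.fun_mul (differentiable_dyson hq hu n)).const_mul _
      have b0 : ∀ z, ‖z‖ ≤ R → ‖m ^ (n + 1) * (q z * dyson q u₀ n z)‖ ≤
          m * C * (A * (1 / 2) ^ n) * Real.exp (L * ‖z‖) := by
        intro z hz
        rw [norm_mul, norm_mul, norm_pow, Complex.norm_real, Real.norm_of_nonneg hm]
        calc m ^ (n + 1) * (‖q z‖ * ‖dyson q u₀ n z‖)
            = m * ‖q z‖ * (m ^ n * ‖dyson q u₀ n z‖) := by ring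
          _ ≤ m * C * (A * (1 / 2) ^ n * Real.exp (L * ‖z‖)) := by
              exact mul_le_mul (by gcongr; exact hC z hz) (ih z hz) (by positivity) hmC
          _ = _ := by ring
      -- The power of m was put inside the integrals to estimate both primitives with one bound;
      -- homogeneity of `primitive` takes it out again.
      have hP : ∀ f : ℂ → ℂ, Differentiable ℂ f → ∀ c : ℂ,
          primitive (fun z => c * f z) = fun z => c * primitive f z := by
        intro f hf c
        have h1 : ∀ z, HasDerivAt (fun z => primitive (fun z => c * f z) z - c * primitive f z)
            0 z := fun z => by
          simpa using (hasDerivAt_primitive (hf.const_mul c) z).fun_sub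
            ((hasDerivAt_primitive hf z).const_mul c)
        funext z
        have := is_const_of_deriv_eq_zero (fun z => (h1 z).differentiableAt)
          (fun z => (h1 z).deriv) z 0
        simp only [primitive_zero hf, primitive_zero (hf.const_mul c)] at this
        linear_combination this
      have hf0 := hq.fun_mul (differentiable_dyson hq hu n)
      have b1 := norm_primitive_le hf (by positivity) hL0 b0
      have hf1 := differentiable_primitive hf
      have b2 := norm_primitive_le hf1 (by positivity) hL0 b1
      rw [hP _ hf0, hP _ (differentiable_primitive hf0)] at b2
      rw [hP _ hf0] at b1
      simp only [norm_mul, norm_pow, Complex.norm_real, Real.norm_of_nonneg hm] at b1 b2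
      have k1 : m * C * (A * (1 / 2) ^ n) ≤ A * (1 / 2) ^ (n + 1) * L := by
        have : m * C ≤ L / 2 := by rw [hLdef]; linarith
        calc m * C * (A * (1 / 2) ^ n) ≤ L / 2 * (A * (1 / 2) ^ n) := by gcongr
          _ = _ := by ring
      refine fun z hz => ⟨?_, ?_⟩
      · rw [deriv_dyson_succ hq hu]
        refine (b1 z hz).trans ?_
        gcongr
        rw [div_le_iff₀ hL0]
        calc _ ≤ A * (1 / 2) ^ (n + 1) * L := k1
          _ ≤ A * (1 / 2) ^ (n + 1) * L * L := le_mul_of_one_le_right (by positivity) hL1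
          _ = _ := by ring
      · refine (b2 z hz).trans ?_
        gcongr
        rw [div_le_iff₀ hL0, div_le_iff₀ hL0]
        exact k1.trans (le_mul_of_one_le_right (by positivity) hL1)
    have hind : ∀ n z, ‖z‖ ≤ R →
        m ^ n * ‖dyson q u₀ n z‖ ≤ A * (1 / 2) ^ n * Real.exp (L * ‖z‖) := by
      intro n
      induction n with
      | zero =>
        intro z hz
        have := hA z hz
        have h1 : 1 ≤ Real.exp (L * ‖z‖) := Real.one_le_exp (by positivity)
        simp only [pow_zero, one_mul, mul_one, dyson]
        nlinarith
      | succ n ih => exact fun z hz => (step n ih z hz).2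
    exact fun n z hz => ⟨hind n z hz, (step n (hind n) z hz).1⟩
  have he : ∀ z : ℂ, ‖z‖ ≤ R → Real.exp (L * ‖z‖) ≤ Real.exp (L * R) := fun z hz => by gcongr
  refine ⟨B + L * A * Real.exp (L * R), fun n z hz => ⟨?_, ?_⟩⟩
  · calc _ ≤ A * (1 / 2) ^ n * Real.exp (L * ‖z‖) := (hmain n z hz).1
      _ ≤ A * (1 / 2) ^ n * Real.exp (L * R) := by gcongr
      _ ≤ L * (A * (1 / 2) ^ n * Real.exp (L * R)) := le_mul_of_one_le_left (by positivity) hL1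
      _ = L * A * Real.exp (L * R) * (1 / 2) ^ n := by ring
      _ ≤ _ := by gcongr; linarith
  · cases n with
    | zero =>
      simp only [pow_zero, one_mul, mul_one, dyson]
      have := hB z hz
      have : 0 ≤ L * A * Real.exp (L * R) := by positivity
      linarith
    | succ n =>
      calc _ ≤ L * A * (1 / 2) ^ (n + 1) * Real.exp (L * ‖z‖) := (hmain n z hz).2
        _ ≤ L * A * (1 / 2) ^ (n + 1) * Real.exp (L * R) := by gcongr
        _ = L * A * Real.exp (L * R) * (1 / 2) ^ (n + 1) := by ring
        _ ≤ _ := by gcongr; linarith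

theorem exists_summable_dyson_bound (R m : ℝ) : ∃ b : ℕ → ℝ, Summable b ∧
    ∀ n z μ, ‖z‖ ≤ R → ‖μ‖ ≤ m → ‖μ ^ n * dyson q u₀ n z‖ ≤ b n ∧
      ‖μ ^ n * deriv (dyson q u₀ n) z‖ ≤ b n := by
  obtain ⟨K, hK⟩ := exists_dyson_bound hq hu R (max m 0) (le_max_right _ _)
  refine ⟨fun n => K * (1 / 2) ^ n, summable_geometric_two.mul_left K, fun n z μ hz hμ => ?_⟩
  have hp : ‖μ‖ ^ n ≤ (max m 0) ^ n := by gcongr; exact hμ.trans (le_max_left _ _)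
  rw [norm_mul, norm_mul, norm_pow]
  exact ⟨(mul_le_mul_of_nonneg_right hp (norm_nonneg _)).trans (hK n z hz).1,
    (mul_le_mul_of_nonneg_right hp (norm_nonneg _)).trans (hK n z hz).2⟩

theorem differentiable_sol (μ : ℂ) : Differentiable ℂ (sol q u₀ μ) := by
  intro z
  obtain ⟨b, hb, hle⟩ := exists_summable_dyson_bound hq hu (‖z‖ + 1) ‖μ‖
  have := Complex.differentiableOn_tsum_of_summable_norm (U := Metric.ball 0 (‖z‖ + 1)) hb
    (F := fun n z => μ ^ n * dyson q u₀ n z)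
    (fun n => ((differentiable_dyson hq hu n).const_mul _).differentiableOn)
    Metric.isOpen_ball (fun n w hw => (hle n w μ (mem_ball_zero_iff.1 hw).le le_rfl).1)
  exact this.differentiableAt (Metric.isOpen_ball.mem_nhds (by simp))

theorem hasSum_deriv_sol (μ z : ℂ) :
    HasSum (fun n => μ ^ n * deriv (dyson q u₀ n) z) (deriv (sol q u₀ μ) z) := by
  obtain ⟨b, hb, hle⟩ := exists_summable_dyson_bound hq hu (‖z‖ + 1) ‖μ‖
  have := Complex.hasSum_deriv_of_summable_norm (U := Metric.ball 0 (‖z‖ + 1)) (z := z) hb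
    (F := fun n z => μ ^ n * dyson q u₀ n z)
    (fun n => ((differentiable_dyson hq hu n).const_mul _).differentiableOn)
    Metric.isOpen_ball (fun n w hw => (hle n w μ (mem_ball_zero_iff.1 hw).le le_rfl).1) (by simp)
  refine this.congr_fun fun n => ?_
  rw [deriv_const_mul _ (differentiable_dyson hq hu n z)]

theorem hasSum_sol (μ z : ℂ) : HasSum (fun n => μ ^ n * dyson q u₀ n z) (sol q u₀ μ z) := by
  obtain ⟨b, hb, hle⟩ := exists_summable_dyson_bound hq hu ‖z‖ ‖μ‖
  exact (Summable.of_norm_bounded hb fun n => (hle n z μ le_rfl le_rfl).1).hasSum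

/-- Two termwise differentiations shift the index: term n + 1 becomes μq times term n, and term 0
drops out because u₀ is affine. -/
theorem hasDerivAt_deriv_sol (h0 : deriv (deriv u₀) = 0) (μ z : ℂ) :
    HasDerivAt (deriv (sol q u₀ μ)) (μ * q z * sol q u₀ μ z) z := by
  obtain ⟨b, hb, hle⟩ := exists_summable_dyson_bound hq hu (‖z‖ + 1) ‖μ‖
  have he : deriv (sol q u₀ μ) = fun z => ∑' n, μ ^ n * deriv (dyson q u₀ n) z :=
    funext fun z => (hasSum_deriv_sol hq hu μ z).tsum_eq.symm
  have h1 := Complex.hasSum_deriv_of_summable_norm (U := Metric.ball 0 (‖z‖ + 1)) (z := z) hb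
    (F := fun n z => μ ^ n * deriv (dyson q u₀ n) z)
    (fun n => ((differentiable_deriv_dyson hq hu n).const_mul _).differentiableOn)
    Metric.isOpen_ball (fun n w hw => (hle n w μ (mem_ball_zero_iff.1 hw).le le_rfl).2) (by simp)
  rw [← he] at h1
  have h2 : HasSum (fun n => deriv (fun z => μ ^ n * deriv (dyson q u₀ n) z) z)
      (μ * q z * sol q u₀ μ z) := by
    rw [← hasSum_nat_add_iff' 1]
    simp only [Finset.range_one, Finset.sum_singleton]
    have e0 : deriv (fun z => μ ^ 0 * deriv (dyson q u₀ 0) z) z = 0 := by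
      simpa [dyson] using congrFun h0 z
    rw [e0, sub_zero]
    refine ((hasSum_sol hq hu μ z).mul_left (μ * q z)).congr_fun fun n => ?_
    rw [deriv_const_mul _ (differentiable_deriv_dyson hq hu _ z), deriv_deriv_dyson_succ hq hu]
    ring
  have hd : DifferentiableAt ℂ (deriv (sol q u₀ μ)) z :=
    ((differentiable_sol hq hu μ).analyticAt z).deriv.differentiableAt
  rw [h2.unique h1]
  exact hd.hasDerivAt

theorem sol_zero (μ : ℂ) : sol q u₀ μ 0 = u₀ 0 := by
  refine (hasSum_sol hq hu μ 0).unique ?_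
  convert hasSum_single 0 ?_ using 1
  · simp [dyson]
  · rintro (_ | n) hn
    · exact absurd rfl hn
    · simp [dyson,
        primitive_zero (differentiable_primitive (hq.fun_mul (differentiable_dyson hq hu n)))]

theorem deriv_sol_zero (μ : ℂ) : deriv (sol q u₀ μ) 0 = deriv u₀ 0 := by
  refine (hasSum_deriv_sol hq hu μ 0).unique ?_
  convert hasSum_single 0 ?_ using 1
  · simp [dyson]
  · rintro (_ | n) hn
    · exact absurd rfl hn
    · simp [deriv_dyson_succ hq hu, primitive_zero (hq.fun_mul (differentiable_dyson hq hu n))]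

theorem differentiable_sol_param (z : ℂ) : Differentiable ℂ fun μ => sol q u₀ μ z := by
  intro μ
  obtain ⟨b, hb, hle⟩ := exists_summable_dyson_bound hq hu ‖z‖ (‖μ‖ + 1)
  have := Complex.differentiableOn_tsum_of_summable_norm (U := Metric.ball 0 (‖μ‖ + 1)) hb
    (F := fun n μ => μ ^ n * dyson q u₀ n z) (fun n => by fun_prop)
    Metric.isOpen_ball (fun n w hw => (hle n z w le_rfl (mem_ball_zero_iff.1 hw).le).1)
  exact this.differentiableAt (Metric.isOpen_ball.mem_nhds (by simp))

theorem differentiable_deriv_sol_param (z : ℂ) :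
    Differentiable ℂ fun μ => deriv (sol q u₀ μ) z := by
  intro μ
  obtain ⟨b, hb, hle⟩ := exists_summable_dyson_bound hq hu ‖z‖ (‖μ‖ + 1)
  have := Complex.differentiableOn_tsum_of_summable_norm (U := Metric.ball 0 (‖μ‖ + 1)) hb
    (F := fun n μ => μ ^ n * deriv (dyson q u₀ n) z) (fun n => by fun_prop)
    Metric.isOpen_ball (fun n w hw => (hle n z w le_rfl (mem_ball_zero_iff.1 hw).le).2)
  simp only [← (hasSum_deriv_sol hq hu _ z).tsum_eq]
  exact this.differentiableAt (Metric.isOpen_ball.mem_nhds (by simp))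

end dyson

/-! ### Fundamental solutions -/

/-- The solution of `u'' = μ q u` with `u(0) = 1`, `u'(0) = 0`. -/
def cosSol (q : ℂ → ℂ) (μ : ℂ) : ℂ → ℂ := sol q (fun _ => 1) μ

/-- The solution of `u'' = μ q u` with `u(0) = 0`, `u'(0) = 1`. -/
def sinSol (q : ℂ → ℂ) (μ : ℂ) : ℂ → ℂ := sol q (fun z => z) μ

theorem wronskian_const {q : ℂ → ℂ} (μ : ℂ) {u u' v v' : ℂ → ℂ} (hu : ∀ z, HasDerivAt u (u' z) z)
    (hu' : ∀ z, HasDerivAt u' (μ * q z * u z) z) (hv : ∀ z, HasDerivAt v (v' z) z)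
    (hv' : ∀ z, HasDerivAt v' (μ * q z * v z) z) (z : ℂ) :
    u z * v' z - u' z * v z = u 0 * v' 0 - u' 0 * v 0 := by
  have h1 : ∀ z, HasDerivAt (fun z => u z * v' z - u' z * v z) 0 z := fun z =>
    (((hu z).fun_mul (hv' z)).fun_sub ((hu' z).fun_mul (hv z))).congr_deriv (by ring)
  exact is_const_of_deriv_eq_zero (fun z => (h1 z).differentiableAt) (fun z => (h1 z).deriv) z 0

section fundamental

variable {q : ℂ → ℂ} (hq : Differentiable ℂ q) (μ : ℂ)

include hq

theorem differentiable_cosSol : Differentiable ℂ (cosSol q μ) :=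
  differentiable_sol hq (differentiable_const _) μ

theorem differentiable_sinSol : Differentiable ℂ (sinSol q μ) :=
  differentiable_sol hq differentiable_fun_id μ

theorem hasDerivAt_deriv_cosSol (z : ℂ) :
    HasDerivAt (deriv (cosSol q μ)) (μ * q z * cosSol q μ z) z :=
  hasDerivAt_deriv_sol hq (differentiable_const _) (by funext; simp) μ z

theorem hasDerivAt_deriv_sinSol (z : ℂ) :
    HasDerivAt (deriv (sinSol q μ)) (μ * q z * sinSol q μ z) z :=
  hasDerivAt_deriv_sol hq differentiable_fun_id (by funext; simp) μ z

theorem cosSol_zero : cosSol q μ 0 = 1 := sol_zero hq (differentiable_const _) μ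

theorem sinSol_zero : sinSol q μ 0 = 0 := sol_zero hq differentiable_fun_id μ

theorem deriv_cosSol_zero : deriv (cosSol q μ) 0 = 0 :=
  (deriv_sol_zero hq (differentiable_const (1 : ℂ)) μ).trans (deriv_const _ _)

theorem deriv_sinSol_zero : deriv (sinSol q μ) 0 = 1 :=
  (deriv_sol_zero hq differentiable_fun_id μ).trans (deriv_id _)

theorem wronskian_eq_one (z : ℂ) :
    cosSol q μ z * deriv (sinSol q μ) z - deriv (cosSol q μ) z * sinSol q μ z = 1 := by
  rw [wronskian_const μ (fun z => (differentiable_cosSol hq μ z).hasDerivAt)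
    (hasDerivAt_deriv_cosSol hq μ) (fun z => (differentiable_sinSol hq μ z).hasDerivAt)
    (hasDerivAt_deriv_sinSol hq μ) z, cosSol_zero hq, sinSol_zero hq, deriv_cosSol_zero hq,
    deriv_sinSol_zero hq]
  ring

/-- This serves as the uniqueness theorem for the Cauchy problem. The Wronskians of u with `sinSol`
and `cosSol` are the constants u(0) and -u'(0), and Cramer's rule with determinant 1 recovers u and
u' from them. -/
theorem eq_combination {u u' : ℂ → ℂ} (hu : ∀ z, HasDerivAt u (u' z) z)
    (hu' : ∀ z, HasDerivAt u' (μ * q z * u z) z) (z : ℂ) :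
    u z = u 0 * cosSol q μ z + u' 0 * sinSol q μ z ∧
      u' z = u 0 * deriv (cosSol q μ) z + u' 0 * deriv (sinSol q μ) z := by
  have h1 := wronskian_const μ hu hu' (fun z => (differentiable_sinSol hq μ z).hasDerivAt)
    (hasDerivAt_deriv_sinSol hq μ) z
  have h2 := wronskian_const μ hu hu' (fun z => (differentiable_cosSol hq μ z).hasDerivAt)
    (hasDerivAt_deriv_cosSol hq μ) z
  rw [sinSol_zero hq, deriv_sinSol_zero hq] at h1
  rw [cosSol_zero hq, deriv_cosSol_zero hq] at h2
  have h3 := wronskian_eq_one hq μ z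
  constructor
  · linear_combination cosSol q μ z * h1 - sinSol q μ z * h2 - u z * h3
  · linear_combination deriv (cosSol q μ) z * h1 - deriv (sinSol q μ) z * h2 - u' z * h3

/-- A translate by a period solves the same equation, so it expands in the fundamental system with
its Cauchy data at 0 as coefficients. -/
theorem cosSol_add_one (hper : ∀ z, q (z + 1) = q z) (z : ℂ) :
    cosSol q μ (z + 1) = cosSol q μ 1 * cosSol q μ z + deriv (cosSol q μ) 1 * sinSol q μ z ∧
    deriv (cosSol q μ) (z + 1) =
      cosSol q μ 1 * deriv (cosSol q μ) z + deriv (cosSol q μ) 1 * deriv (sinSol q μ) z := by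
  have := eq_combination hq μ (u := fun z => cosSol q μ (z + 1))
    (u' := fun z => deriv (cosSol q μ) (z + 1))
    (fun z => (differentiable_cosSol hq μ (z + 1)).hasDerivAt.comp_add_const z 1)
    (fun z => by
      simpa [hper] using (hasDerivAt_deriv_cosSol hq μ (z + 1)).comp_add_const z 1) z
  simpa using this

theorem sinSol_add_one (hper : ∀ z, q (z + 1) = q z) (z : ℂ) :
    sinSol q μ (z + 1) = sinSol q μ 1 * cosSol q μ z + deriv (sinSol q μ) 1 * sinSol q μ z ∧
    deriv (sinSol q μ) (z + 1) =
      sinSol q μ 1 * deriv (cosSol q μ) z + deriv (sinSol q μ) 1 * deriv (sinSol q μ) z := by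
  have := eq_combination hq μ (u := fun z => sinSol q μ (z + 1))
    (u' := fun z => deriv (sinSol q μ) (z + 1))
    (fun z => (differentiable_sinSol hq μ (z + 1)).hasDerivAt.comp_add_const z 1)
    (fun z => by
      simpa [hper] using (hasDerivAt_deriv_sinSol hq μ (z + 1)).comp_add_const z 1) z
  simpa using this

end fundamental

/-- The matrix of Cauchy data of the fundamental solutions, the derivatives multiplied by `κ`. -/
def cauchyMatrix (q : ℂ → ℂ) (κ μ z : ℂ) : Matrix (Fin 2) (Fin 2) ℂ :=
  !![cosSol q μ z, sinSol q μ z; κ * deriv (cosSol q μ) z, κ * deriv (sinSol q μ) z]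

/-- The monodromy matrix `Φ(1)` of the fundamental matrix `Φ` with `Φ(0) = 1`. -/
def monodromy (q : ℂ → ℂ) (μ : ℂ) : Matrix (Fin 2) (Fin 2) ℂ := cauchyMatrix q 1 μ 1

/-- The spectral parameter `μ = -β² / h²`. -/
def specParam (h : ℝ) (β : ℂ) : ℂ := -(β ^ 2) / (h : ℂ) ^ 2

/-- The Floquet multiplier `e^{ik/h}`. -/
def floquet (k : ℂ) (h : ℝ) : ℂ := Complex.exp (Complex.I * k / h)

/-- `det (Φ(1) - e^{ik/h})`. -/
def floquetDet (q : ℂ → ℂ) (k : ℂ) (h : ℝ) (β : ℂ) : ℂ :=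
  (monodromy q (specParam h β) - floquet k h • (1 : Matrix (Fin 2) (Fin 2) ℂ)).det

theorem differentiable_specParam (h : ℝ) : Differentiable ℂ (specParam h) := by
  unfold specParam; fun_prop

theorem differentiable_cauchyMatrix {q : ℂ → ℂ} (hq : Differentiable ℂ q) (κ z : ℂ) (i j : Fin 2) :
    Differentiable ℂ fun μ => cauchyMatrix q κ μ z i j := by
  have h1 := differentiable_sol_param hq (differentiable_const (1 : ℂ)) z
  have h2 := differentiable_sol_param hq differentiable_fun_id z
  have h3 := differentiable_deriv_sol_param hq (differentiable_const (1 : ℂ)) z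
  have h4 := differentiable_deriv_sol_param hq differentiable_fun_id z
  fin_cases i <;> fin_cases j
  exacts [h1, h2, h3.const_mul κ, h4.const_mul κ]

theorem det_cauchyMatrix {q : ℂ → ℂ} (hq : Differentiable ℂ q) (κ μ z : ℂ) :
    (cauchyMatrix q κ μ z).det = κ := by
  rw [cauchyMatrix, Matrix.det_fin_two_of]
  linear_combination κ * wronskian_eq_one hq μ z

/-- The solutions are the columns, so a change of the basis of solutions, such as translation by a
period, acts from the right. -/
theorem cauchyMatrix_add_one {q : ℂ → ℂ} (hq : Differentiable ℂ q) (hper : ∀ z, q (z + 1) = q z)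
    (κ μ z : ℂ) : cauchyMatrix q κ μ (z + 1) = cauchyMatrix q κ μ z * monodromy q μ := by
  obtain ⟨h1, h2⟩ := cosSol_add_one hq μ hper z
  obtain ⟨h3, h4⟩ := sinSol_add_one hq μ hper z
  ext i j
  fin_cases i <;> fin_cases j <;>
    simp [cauchyMatrix, monodromy, Matrix.mul_apply, Fin.sum_univ_two, h1, h2, h3, h4] <;> ring

/-! ### The transition matrix -/

section transition

variable {W : ℂ → ℂ} (hW : Differentiable ℂ W) {h : ℝ} (hh : 0 < h)

theorem hD_hD (u : ℂ → ℂ) (z : ℂ) : hD h (hD h u) z = -(h : ℂ) ^ 2 * deriv (deriv u) z := by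
  have : hD h u = fun z => ((h : ℂ) / Complex.I) * deriv u z := rfl
  rw [hD, this, deriv_const_mul_field]
  have hI := Complex.I_sq
  field_simp
  linear_combination (h : ℂ) ^ 2 * deriv (deriv u) z * hI

include hh in
theorem isEntireSolution_iff (β : ℂ) (u : ℂ → ℂ) : IsEntireSolution W β h u ↔
    Differentiable ℂ u ∧ ∀ z, HasDerivAt (deriv u) (specParam h β * W z ^ 2 * u z) z := by
  have hh' : (h : ℂ) ≠ 0 := by exact_mod_cast hh.ne'
  refine and_congr_right fun hu => forall_congr' fun z => ?_
  have hd : DifferentiableAt ℂ (deriv u) z := (hu.analyticAt z).deriv.differentiableAt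
  rw [hD_hD]
  constructor
  · intro H
    refine hd.hasDerivAt.congr_deriv ?_
    rw [specParam]
    field_simp
    linear_combination -H
  · intro H
    rw [H.deriv, specParam]
    field_simp
    ring

include hW hh

/-- Testing on the two fundamental solutions suffices, since every entire solution is a combination
of them. Existence and uniqueness of the transition matrix become invertibility of the matrix at z₀.
-/
theorem isTransitionMatrix_iff (β z₁ z₀ : ℂ) (M : Matrix (Fin 2) (Fin 2) ℂ) :
    IsTransitionMatrix W β h z₁ z₀ M ↔
      M * cauchyMatrix (fun z => W z ^ 2) ((h : ℂ) / Complex.I) (specParam h β) z₀ =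
        cauchyMatrix (fun z => W z ^ 2) ((h : ℂ) / Complex.I) (specParam h β) z₁ := by
  have hq : Differentiable ℂ fun z => W z ^ 2 := hW.fun_pow 2
  set μ := specParam h β
  set κ := (h : ℂ) / Complex.I
  constructor
  · intro H
    have h1 := H (cosSol (fun z => W z ^ 2) μ) ((isEntireSolution_iff hh β _).2
      ⟨differentiable_cosSol hq μ, hasDerivAt_deriv_cosSol hq μ⟩)
    have h2 := H (sinSol (fun z => W z ^ 2) μ) ((isEntireSolution_iff hh β _).2
      ⟨differentiable_sinSol hq μ, hasDerivAt_deriv_sinSol hq μ⟩)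
    ext i j
    fin_cases j
    · have := congrFun h1 i
      fin_cases i <;>
      simpa [cauchyData, cauchyMatrix, Matrix.mulVec, dotProduct, Matrix.mul_apply,
        Fin.sum_univ_two, hD, κ] using this.symm
    · have := congrFun h2 i
      fin_cases i <;>
      simpa [cauchyData, cauchyMatrix, Matrix.mulVec, dotProduct, Matrix.mul_apply,
        Fin.sum_univ_two, hD, κ] using this.symm
  · intro H u hu
    obtain ⟨hu1, hu2⟩ := (isEntireSolution_iff hh β u).1 hu
    have key : ∀ z, cauchyData h u z =
        cauchyMatrix (fun z => W z ^ 2) κ μ z *ᵥ ![u 0, deriv u 0] := by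
      intro z
      obtain ⟨h1, h2⟩ := eq_combination hq μ (fun z => (hu1 z).hasDerivAt) hu2 z
      ext i
      have hκ : hD h u z = κ * deriv u z := rfl
      fin_cases i
      · simp [cauchyData, cauchyMatrix, Matrix.mulVec, dotProduct, Fin.sum_univ_two]
        linear_combination h1
      · simp [cauchyData, cauchyMatrix, Matrix.mulVec, dotProduct, Fin.sum_univ_two, hκ]
        linear_combination κ * h2
    rw [key, key, Matrix.mulVec_mulVec, H]

theorem isUnit_det_cauchyMatrix (μ z : ℂ) :
    IsUnit (cauchyMatrix (fun z => W z ^ 2) ((h : ℂ) / Complex.I) μ z).det := by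
  rw [det_cauchyMatrix (hW.fun_pow 2), isUnit_iff_ne_zero]
  exact div_ne_zero (by exact_mod_cast hh.ne') Complex.I_ne_zero

theorem existsUnique_isTransitionMatrix (β z₁ z₀ : ℂ) :
    ∃! M, IsTransitionMatrix W β h z₁ z₀ M := by
  simp only [isTransitionMatrix_iff hW hh]
  have hu := isUnit_det_cauchyMatrix hW hh (specParam h β) z₀
  refine ⟨cauchyMatrix (fun z => W z ^ 2) ((h : ℂ) / Complex.I) (specParam h β) z₁ *
    (cauchyMatrix (fun z => W z ^ 2) ((h : ℂ) / Complex.I) (specParam h β) z₀)⁻¹,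
    Matrix.nonsing_inv_mul_cancel_right _ _ hu, fun M hM => ?_⟩
  rw [← hM, Matrix.mul_nonsing_inv_cancel_right _ _ hu]

theorem transitionMatrix_mul (β z₁ z₀ : ℂ) : transitionMatrix W β h z₁ z₀ *
    cauchyMatrix (fun z => W z ^ 2) ((h : ℂ) / Complex.I) (specParam h β) z₀ =
      cauchyMatrix (fun z => W z ^ 2) ((h : ℂ) / Complex.I) (specParam h β) z₁ :=
  (isTransitionMatrix_iff hW hh β z₁ z₀ _).1
    (Classical.epsilon_spec (existsUnique_isTransitionMatrix hW hh β z₁ z₀).exists)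

theorem differentiable_transitionMatrix (z₁ z₀ : ℂ) (i j : Fin 2) :
    Differentiable ℂ fun β => transitionMatrix W β h z₁ z₀ i j := by
  have hq : Differentiable ℂ fun z => W z ^ 2 := hW.fun_pow 2
  set κ := (h : ℂ) / Complex.I
  -- The determinant of the Cauchy matrix is the constant κ, so its inverse is κ⁻¹ times the
  -- adjugate, which is visibly entire in β.
  have e : ∀ β, transitionMatrix W β h z₁ z₀ =
      cauchyMatrix (fun z => W z ^ 2) κ (specParam h β) z₁ *
        (κ⁻¹ • (cauchyMatrix (fun z => W z ^ 2) κ (specParam h β) z₀).adjugate) := by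
    intro β
    rw [← transitionMatrix_mul hW hh, Matrix.mul_assoc, Matrix.mul_smul, Matrix.mul_adjugate,
      det_cauchyMatrix hq, smul_smul, inv_mul_cancel₀, one_smul, Matrix.mul_one]
    have := (isUnit_det_cauchyMatrix hW hh (specParam h β) z₀).ne_zero
    rwa [det_cauchyMatrix hq] at this
  have hd : ∀ z i j, Differentiable ℂ fun β =>
      cauchyMatrix (fun z => W z ^ 2) κ (specParam h β) z i j := fun z i j =>
    (differentiable_cauchyMatrix hq κ z i j).comp (differentiable_specParam h)
  simp only [e, Matrix.mul_apply, Fin.sum_univ_two, Matrix.smul_apply, Matrix.adjugate_fin_two,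
    smul_eq_mul]
  fin_cases j <;> simp <;> fun_prop

/-- With C the Cauchy matrix at z₀, periodicity gives ℳC = CΦ(1), hence (ℳ - ρ)C = C(Φ(1) - ρ);
taking determinants, det C ≠ 0 cancels. -/
theorem det_shiftedMonodromy (hper : ∀ z, W (z + 1) = W z) (k z₀ β : ℂ) :
    (shiftedMonodromy W k h z₀ β).det = floquetDet (fun z => W z ^ 2) k h β := by
  have hu := isUnit_det_cauchyMatrix hW hh (specParam h β) z₀
  have h1 := transitionMatrix_mul hW hh β (z₀ + 1) z₀
  rw [cauchyMatrix_add_one (hW.fun_pow 2) (fun z => by simp [hper])] at h1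
  refine mul_right_cancel₀ hu.ne_zero ?_
  rw [← Matrix.det_mul, mul_comm, floquetDet, ← Matrix.det_mul, shiftedMonodromy, sub_mul, mul_sub,
    h1, floquet]
  simp

end transition

theorem differentiable_floquetDet {q : ℂ → ℂ} (hq : Differentiable ℂ q) (k : ℂ) (h : ℝ) :
    Differentiable ℂ (floquetDet q k h) := by
  have hd : ∀ i j, Differentiable ℂ fun β => monodromy q (specParam h β) i j := fun i j =>
    (differentiable_cauchyMatrix hq 1 1 i j).comp (differentiable_specParam h)
  unfold floquetDet
  simp only [Matrix.det_fin_two, Matrix.sub_apply]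
  fun_prop

/-- Jacobi's formula for the logarithmic derivative of the determinant of a `2 × 2` matrix. -/
theorem trace_inv_mul_deriv {M : ℂ → Matrix (Fin 2) (Fin 2) ℂ}
    (hM : ∀ i j, Differentiable ℂ fun β => M β i j) (β : ℂ) :
    ((M β)⁻¹ * Matrix.of fun i j => deriv (fun b => M b i j) β).trace =
      deriv (fun b => (M b).det) β / (M β).det := by
  have h1 := ((hM 0 0 β).hasDerivAt.fun_mul (hM 1 1 β).hasDerivAt).fun_sub
    ((hM 0 1 β).hasDerivAt.fun_mul (hM 1 0 β).hasDerivAt)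
  simp only [← Matrix.det_fin_two] at h1
  -- Where the determinant vanishes, both sides are 0 by the conventions for inverses, so no
  -- assumption of invertibility is needed.
  rw [h1.deriv, Matrix.inv_def, Matrix.adjugate_fin_two]
  simp only [Ring.inverse_eq_inv', Matrix.smul_mul, Matrix.trace_smul, Matrix.trace_fin_two,
    Matrix.mul_apply, Fin.sum_univ_two, Matrix.of_apply, smul_eq_mul, Matrix.cons_val',
    Matrix.cons_val_zero,
    Matrix.cons_val_one]
  ring

/-! ### Operators of finite rank and their traces -/

section finiteRank

variable {E F : Type*} [NormedAddCommGroup E] [NormedSpace ℂ E]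
  [NormedAddCommGroup F] [NormedSpace ℂ F]

/-- The trace may be computed on any finite-dimensional subspace that contains the range, by tr(AB)
= tr(BA) with A the inclusion of the range. Traces of operators with different ranges can thus be
compared on a common subspace. -/
theorem finiteRankTrace_eq_of_range_le {T : E →ₗ[ℂ] E} {U : Submodule ℂ E} [FiniteDimensional ℂ U]
    (hU : ∀ x, T x ∈ U) :
    finiteRankTrace T = LinearMap.trace ℂ U (T.codRestrict U hU ∘ₗ U.subtype) := by
  have hle : LinearMap.range T ≤ U := by rintro _ ⟨x, rfl⟩; exact hU x
  have : FiniteDimensional ℂ (LinearMap.range T) := Submodule.finiteDimensional_of_le hle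
  exact LinearMap.trace_comp_comm' (Submodule.inclusion hle) (T.rangeRestrict ∘ₗ U.subtype)

/-- `T` has finite rank and trace `t`. -/
def HasFiniteRankTrace (T : E →L[ℂ] E) (t : ℂ) : Prop :=
  FiniteDimensional ℂ (LinearMap.range (T : E →ₗ[ℂ] E)) ∧ finiteRankTrace (T : E →ₗ[ℂ] E) = t

theorem HasFiniteRankTrace.of_mem {T : E →L[ℂ] E} {U : Submodule ℂ E} [FiniteDimensional ℂ U]
    (hU : ∀ x, T x ∈ U) {t : ℂ}
    (ht : LinearMap.trace ℂ U ((T : E →ₗ[ℂ] E).codRestrict U hU ∘ₗ U.subtype) = t) :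
    HasFiniteRankTrace T t := by
  refine ⟨Submodule.finiteDimensional_of_le (S₂ := U) ?_,
    (finiteRankTrace_eq_of_range_le hU).trans ht⟩
  rintro _ ⟨x, rfl⟩; exact hU x

theorem HasFiniteRankTrace.zero : HasFiniteRankTrace (0 : E →L[ℂ] E) 0 :=
  .of_mem (U := ⊥) (fun _ => by simp) (by
    rw [show LinearMap.codRestrict ⊥ ((0 : E →L[ℂ] E) : E →ₗ[ℂ] E) _ ∘ₗ Submodule.subtype ⊥ = 0 from
      LinearMap.ext fun x => Subsingleton.elim _ _, map_zero])

theorem HasFiniteRankTrace.add {S T : E →L[ℂ] E} {s t : ℂ} (hS : HasFiniteRankTrace S s)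
    (hT : HasFiniteRankTrace T t) : HasFiniteRankTrace (S + T) (s + t) := by
  obtain ⟨hS1, hS2⟩ := hS
  obtain ⟨hT1, hT2⟩ := hT
  set U := LinearMap.range (S : E →ₗ[ℂ] E) ⊔ LinearMap.range (T : E →ₗ[ℂ] E)
  have mS : ∀ x, (S : E →ₗ[ℂ] E) x ∈ U := fun x => Submodule.mem_sup_left ⟨x, rfl⟩
  have mT : ∀ x, (T : E →ₗ[ℂ] E) x ∈ U := fun x => Submodule.mem_sup_right ⟨x, rfl⟩
  refine .of_mem (U := U) (fun x => U.add_mem (mS x) (mT x)) ?_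
  rw [← hS2, ← hT2, finiteRankTrace_eq_of_range_le mS, finiteRankTrace_eq_of_range_le mT, ← map_add]
  rfl

theorem HasFiniteRankTrace.const_smul {T : E →L[ℂ] E} {t : ℂ} (c : ℂ)
    (hT : HasFiniteRankTrace T t) : HasFiniteRankTrace (c • T) (c * t) := by
  obtain ⟨hT1, hT2⟩ := hT
  have mT : ∀ x, (T : E →ₗ[ℂ] E) x ∈ LinearMap.range (T : E →ₗ[ℂ] E) := fun x => ⟨x, rfl⟩
  refine .of_mem (fun x => Submodule.smul_mem _ c (mT x)) ?_
  rw [← hT2, finiteRankTrace_eq_of_range_le mT, ← smul_eq_mul, ← map_smul]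
  rfl

theorem HasFiniteRankTrace.sum {ι : Type*} (A : Finset ι) {T : ι → E →L[ℂ] E} {t : ι → ℂ}
    (hT : ∀ i, HasFiniteRankTrace (T i) (t i)) :
    HasFiniteRankTrace (∑ i ∈ A, T i) (∑ i ∈ A, t i) := by
  classical
  induction A using Finset.induction_on with
  | empty => simpa using HasFiniteRankTrace.zero
  | insert i A hi ih => simpa [Finset.sum_insert hi] using (hT i).add ih

open ContinuousLinearMap in
theorem finiteDimensional_range_smulRightL (s : StrongDual ℂ E) (r : F) :
    FiniteDimensional ℂ (LinearMap.range (smulRightL ℂ E F s r : E →ₗ[ℂ] F)) := by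
  refine Submodule.finiteDimensional_of_le (S₂ := ℂ ∙ r) ?_
  rintro _ ⟨x, rfl⟩
  exact Submodule.smul_mem _ _ (Submodule.mem_span_singleton_self r)

open ContinuousLinearMap in
-- The operator x ↦ s(x)r factors through ℂ; exchanging the two factors leaves multiplication by
-- s(r) on ℂ.
theorem hasFiniteRankTrace_smulRightL (s : StrongDual ℂ E) (r : E) :
    HasFiniteRankTrace (smulRightL ℂ E E s r) (s r) := by
  have hU : ∀ x, smulRightL ℂ E E s r x ∈ (ℂ ∙ r) := fun x =>
    Submodule.smul_mem _ _ (Submodule.mem_span_singleton_self r)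
  refine .of_mem hU ?_
  let u : (ℂ ∙ r) := ⟨r, Submodule.mem_span_singleton_self r⟩
  have e : ((smulRightL ℂ E E s r : E →L[ℂ] E) : E →ₗ[ℂ] E).codRestrict (ℂ ∙ r) hU ∘ₗ
      (ℂ ∙ r).subtype = (LinearMap.toSpanSingleton ℂ (ℂ ∙ r) u) ∘ₗ ((s : E →ₗ[ℂ] ℂ) ∘ₗ
        (ℂ ∙ r).subtype) := rfl
  rw [e, LinearMap.trace_comp_comm']
  have e2 : ((s : E →ₗ[ℂ] ℂ) ∘ₗ (ℂ ∙ r).subtype) ∘ₗ LinearMap.toSpanSingleton ℂ (ℂ ∙ r) u =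
      s r • LinearMap.id := by
    ext; simp [u]
  rw [e2, map_smul, LinearMap.trace_id]
  simp

end finiteRank

/-! ### Contour integrals of operators of finite rank -/

section contour

variable {E : Type*} [NormedAddCommGroup E] [NormedSpace ℂ E]
  {F : Type*} [NormedAddCommGroup F] [NormedSpace ℂ F]

theorem circleIntegral_comp_comm [CompleteSpace E] [CompleteSpace F] (L : E →L[ℂ] F) {f : ℂ → E}
    {c : ℂ} {R : ℝ} (hf : CircleIntegrable f c R) :
    (∮ z in C(c, R), L (f z)) = L (∮ z in C(c, R), f z) := by
  have := hf.out
  simp only [circleIntegral]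
  rw [← L.intervalIntegral_comp_comm this]
  simp

theorem circleIntegral_eq_zero {f : ℂ → E} {c : ℂ} {R : ℝ} (hR : 0 ≤ R) {Ω : Set ℂ}
    (hΩ : IsOpen Ω) (hsub : Metric.closedBall c R ⊆ Ω) (hf : DifferentiableOn ℂ f Ω) :
    (∮ z in C(c, R), f z) = 0 :=
  Complex.circleIntegral_eq_zero_of_differentiable_on_off_countable hR Set.countable_empty
    (hf.continuousOn.mono hsub) fun _ hz => hf.differentiableAt
      (hΩ.mem_nhds (hsub (Metric.ball_subset_closedBall hz.1)))

theorem ne_of_mem_sphere_of_mem_ball {a c z : ℂ} {R : ℝ} (ha : a ∈ Metric.ball c R)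
    (hz : z ∈ Metric.sphere c R) : z ≠ a := by
  rintro rfl
  exact absurd (Metric.mem_sphere.1 hz) (ne_of_lt ha)

theorem continuousOn_inv_sub_pow {a c : ℂ} {R : ℝ} (ha : a ∈ Metric.ball c R) (N : ℕ) :
    ContinuousOn (fun z : ℂ => ((z - a) ^ N)⁻¹) (Metric.sphere c R) :=
  ContinuousOn.inv₀ (by fun_prop) fun _ hz =>
    pow_ne_zero _ (sub_ne_zero.2 (ne_of_mem_sphere_of_mem_ball ha hz))

open ContinuousLinearMap in
theorem differentiableOn_smulRightL {Ω : Set ℂ} {s : ℂ → StrongDual ℂ E} {r : ℂ → F}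
    (hs : DifferentiableOn ℂ s Ω) (hr : DifferentiableOn ℂ r Ω) :
    DifferentiableOn ℂ (fun z => smulRightL ℂ E F (s z) (r z)) Ω :=
  ((smulRightL ℂ E F).differentiable.comp_differentiableOn hs).clm_apply hr

open ContinuousLinearMap in
-- Trace and integral commute here although the trace is not defined on all bounded operators.
-- Writing r(z) = r(a) + (z - a)r'(z) splits off (∮ (z - a)^{-N-1} s) ⊗ r(a), of rank at most one,
-- whose trace is the corresponding scalar integral, and lowers the order of the pole by one.
-- Without a pole both integrals vanish by Cauchy's theorem.
theorem hasFiniteRankTrace_circleIntegral [CompleteSpace E] {a c : ℂ} {R : ℝ}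
    (ha : a ∈ Metric.ball c R) {Ω : Set ℂ} (hΩ : IsOpen Ω) (hsub : Metric.closedBall c R ⊆ Ω)
    (N : ℕ) {s : ℂ → StrongDual ℂ E} (hs : DifferentiableOn ℂ s Ω) {r : ℂ → E}
    (hr : DifferentiableOn ℂ r Ω) :
    HasFiniteRankTrace (∮ z in C(c, R), ((z - a) ^ N)⁻¹ • smulRightL ℂ E E (s z) (r z))
      (∮ z in C(c, R), ((z - a) ^ N)⁻¹ * s z (r z)) := by
  have hR : 0 ≤ R := dist_nonneg.trans (Metric.mem_ball.1 ha).le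
  have hsph : Metric.sphere c R ⊆ Ω := Metric.sphere_subset_closedBall.trans hsub
  induction N generalizing r with
  | zero =>
    simp only [pow_zero, inv_one, one_smul, one_mul]
    rw [circleIntegral_eq_zero hR hΩ hsub (differentiableOn_smulRightL hs hr),
      circleIntegral_eq_zero hR hΩ hsub (hs.clm_apply hr)]
    exact .zero
  | succ N ih =>
    set r' := dslope r a
    have hr' : DifferentiableOn ℂ r' Ω := (Complex.differentiableOn_dslope
      (hΩ.mem_nhds (hsub (Metric.ball_subset_closedBall ha)))).2 hr
    have hrr : ∀ z, r z = r a + (z - a) • r' z := fun z => by rw [sub_smul_dslope]; abel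
    have key : ∀ z ∈ Metric.sphere c R, ((z - a) ^ (N + 1))⁻¹ * (z - a) = ((z - a) ^ N)⁻¹ := by
      intro z hz
      have : z - a ≠ 0 := sub_ne_zero.2 (ne_of_mem_sphere_of_mem_ball ha hz)
      rw [pow_succ, mul_inv, inv_mul_cancel_right₀ this]
    have c1 := continuousOn_inv_sub_pow ha (N + 1)
    have c2 := continuousOn_inv_sub_pow ha N
    have i0 : CircleIntegrable (fun z => ((z - a) ^ (N + 1))⁻¹ • s z) c R :=
      (c1.smul (hs.continuousOn.mono hsph)).circleIntegrable hR
    have e1 : (∮ z in C(c, R), ((z - a) ^ (N + 1))⁻¹ • smulRightL ℂ E E (s z) (r z)) =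
        smulRightL ℂ E E (∮ z in C(c, R), ((z - a) ^ (N + 1))⁻¹ • s z) (r a) +
          ∮ z in C(c, R), ((z - a) ^ N)⁻¹ • smulRightL ℂ E E (s z) (r' z) := by
      have := circleIntegral_comp_comm ((smulRightL ℂ E E).flip (r a)) i0
      simp only [flip_apply] at this
      rw [← this, ← circleIntegral.integral_add]
      · refine circleIntegral.integral_congr hR fun z hz => ?_
        simp only [map_smul, smul_apply]
        rw [hrr z, map_add, map_smul, smul_add, smul_smul, key z hz]
      · refine ContinuousOn.circleIntegrable hR ?_
        exact (((smulRightL ℂ E E).flip (r a)).continuous.comp_continuousOn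
          (c1.smul (hs.continuousOn.mono hsph)))
      · exact (c2.smul ((differentiableOn_smulRightL hs hr').continuousOn.mono
          hsph)).circleIntegrable hR
    have e2 : (∮ z in C(c, R), ((z - a) ^ (N + 1))⁻¹ * s z (r z)) =
        (∮ z in C(c, R), ((z - a) ^ (N + 1))⁻¹ • s z) (r a) +
          ∮ z in C(c, R), ((z - a) ^ N)⁻¹ * s z (r' z) := by
      have := circleIntegral_comp_comm (ContinuousLinearMap.apply ℂ ℂ (r a)) i0
      simp only [apply_apply] at this
      rw [← this, ← circleIntegral.integral_add]
      · refine circleIntegral.integral_congr hR fun z hz => ?_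
        simp only [smul_apply, smul_eq_mul]
        rw [hrr z, map_add, map_smul, mul_add, smul_eq_mul, ← mul_assoc _ (z - a), key z hz]
      · refine ContinuousOn.circleIntegrable hR ?_
        exact (c1.smul (hs.continuousOn.mono hsph)).clm_apply continuousOn_const
      · exact (c2.mul ((hs.clm_apply hr').continuousOn.mono hsph)).circleIntegrable hR
    rw [e1, e2]
    exact (hasFiniteRankTrace_smulRightL _ _).add (ih hr')

end contour

/-! ### Orders of vanishing and logarithmic derivatives -/

/-- The factorisation holds on all of ℂ, since the difference quotient of an entire function is
entire. One cofactor g therefore serves every circle around a, large or small. -/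
theorem exists_eq_pow_mul_of_analyticOrderAt {d : ℂ → ℂ} (hd : Differentiable ℂ d) {a : ℂ} {N : ℕ}
    (hN : analyticOrderAt d a = N) :
    ∃ g : ℂ → ℂ, Differentiable ℂ g ∧ g a ≠ 0 ∧ ∀ z, d z = (z - a) ^ N * g z := by
  induction N generalizing d with
  | zero =>
    refine ⟨d, hd, ?_, by simp⟩
    simpa using (hd.analyticAt a).analyticOrderAt_eq_zero.1 (by simpa using hN)
  | succ N ih =>
    have hd' : Differentiable ℂ (dslope d a) := by
      rw [← differentiableOn_univ] at hd ⊢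
      exact (Complex.differentiableOn_dslope Filter.univ_mem).2 hd
    have h0 : d a = 0 := by
      by_contra h
      rw [(hd.analyticAt a).analyticOrderAt_eq_zero.2 h] at hN
      exact absurd (Nat.cast_injective hN) (Nat.succ_ne_zero N).symm
    have hdd : ∀ z, d z = (z - a) * dslope d a z := fun z => by
      rw [← smul_eq_mul, sub_smul_dslope, h0, sub_zero]
    have hor : analyticOrderAt (dslope d a) a = N := by
      have h1 : analyticOrderAt (fun z => z - a) a = 1 := by
        rw [← Nat.cast_one, AnalyticAt.analyticOrderAt_eq_natCast (by fun_prop)]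
        exact ⟨fun _ => 1, analyticAt_const, one_ne_zero, by simp⟩
      have h2 := analyticOrderAt_mul (f := fun z => z - a) (g := dslope d a) (z₀ := a)
        (by fun_prop) (hd'.analyticAt a)
      rw [show (fun z => z - a) * dslope d a = d from funext fun z => (hdd z).symm, h1, hN] at h2
      rw [Nat.cast_add, Nat.cast_one, add_comm] at h2
      exact (ENat.add_right_injective_of_ne_top ENat.one_ne_top h2).symm
    obtain ⟨g, hg1, hg2, hg3⟩ := ih hd' hor
    exact ⟨g, hg1, hg2, fun z => by rw [hdd, hg3]; ring⟩

/-- This is the argument principle for a single zero: d'/d = N/(z - a) + g'/g, and the last term is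
holomorphic near the closed disc because g has no zeros there. -/
theorem circleIntegral_deriv_div {d : ℂ → ℂ} (hd : Differentiable ℂ d) {a c : ℂ} {R : ℝ} {N : ℕ}
    (hN : analyticOrderAt d a = N) (hc : IsolatingCircle (fun z => d z ≠ 0) a c R) :
    (∮ z in C(c, R), deriv d z / d z) = 2 * Real.pi * Complex.I * N := by
  obtain ⟨ha, hne⟩ := hc
  have hR : 0 ≤ R := dist_nonneg.trans (Metric.mem_ball.1 ha).le
  obtain ⟨g, hg, hga, hdg⟩ := exists_eq_pow_mul_of_analyticOrderAt hd hN
  have hΩ : IsOpen {z | g z ≠ 0} := isOpen_ne.preimage hg.continuous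
  have hsub : Metric.closedBall c R ⊆ {z | g z ≠ 0} := by
    intro z hz
    by_cases h : z = a
    · rwa [h]
    · have := hne z hz h
      simp only [hdg z] at this
      exact right_ne_zero_of_mul this
  have hg' : Differentiable ℂ (deriv g) := fun z => (hg.analyticAt z).deriv.differentiableAt
  have hgd : DifferentiableOn ℂ (fun z => deriv g z / g z) {z | g z ≠ 0} :=
    hg'.differentiableOn.div hg.differentiableOn fun _ hz => hz
  have e : ∀ z ∈ Metric.sphere c R, deriv d z / d z = N * (z - a)⁻¹ + deriv g z / g z := by
    intro z hz
    have h1 : z - a ≠ 0 := sub_ne_zero.2 (ne_of_mem_sphere_of_mem_ball ha hz)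
    have h2 : g z ≠ 0 := hsub (Metric.sphere_subset_closedBall hz)
    have h3 := ((((hasDerivAt_id' z).sub_const a).fun_pow N).fun_mul (hg z).hasDerivAt)
    rw [show d = fun z => (z - a) ^ N * g z from funext hdg, h3.deriv]
    cases N with
    | zero => simp
    | succ N =>
      field_simp
      push_cast
      ring
  rw [circleIntegral.integral_congr hR e, circleIntegral.integral_add,
    circleIntegral_eq_zero hR hΩ hsub hgd, circleIntegral.integral_const_mul,
    circleIntegral.integral_sub_inv_of_mem_ball ha]
  · ring
  · refine ContinuousOn.circleIntegrable hR ?_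
    simpa using (continuousOn_const (c := (N : ℂ))).fun_mul (continuousOn_inv_sub_pow ha 1)
  · exact (hgd.continuousOn.mono (Metric.sphere_subset_closedBall.trans hsub)).circleIntegrable hR


/-! ### Residues of operator families with poles of finite rank -/

section contour

variable {E : Type*} [NormedAddCommGroup E] [NormedSpace ℂ E]
  {F : Type*} [NormedAddCommGroup F] [NormedSpace ℂ F]

open ContinuousLinearMap in
/-- Residues of families with poles of finite rank: the trace of the contour integral is the order
of vanishing of the denominator, provided that the trace of the numerator is its derivative. -/
theorem hasFiniteRankTrace_contour [CompleteSpace E] {ι : Type*} [Fintype ι] {d : ℂ → ℂ}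
    (hd : Differentiable ℂ d) {A T : ℂ → E →L[ℂ] E} (hA : Differentiable ℂ A)
    {s : ι → ℂ → StrongDual ℂ E} (hs : ∀ i, Differentiable ℂ (s i))
    {r : ι → ℂ → E} (hr : ∀ i, Differentiable ℂ (r i))
    (hT : ∀ z, d z ≠ 0 → T z = A z + (d z)⁻¹ • ∑ i, smulRightL ℂ E E (s i z) (r i z))
    (htr : ∀ z, ∑ i, s i z (r i z) = deriv d z) {a c : ℂ} {R : ℝ} {N : ℕ}
    (hN : analyticOrderAt d a = N) (hc : IsolatingCircle (fun z => d z ≠ 0) a c R) :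
    CircleIntegrable T c R ∧
      HasFiniteRankTrace ((2 * Real.pi * Complex.I : ℂ)⁻¹ • ∮ z in C(c, R), T z) N := by
  have hlog := circleIntegral_deriv_div hd hN hc
  obtain ⟨ha, hne⟩ := hc
  have hR : 0 ≤ R := dist_nonneg.trans (Metric.mem_ball.1 ha).le
  obtain ⟨g, hg, hga, hdg⟩ := exists_eq_pow_mul_of_analyticOrderAt hd hN
  set Ω : Set ℂ := {z | g z ≠ 0}
  have hΩ : IsOpen Ω := isOpen_ne.preimage hg.continuous
  have hsub : Metric.closedBall c R ⊆ Ω := by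
    intro z hz
    by_cases h : z = a
    · rw [h]; exact hga
    · have := hne z hz h
      simp only [hdg z] at this
      exact right_ne_zero_of_mul this
  have hsph : Metric.sphere c R ⊆ Ω := Metric.sphere_subset_closedBall.trans hsub
  -- The zero-free cofactor of d is absorbed into the functionals, so that the only singular factor
  -- left is the pure power (z - a)^{-N}.
  set s' : ι → ℂ → StrongDual ℂ E := fun i z => (g z)⁻¹ • s i z with hs'def
  have hs' : ∀ i, DifferentiableOn ℂ (s' i) Ω := fun i =>
    (hg.differentiableOn.inv fun z hz => hz).smul (hs i).differentiableOn
  have hTs : ∀ z ∈ Metric.sphere c R, T z = A z +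
      ∑ i, ((z - a) ^ N)⁻¹ • smulRightL ℂ E E (s' i z) (r i z) := by
    intro z hz
    rw [hT z (hne z (Metric.sphere_subset_closedBall hz) (ne_of_mem_sphere_of_mem_ball ha hz)),
      hdg z, Finset.smul_sum]
    simp only [hs'def, map_smul, smul_apply, mul_inv, smul_smul]
  have hcont : ∀ i, ContinuousOn
      (fun z => ((z - a) ^ N)⁻¹ • smulRightL ℂ E E (s' i z) (r i z)) (Metric.sphere c R) := fun i =>
    (continuousOn_inv_sub_pow ha N).smul
      ((differentiableOn_smulRightL (hs' i) (hr i).differentiableOn).continuousOn.mono hsph)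
  have hcs := continuousOn_finsetSum Finset.univ fun i _ => hcont i
  refine ⟨ContinuousOn.circleIntegrable hR
    ((hA.continuous.continuousOn.add hcs).congr fun z hz => hTs z hz), ?_⟩
  have e1 : (∮ z in C(c, R), T z) =
      ∑ i, ∮ z in C(c, R), ((z - a) ^ N)⁻¹ • smulRightL ℂ E E (s' i z) (r i z) := by
    rw [circleIntegral.integral_congr hR hTs, circleIntegral.integral_add
      (hA.continuous.continuousOn.circleIntegrable hR) (hcs.circleIntegrable hR),
      circleIntegral_eq_zero hR isOpen_univ (Set.subset_univ _) hA.differentiableOn, zero_add,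
      circleIntegral.integral_fun_sum fun i _ => (hcont i).circleIntegrable hR]
  -- Here the hypothesis on the trace of the numerator enters: the scalar integrals attached to the
  -- rank-one terms add up to the integral of d'/d.
  have e2 : (∮ z in C(c, R), deriv d z / d z) =
      ∑ i, ∮ z in C(c, R), ((z - a) ^ N)⁻¹ * s' i z (r i z) := by
    rw [← circleIntegral.integral_fun_sum]
    · refine circleIntegral.integral_congr hR fun z hz => ?_
      simp only [← htr z, hdg z, hs'def, smul_apply, smul_eq_mul, ← mul_assoc, ← mul_inv]
      rw [← Finset.mul_sum, div_eq_inv_mul]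
    · intro i _
      exact ((continuousOn_inv_sub_pow ha N).mul (((hs' i).clm_apply
        (hr i).differentiableOn).continuousOn.mono hsph)).circleIntegrable hR
  have e3 : (N : ℂ) = (2 * Real.pi * Complex.I : ℂ)⁻¹ *
      ∑ i, ∮ z in C(c, R), ((z - a) ^ N)⁻¹ * s' i z (r i z) := by
    rw [← e2, hlog, inv_mul_cancel_left₀ Complex.two_pi_I_ne_zero]
  rw [e1, e3]
  exact HasFiniteRankTrace.const_smul _ (HasFiniteRankTrace.sum _ fun i =>
    hasFiniteRankTrace_circleIntegral ha hΩ hsub N (hs' i) (hr i).differentiableOn)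

/-! ### Meromorphic families -/

/-- `B` is near `a` the sum of a holomorphic family and a finite principal part of finite rank. -/
def HasFinitePrincipalPart (B : ℂ → E →L[ℂ] F) (a : ℂ) : Prop :=
  ∃ (N : ℕ) (A : Fin N → E →L[ℂ] F) (B₀ : ℂ → E →L[ℂ] F),
    (∀ j, FiniteDimensional ℂ (LinearMap.range (A j : E →ₗ[ℂ] F))) ∧ AnalyticAt ℂ B₀ a ∧
    ∀ᶠ z in 𝓝[≠] a, B z = B₀ z + ∑ j : Fin N, ((z - a) ^ ((j : ℕ) + 1))⁻¹ • A j

theorem finiteDimensional_range_zero :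
    FiniteDimensional ℂ (LinearMap.range ((0 : E →L[ℂ] F) : E →ₗ[ℂ] F)) := by
  rw [show ((0 : E →L[ℂ] F) : E →ₗ[ℂ] F) = 0 from rfl, LinearMap.range_zero]
  infer_instance

/-- Extending the coefficients by zero to all of ℕ lets principal parts of different lengths be
added. -/
theorem hasFinitePrincipalPart_iff {B : ℂ → E →L[ℂ] F} {a : ℂ} : HasFinitePrincipalPart B a ↔
    ∃ (N : ℕ) (A : ℕ → E →L[ℂ] F) (B₀ : ℂ → E →L[ℂ] F), (∀ j, N ≤ j → A j = 0) ∧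
      (∀ j, FiniteDimensional ℂ (LinearMap.range (A j : E →ₗ[ℂ] F))) ∧ AnalyticAt ℂ B₀ a ∧
      ∀ᶠ z in 𝓝[≠] a, B z = B₀ z + ∑ j ∈ Finset.range N, ((z - a) ^ (j + 1))⁻¹ • A j := by
  constructor
  · rintro ⟨N, A, B₀, h1, h2, h3⟩
    refine ⟨N, fun j => if hj : j < N then A ⟨j, hj⟩ else 0, B₀,
      fun j hj => dif_neg hj.not_gt, fun j => ?_, h2, ?_⟩
    · beta_reduce
      by_cases hj : j < N
      · rw [dif_pos hj]; exact h1 ⟨j, hj⟩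
      · rw [dif_neg hj]; exact finiteDimensional_range_zero
    · filter_upwards [h3] with z hz
      rw [hz, Finset.sum_range]
      simp
  · rintro ⟨N, A, B₀, -, h1, h2, h3⟩
    refine ⟨N, fun j => A j, B₀, fun j => h1 j, h2, ?_⟩
    filter_upwards [h3] with z hz
    rw [hz, Finset.sum_range]

theorem _root_.AnalyticAt.hasFinitePrincipalPart {B : ℂ → E →L[ℂ] F} {a : ℂ}
    (hB : AnalyticAt ℂ B a) : HasFinitePrincipalPart B a :=
  ⟨0, Fin.elim0, B, fun j => j.elim0, hB, by simp⟩

theorem HasFinitePrincipalPart.congr {B C : ℂ → E →L[ℂ] F} {a : ℂ}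
    (hB : HasFinitePrincipalPart B a) (h : ∀ᶠ z in 𝓝[≠] a, C z = B z) :
    HasFinitePrincipalPart C a := by
  obtain ⟨N, A, B₀, h1, h2, h3⟩ := hB
  refine ⟨N, A, B₀, h1, h2, ?_⟩
  filter_upwards [h, h3] with z hz hz'
  rw [hz, hz']

theorem HasFinitePrincipalPart.add {B C : ℂ → E →L[ℂ] F} {a : ℂ}
    (hB : HasFinitePrincipalPart B a) (hC : HasFinitePrincipalPart C a) :
    HasFinitePrincipalPart (fun z => B z + C z) a := by
  rw [hasFinitePrincipalPart_iff] at *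
  obtain ⟨N, A, B₀, h0, h1, h2, h3⟩ := hB
  obtain ⟨M, D, C₀, g0, g1, g2, g3⟩ := hC
  refine ⟨max N M, fun j => A j + D j, fun z => B₀ z + C₀ z, fun j hj => ?_, fun j => ?_,
    h2.add g2, ?_⟩
  · simp only [h0 j ((le_max_left _ _).trans hj), g0 j ((le_max_right _ _).trans hj), add_zero]
  · have := h1 j
    have := g1 j
    exact Submodule.finiteDimensional_of_le
      (LinearMap.range_add_le (A j : E →ₗ[ℂ] F) (D j : E →ₗ[ℂ] F))
  · have key : ∀ {N M : ℕ} (A : ℕ → E →L[ℂ] F) (z : ℂ), N ≤ M → (∀ j, N ≤ j → A j = 0) →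
        ∑ j ∈ Finset.range N, ((z - a) ^ (j + 1))⁻¹ • A j =
          ∑ j ∈ Finset.range M, ((z - a) ^ (j + 1))⁻¹ • A j := by
      intro N M A z hNM hA
      refine Finset.sum_subset (Finset.range_mono hNM) fun j _ hj => ?_
      rw [hA j (by simpa using hj), smul_zero]
    filter_upwards [h3, g3] with z hz hz'
    rw [hz, hz', key A z (le_max_left N M) h0, key D z (le_max_right N M) g0]
    simp only [smul_add, Finset.sum_add_distrib]
    abel

theorem HasFinitePrincipalPart.sum {ι : Type*} (S : Finset ι) {B : ι → ℂ → E →L[ℂ] F} {a : ℂ}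
    (hB : ∀ i, HasFinitePrincipalPart (B i) a) :
    HasFinitePrincipalPart (fun z => ∑ i ∈ S, B i z) a := by
  classical
  induction S using Finset.induction_on with
  | empty => simpa using (analyticAt_const (v := (0 : E →L[ℂ] F))).hasFinitePrincipalPart
  | insert i S hi ih => simpa [Finset.sum_insert hi] using (hB i).add ih

theorem HasFinitePrincipalPart.clm_comp {G : Type*} [NormedAddCommGroup G] [NormedSpace ℂ G]
    {B : ℂ → E →L[ℂ] F} {a : ℂ} (hB : HasFinitePrincipalPart B a) (L : F →L[ℂ] G) :
    HasFinitePrincipalPart (fun z => L ∘L B z) a := by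
  obtain ⟨N, A, B₀, h1, h2, h3⟩ := hB
  refine ⟨N, fun j => L ∘L A j, fun z => L ∘L B₀ z, fun j => ?_,
    (ContinuousLinearMap.compL ℂ E F G L).analyticAt _ |>.comp h2, ?_⟩
  · have := h1 j
    beta_reduce
    rw [ContinuousLinearMap.toLinearMap_comp, LinearMap.range_comp]
    infer_instance
  · filter_upwards [h3] with z hz
    rw [hz]
    ext x
    simp

theorem hasFinitePrincipalPart_pole (A : E →L[ℂ] F)
    [hA : FiniteDimensional ℂ (LinearMap.range (A : E →ₗ[ℂ] F))] (a : ℂ) (N : ℕ) :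
    HasFinitePrincipalPart (fun z => ((z - a) ^ (N + 1))⁻¹ • A) a := by
  refine ⟨N + 1, fun j => if (j : ℕ) = N then A else 0, 0, fun j => ?_, analyticAt_const, ?_⟩
  · beta_reduce
    by_cases hj : (j : ℕ) = N
    · rw [if_pos hj]; exact hA
    · rw [if_neg hj]; exact finiteDimensional_range_zero
  · refine Filter.Eventually.of_forall fun z => ?_
    rw [Fin.sum_univ_castSucc]
    simp [fun i : Fin N => i.2.ne]

open ContinuousLinearMap in
-- Since the coefficients of the principal part must be constant operators, both factors are
-- expanded: s(z) ⊗ r(z) equals s(a) ⊗ r(a) plus (z - a) times two terms of the same type. The first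
-- piece contributes a pole coefficient of rank at most one, the others a pole of lower order.
theorem hasFinitePrincipalPart_smulRightL [CompleteSpace F] {Ω : Set ℂ} {a : ℂ} (hΩ : Ω ∈ 𝓝 a)
    (N : ℕ) {s : ℂ → StrongDual ℂ E} (hs : DifferentiableOn ℂ s Ω) {r : ℂ → F}
    (hr : DifferentiableOn ℂ r Ω) :
    HasFinitePrincipalPart (fun z => ((z - a) ^ N)⁻¹ • smulRightL ℂ E F (s z) (r z)) a := by
  induction N generalizing s r with
  | zero =>
    simp only [pow_zero, inv_one, one_smul]
    exact ((differentiableOn_smulRightL hs hr).analyticAt hΩ).hasFinitePrincipalPart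
  | succ N ih =>
    have hs' := (Complex.differentiableOn_dslope hΩ).2 hs
    have hr' := (Complex.differentiableOn_dslope hΩ).2 hr
    have := finiteDimensional_range_smulRightL (s a) (r a)
    refine (((hasFinitePrincipalPart_pole (smulRightL ℂ E F (s a) (r a)) a N).add
      (ih hs' (differentiableOn_const (r a)))).add (ih hs hr')).congr ?_
    filter_upwards [self_mem_nhdsWithin] with z hz
    have hz' : z - a ≠ 0 := sub_ne_zero.2 hz
    have key : ((z - a) ^ N)⁻¹ = ((z - a) ^ (N + 1))⁻¹ * (z - a) := by
      rw [pow_succ, mul_inv, inv_mul_cancel_right₀ hz']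
    have h1 : smulRightL ℂ E F (s z) (r z) = smulRightL ℂ E F (s a) (r a) +
        (z - a) • smulRightL ℂ E F (dslope s a z) (r a) +
        (z - a) • smulRightL ℂ E F (s z) (dslope r a z) := by
      rw [← map_smul (smulRightL ℂ E F (s z)), ← smul_apply, ← map_smul, sub_smul_dslope,
        sub_smul_dslope, map_sub, map_sub, sub_apply]
      abel
    rw [h1, key]
    simp only [smul_add, smul_smul]

open ContinuousLinearMap in
theorem hasFinitePrincipalPart_of_denominator [CompleteSpace F] {ι : Type*} [Fintype ι] {d : ℂ → ℂ}
    (hd : Differentiable ℂ d) {A : ℂ → E →L[ℂ] F} {a : ℂ} (hA : AnalyticAt ℂ A a)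
    {s : ι → ℂ → StrongDual ℂ E} (hs : ∀ i, Differentiable ℂ (s i))
    {r : ι → ℂ → F} (hr : ∀ i, Differentiable ℂ (r i)) {N : ℕ} (hN : analyticOrderAt d a = N) :
    HasFinitePrincipalPart
      (fun z => A z + (d z)⁻¹ • ∑ i, smulRightL ℂ E F (s i z) (r i z)) a := by
  obtain ⟨g, hg, hga, hdg⟩ := exists_eq_pow_mul_of_analyticOrderAt hd hN
  have hΩ : {z | g z ≠ 0} ∈ 𝓝 a := (isOpen_ne.preimage hg.continuous).mem_nhds hga
  refine (hA.hasFinitePrincipalPart.add (HasFinitePrincipalPart.sum Finset.univ fun i =>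
    hasFinitePrincipalPart_smulRightL hΩ N (s := fun z => (g z)⁻¹ • s i z)
      ((hg.differentiableOn.inv fun z hz => hz).smul (hs i).differentiableOn)
      (hr i).differentiableOn)).congr ?_
  refine Filter.Eventually.of_forall fun z => ?_
  rw [hdg z, Finset.smul_sum]
  simp only [map_smul, smul_apply, mul_inv, smul_smul]

end contour

/-! ### Absolutely continuous functions and weak derivatives -/

/-- `v` is locally absolutely continuous with derivative `f`. -/
def HasACDeriv (v f : ℝ → ℂ) : Prop :=
  LocallyIntegrable f ∧ ∀ x y, x ≤ y → v y - v x = ∫ t in x..y, f t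

theorem locallyIntegrable_intervalIntegrable {f : ℝ → ℂ} (hf : LocallyIntegrable f) (a b : ℝ) :
    IntervalIntegrable f volume a b :=
  (hf.integrableOn_isCompact isCompact_uIcc).intervalIntegrable

theorem HasACDeriv.sub_eq {v f : ℝ → ℂ} (hv : HasACDeriv v f) (x y : ℝ) :
    v y - v x = ∫ t in x..y, f t := by
  rcases le_total x y with h | h
  · exact hv.2 x y h
  · rw [intervalIntegral.integral_symm, ← hv.2 y x h]; ring

theorem HasACDeriv.continuous {v f : ℝ → ℂ} (hv : HasACDeriv v f) : Continuous v := by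
  have h1 : v = fun x => v 0 + ∫ t in (0 : ℝ)..x, f t := funext fun x => by
    rw [← hv.sub_eq 0 x]; ring
  rw [h1]
  exact continuous_const.add
    (intervalIntegral.continuous_primitive (locallyIntegrable_intervalIntegrable hv.1) 0)

theorem hasACDeriv_integral {f : ℝ → ℂ} (hf : LocallyIntegrable f) (c : ℂ) :
    HasACDeriv (fun x => c + ∫ t in (0 : ℝ)..x, f t) f := by
  refine ⟨hf, fun x y _ => ?_⟩
  have := intervalIntegral.integral_add_adjacent_intervals
    (locallyIntegrable_intervalIntegrable hf 0 x) (locallyIntegrable_intervalIntegrable hf x y)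
  linear_combination -this

theorem hasACDeriv_of_hasDerivAt {g g' : ℝ → ℂ} (hg : ∀ x, HasDerivAt g (g' x) x)
    (hg' : Continuous g') : HasACDeriv g g' :=
  ⟨hg'.locallyIntegrable, fun x y _ => (intervalIntegral.integral_eq_sub_of_hasDerivAt
    (fun t _ => hg t) (hg'.intervalIntegrable x y)).symm⟩

theorem HasACDeriv.hasDerivAt {v f : ℝ → ℂ} (hv : HasACDeriv v f) (hf : Continuous f) (x : ℝ) :
    HasDerivAt v (f x) x := by
  have h1 : v = fun x => v 0 + ∫ t in (0 : ℝ)..x, f t := funext fun x => by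
    rw [← hv.sub_eq 0 x]; ring
  rw [h1]
  exact (intervalIntegral.integral_hasDerivAt_right (hf.intervalIntegrable 0 x)
    (hf.stronglyMeasurableAtFilter _ _) hf.continuousAt).const_add _

theorem HasACDeriv.congr {v f g : ℝ → ℂ} (hv : HasACDeriv v f) (h : f =ᵐ[volume] g) :
    HasACDeriv v g := by
  refine ⟨(hv.1.congr h), fun x y hxy => ?_⟩
  rw [hv.2 x y hxy]
  exact intervalIntegral.integral_congr_ae (h.mono fun t ht _ => ht)

theorem HasACDeriv.add {v w f g : ℝ → ℂ} (hv : HasACDeriv v f) (hw : HasACDeriv w g) :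
    HasACDeriv (fun x => v x + w x) (fun x => f x + g x) := by
  refine ⟨hv.1.add hw.1, fun x y hxy => ?_⟩
  rw [intervalIntegral.integral_add (locallyIntegrable_intervalIntegrable hv.1 x y)
    (locallyIntegrable_intervalIntegrable hw.1 x y), ← hv.2 x y hxy, ← hw.2 x y hxy]
  ring

theorem HasACDeriv.neg {v f : ℝ → ℂ} (hv : HasACDeriv v f) :
    HasACDeriv (fun x => -v x) (fun x => -f x) := by
  refine ⟨hv.1.neg, fun x y hxy => ?_⟩
  rw [intervalIntegral.integral_neg, ← hv.2 x y hxy]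
  ring

/-- Integration by parts with f merely integrable: both sides are the integral of g'(s)f(t) over the
triangle x < t ≤ s ≤ y, in the two orders allowed by Fubini. -/
theorem integral_deriv_mul_sub {g g' v f : ℝ → ℂ} (hg : ∀ x, HasDerivAt g (g' x) x)
    (hg' : Continuous g') (hv : HasACDeriv v f) {x y : ℝ} (hxy : x ≤ y) :
    ∫ s in x..y, g' s * (v s - v x) = ∫ t in x..y, f t * (g y - g t) := by
  have hf : IntegrableOn f (Set.Ioc x y) :=
    (intervalIntegrable_iff_integrableOn_Ioc_of_le hxy).1
      (locallyIntegrable_intervalIntegrable hv.1 x y)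
  have hgi : IntegrableOn g' (Set.Ioc x y) :=
    (intervalIntegrable_iff_integrableOn_Ioc_of_le hxy).1 (hg'.intervalIntegrable x y)
  have hint : Integrable (Function.uncurry fun s t =>
      (Set.Iic s).indicator (fun t => g' s * f t) t)
      ((volume.restrict (Set.Ioc x y)).prod (volume.restrict (Set.Ioc x y))) := by
    have hm : MeasurableSet {p : ℝ × ℝ | p.2 ≤ p.1} :=
      measurableSet_le measurable_snd measurable_fst
    refine ((Integrable.mul_prod hgi hf).indicator hm).congr (Filter.Eventually.of_forall ?_)
    rintro ⟨s, t⟩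
    simp [Set.indicator_apply, Function.uncurry]
  have hswap := integral_integral_swap hint
  rw [intervalIntegral.integral_of_le hxy, intervalIntegral.integral_of_le hxy]
  have e1 : ∫ s in Set.Ioc x y, g' s * (v s - v x) = ∫ s in Set.Ioc x y, ∫ t in Set.Ioc x y,
      (Set.Iic s).indicator (fun t => g' s * f t) t := by
    refine setIntegral_congr_fun measurableSet_Ioc fun s hs => ?_
    rw [setIntegral_indicator measurableSet_Iic, Set.Ioc_inter_Iic, inf_eq_right.2 hs.2,
      integral_const_mul, hv.2 x s hs.1.le, intervalIntegral.integral_of_le hs.1.le]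
  have e2 : ∫ t in Set.Ioc x y, f t * (g y - g t) = ∫ t in Set.Ioc x y, ∫ s in Set.Ioc x y,
      (Set.Iic s).indicator (fun t => g' s * f t) t := by
    refine setIntegral_congr_fun measurableSet_Ioc fun t ht => ?_
    have h1 : ∀ s, (Set.Iic s).indicator (fun t => g' s * f t) t =
        (Set.Ici t).indicator (fun s => g' s * f t) s := fun s => by
      simp [Set.indicator_apply]
    have h2 : Set.Ioc x y ∩ Set.Ici t = Set.Icc t y := by
      ext s
      simp only [Set.mem_inter_iff, Set.mem_Ioc, Set.mem_Ici, Set.mem_Icc]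
      exact ⟨fun h => ⟨h.2, h.1.2⟩, fun h => ⟨⟨ht.1.trans_le h.1, h.2⟩, h.1⟩⟩
    simp only [h1]
    rw [setIntegral_indicator measurableSet_Ici, h2, integral_Icc_eq_integral_Ioc,
      integral_mul_const, ← intervalIntegral.integral_of_le ht.2,
      intervalIntegral.integral_eq_sub_of_hasDerivAt (fun t _ => hg t)
        (hg'.intervalIntegrable t y)]
    ring
  rw [e1, e2, hswap]

/-- The product rule for a `C¹` function and an absolutely continuous function. -/
theorem HasACDeriv.mul {g g' v f : ℝ → ℂ} (hv : HasACDeriv v f) (hg : ∀ x, HasDerivAt g (g' x) x)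
    (hg' : Continuous g') :
    HasACDeriv (fun x => g x * v x) (fun x => g' x * v x + g x * f x) := by
  have hgc : Continuous g := continuous_iff_continuousAt.2 fun x => (hg x).continuousAt
  have hgf : LocallyIntegrable (fun x => g x * f x) := hv.1.continuous_smul hgc
  have hgv : Continuous fun x => g' x * v x := hg'.mul hv.continuous
  refine ⟨hgv.locallyIntegrable.add hgf, fun x y hxy => ?_⟩
  have i1 := locallyIntegrable_intervalIntegrable hv.1 x y
  have i2 := locallyIntegrable_intervalIntegrable hgf x y
  have i3 := hgv.intervalIntegrable (μ := volume) x y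
  have i4 := hg'.intervalIntegrable (μ := volume) x y
  have h1 := integral_deriv_mul_sub hg hg' hv hxy
  have h2 : ∫ s in x..y, g' s * (v s - v x) = (∫ s in x..y, g' s * v s) - (g y - g x) * v x := by
    simp only [mul_sub]
    rw [intervalIntegral.integral_sub i3 (i4.mul_const _), intervalIntegral.integral_mul_const,
      (hasACDeriv_of_hasDerivAt hg hg').2 x y hxy]
  have h3 : ∫ t in x..y, f t * (g y - g t) = (v y - v x) * g y - ∫ t in x..y, g t * f t := by
    have : ∀ t, f t * (g y - g t) = f t * g y - g t * f t := fun t => by ring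
    simp only [this]
    rw [intervalIntegral.integral_sub (i1.mul_const _) i2, intervalIntegral.integral_mul_const,
      hv.2 x y hxy]
  rw [intervalIntegral.integral_add i3 i2]
  linear_combination -h1 + h2 - h3

theorem _root_.Continuous.isL2loc {v : ℝ → ℂ} (hv : Continuous v) : IsL2loc v := by
  intro K hK
  obtain ⟨C, hC⟩ := hK.exists_bound_of_continuousOn hv.continuousOn
  have : IsFiniteMeasure (volume.restrict K) := ⟨by simpa using hK.measure_lt_top⟩
  refine MemLp.of_bound hv.aestronglyMeasurable C ?_
  filter_upwards [ae_restrict_mem hK.measurableSet] with x hx using hC x hx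

theorem HasACDeriv.integral_deriv_mul {v f φ : ℝ → ℂ} (hv : HasACDeriv v f)
    (hφ : ContDiff ℝ ∞ φ) (hc : HasCompactSupport φ) :
    ∫ x, deriv φ x * v x = -∫ x, φ x * f x := by
  have hd : Continuous (deriv φ) := hφ.continuous_deriv (by simp)
  have i1 := hv.continuous.locallyIntegrable (μ := volume)
    |>.integrable_smul_left_of_hasCompactSupport hd hc.deriv
  have i2 := hv.1.integrable_smul_left_of_hasCompactSupport hφ.continuous hc
  simp only [smul_eq_mul] at i1 i2
  obtain ⟨R, hR⟩ := hc.isCompact.isBounded.subset_ball 0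
  have hsub : ∀ x, x ∈ tsupport φ → -R < x ∧ x < R := fun x hx => by
    have := hR hx
    simpa [abs_lt] using this
  have hz : ∀ x, ¬(-R < x ∧ x < R) → φ x = 0 := fun x hx =>
    image_eq_zero_of_notMem_tsupport fun h => hx (hsub x h)
  have hz' : ∀ x, ¬(-R < x ∧ x < R) → deriv φ x = 0 := fun x hx =>
    image_eq_zero_of_notMem_tsupport fun h => hx (hsub x (tsupport_deriv_subset h))
  have hp := (hv.mul (fun x => (hφ.differentiable (by simp) x).hasDerivAt) hd).sub_eq (-R) R
  rw [hz R (by simp), hz (-R) (by simp), intervalIntegral.integral_eq_integral_of_support_subset,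
    integral_add i1 i2] at hp
  · linear_combination -hp
  · intro x hx
    by_contra h
    have h' : ¬(-R < x ∧ x < R) := fun h' => h ⟨h'.1, h'.2.le⟩
    simp [hz x h', hz' x h'] at hx

theorem HasACDeriv.hasWeakDerivL2loc {v f : ℝ → ℂ} (hv : HasACDeriv v f) (hf : IsL2loc f) :
    HasWeakDerivL2loc v f :=
  ⟨hv.continuous.isL2loc, hf, fun _ hφ hc => hv.integral_deriv_mul hφ hc⟩

/-- The primitive of g from the left of its support is also zero on the right exactly because g has
mean zero. This supplies the test functions for the lemma of du Bois-Reymond. -/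
theorem exists_contDiff_deriv_eq {g : ℝ → ℂ} (hg : ContDiff ℝ ∞ g) (hc : HasCompactSupport g)
    (h0 : ∫ x, g x = 0) : ∃ ψ : ℝ → ℂ, ContDiff ℝ ∞ ψ ∧ HasCompactSupport ψ ∧ deriv ψ = g := by
  obtain ⟨R, hR⟩ := hc.isCompact.isBounded.subset_ball 0
  have hz : ∀ x, ¬(-R < x ∧ x < R) → g x = 0 := fun x hx =>
    image_eq_zero_of_notMem_tsupport fun h => hx (by simpa [abs_lt] using hR h)
  have hgc := hg.continuous
  have hd : ∀ x, HasDerivAt (fun x => ∫ t in (-R)..x, g t) (g x) x := fun x =>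
    intervalIntegral.integral_hasDerivAt_right (hgc.intervalIntegrable _ x)
      (hgc.stronglyMeasurableAtFilter _ _) hgc.continuousAt
  have hd' : deriv (fun x => ∫ t in (-R)..x, g t) = g := funext fun x => (hd x).deriv
  refine ⟨_, contDiff_infty_iff_deriv.2 ⟨fun x => (hd x).differentiableAt, by rwa [hd']⟩, ?_, hd'⟩
  refine HasCompactSupport.intro (isCompact_Icc (a := -R) (b := R)) fun x hx => ?_
  rw [Set.mem_Icc, not_and_or, not_le, not_le] at hx
  rcases hx with hx | hx
  · rw [intervalIntegral.integral_symm, intervalIntegral.integral_of_le hx.le,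
      setIntegral_congr_fun measurableSet_Ioc (g := fun _ => 0) fun t ht =>
        hz t fun h => absurd h.1 ht.2.not_gt]
    simp
  · rw [intervalIntegral.integral_eq_integral_of_support_subset, h0]
    intro t ht
    by_contra h
    exact ht (hz t fun h' => h ⟨h'.1, (h'.2.trans hx).le⟩)

/-- The lemma of du Bois-Reymond. -/
theorem ae_eq_const_of_integral_deriv_mul_eq_zero {u : ℝ → ℂ} (hu : LocallyIntegrable u)
    (h : ∀ φ : ℝ → ℂ, ContDiff ℝ ∞ φ → HasCompactSupport φ → ∫ x, deriv φ x * u x = 0) :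
    ∃ C : ℂ, u =ᵐ[volume] fun _ => C := by
  let b : ContDiffBump (0 : ℝ) := ⟨1, 2, one_pos, one_lt_two⟩
  set η : ℝ → ℂ := fun x => ((b.normed volume x : ℝ) : ℂ)
  have hη : ContDiff ℝ ∞ η := Complex.ofRealCLM.contDiff.comp b.contDiff_normed
  have hηc : HasCompactSupport η := b.hasCompactSupport_normed.comp_left Complex.ofReal_zero
  have hη1 : ∫ x, η x = 1 := by
    rw [integral_complex_ofReal, b.integral_normed, Complex.ofReal_one]
  -- The constant is found by testing u against a function η of integral 1; subtracting (∫ γ)η from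
  -- a test function γ leaves mean zero, hence a derivative of a test function.
  refine ⟨∫ x, η x * u x, ?_⟩
  set C := ∫ x, η x * u x
  have hloc : LocallyIntegrable (fun x => u x - C) :=
    hu.sub (continuous_const (y := C)).locallyIntegrable
  have := ae_eq_zero_of_integral_contDiff_smul_eq_zero hloc fun g hg hgc => ?_
  · filter_upwards [this] with x hx using sub_eq_zero.1 hx
  set γ : ℝ → ℂ := fun x => ((g x : ℝ) : ℂ)
  have hγ : ContDiff ℝ ∞ γ := Complex.ofRealCLM.contDiff.comp hg
  have hγc : HasCompactSupport γ := hgc.comp_left Complex.ofReal_zero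
  have iγ : Integrable γ := hγ.continuous.integrable_of_hasCompactSupport hγc
  have iη : Integrable η := hη.continuous.integrable_of_hasCompactSupport hηc
  set G := ∫ x, γ x
  have iγu := hu.integrable_smul_left_of_hasCompactSupport hγ.continuous hγc
  have iηu := hu.integrable_smul_left_of_hasCompactSupport hη.continuous hηc
  simp only [smul_eq_mul] at iγu iηu
  obtain ⟨ψ, hψ, hψc, hψd⟩ := exists_contDiff_deriv_eq (g := fun x => γ x - G * η x)
    (hγ.sub (contDiff_const.mul hη)) (hγc.sub hηc.mul_left) (by
      rw [integral_sub iγ (iη.const_mul G), integral_const_mul, hη1, mul_one, sub_self])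
  have h1 := h ψ hψ hψc
  simp only [hψd, sub_mul, mul_assoc] at h1
  rw [integral_sub iγu (iηu.const_mul G), integral_const_mul] at h1
  have e : ∀ x, g x • (u x - C) = γ x * u x - γ x * C := fun x => by
    rw [Complex.real_smul, mul_sub]
  simp only [e]
  rw [integral_sub iγu (iγ.mul_const C), integral_mul_const]
  exact h1

/-- The difference of w and a primitive of w' has weak derivative zero, so it is constant almost
everywhere and the primitive can be corrected by that constant. -/
theorem HasWeakDerivL2loc.exists_hasACDeriv {w w' : ℝ → ℂ} (hw : HasWeakDerivL2loc w w') :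
    ∃ v, HasACDeriv v w' ∧ v =ᵐ[volume] w := by
  have hV := hasACDeriv_integral hw.2.1.locallyIntegrable 0
  set V : ℝ → ℂ := fun x => 0 + ∫ t in (0 : ℝ)..x, w' t
  have hVl := hV.continuous.locallyIntegrable (μ := volume)
  obtain ⟨C, hC⟩ := ae_eq_const_of_integral_deriv_mul_eq_zero
    (hw.1.locallyIntegrable.sub hVl) fun φ hφ hc => by
      have hd : Continuous (deriv φ) := hφ.continuous_deriv (by simp)
      have i1 := hw.1.locallyIntegrable.integrable_smul_left_of_hasCompactSupport hd hc.deriv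
      have i2 := hVl.integrable_smul_left_of_hasCompactSupport hd hc.deriv
      simp only [smul_eq_mul] at i1 i2
      simp only [Pi.sub_apply, mul_sub]
      rw [integral_sub i1 i2, hw.2.2 φ hφ hc, hV.integral_deriv_mul hφ hc, sub_self]
  refine ⟨_, hasACDeriv_integral hw.2.1.locallyIntegrable C, ?_⟩
  filter_upwards [hC] with x hx
  simp only [Pi.sub_apply, V] at hx
  linear_combination -hx

/-! ### Operators on the period cell -/

instance : IsProbabilityMeasure cell := ⟨by simp⟩

theorem integrable_cell (f : L2k) : Integrable f cell := (Lp.memLp f).integrable (by norm_num)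

theorem integral_norm_le (f : L2k) : ∫ x, ‖f x‖ ∂cell ≤ ‖f‖ := by
  have h1 : eLpNorm f 1 cell ≤ eLpNorm f 2 cell :=
    eLpNorm_le_eLpNorm_of_exponent_le (by norm_num) (Lp.aestronglyMeasurable f)
  rw [integral_norm_eq_lintegral_enorm (Lp.aestronglyMeasurable f),
    ← eLpNorm_one_eq_lintegral_enorm,
    Lp.norm_def]
  exact ENNReal.toReal_mono (Lp.eLpNorm_ne_top f) h1

/-- The bounded continuous function on `ℝ` that coincides with `a` on `[0,1]` and is constant on
either side. -/
def clamp (a : ℝ → ℂ) (ha : Continuous a) : BoundedContinuousFunction ℝ ℂ :=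
  (BoundedContinuousFunction.mkOfCompact
    (⟨fun t : Set.Icc (0 : ℝ) 1 => a t, ha.comp continuous_subtype_val⟩ :
      C(Set.Icc (0 : ℝ) 1, ℂ))).compContinuous ⟨Set.projIcc 0 1 zero_le_one, continuous_projIcc⟩

theorem clamp_apply (a : ℝ → ℂ) (ha : Continuous a) (x : ℝ) :
    clamp a ha x = a (Set.projIcc 0 1 zero_le_one x) := rfl

theorem clamp_apply_of_mem (a : ℝ → ℂ) (ha : Continuous a) {x : ℝ} (hx : x ∈ Set.Ico (0 : ℝ) 1) :
    clamp a ha x = a x := by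
  rw [clamp_apply, Set.projIcc_of_mem _ (Set.Ico_subset_Icc_self hx)]

/-- Multiplication by a bounded continuous function on `L²_k`. -/
def cellMul : BoundedContinuousFunction ℝ ℂ →L[ℂ] L2k →L[ℂ] L2k :=
  (ContinuousLinearMap.mul ℂ ℂ).holderL cell ∞ 2 2 ∘L BoundedContinuousFunction.toLp ∞ cell ℂ

theorem cellMul_apply (b : BoundedContinuousFunction ℝ ℂ) (f : L2k) :
    cellMul b f =ᵐ[cell] fun x => b x * f x := by
  have h1 := (ContinuousLinearMap.mul ℂ ℂ).coeFn_holder (r := 2)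
    (BoundedContinuousFunction.toLp ∞ cell ℂ b) f
  filter_upwards [h1, BoundedContinuousFunction.coeFn_toLp ∞ cell ℂ b] with x hx hx'
  rw [← hx']
  exact hx

/-- Multiplication by a continuous function on `L²_k`. -/
def mulCont (a : ℝ → ℂ) (ha : Continuous a) : L2k →L[ℂ] L2k := cellMul (clamp a ha)

theorem mulCont_apply (a : ℝ → ℂ) (ha : Continuous a) (f : L2k) :
    mulCont a ha f =ᵐ[cell] fun x => a x * f x := by
  filter_upwards [cellMul_apply (clamp a ha) f, ae_restrict_mem measurableSet_Ico] with x hx hx'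
  rw [mulCont, hx, clamp_apply_of_mem a ha hx']

/-- The constant function `1`. -/
def cellOne : L2k := Lp.const 2 cell (1 : ℂ)

theorem cellOne_ae : cellOne =ᵐ[cell] fun _ => 1 := Lp.coeFn_const ..

theorem mulCont_one (a : ℝ → ℂ) (ha : Continuous a) : mulCont a ha cellOne =ᵐ[cell] a := by
  filter_upwards [mulCont_apply a ha cellOne, cellOne_ae] with x hx hx'
  rw [hx, hx', mul_one]

/-- Integration over the period. -/
def cellIntegral : L2k →L[ℂ] ℂ :=
  LinearMap.mkContinuous
    { toFun := fun f => ∫ x, f x ∂cell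
      map_add' := fun f g => by
        rw [← integral_add (integrable_cell f) (integrable_cell g)]
        exact integral_congr_ae (Lp.coeFn_add f g)
      map_smul' := fun c f => by
        rw [RingHom.id_apply, ← integral_smul]
        exact integral_congr_ae (Lp.coeFn_smul c f) } 1
    fun f => by
      rw [one_mul]
      exact (norm_integral_le_integral_norm _).trans (integral_norm_le f)

theorem cellIntegral_apply (f : L2k) : cellIntegral f = ∫ x, f x ∂cell := rfl

theorem cellIntegral_eq {f : L2k} {F : ℝ → ℂ} (h : f =ᵐ[cell] F) :
    cellIntegral f = ∫ t in (0 : ℝ)..1, F t := by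
  rw [cellIntegral_apply, integral_congr_ae h, intervalIntegral.integral_of_le zero_le_one,
    integral_Ioc_eq_integral_Ioo, integral_Ico_eq_integral_Ioo]

/-- The values of a representative outside [0,1) are arbitrary, so it is cut off before it is
integrated over intervals of ℝ. -/
theorem integrable_indicator_cell (f : L2k) :
    Integrable ((Set.Ico (0 : ℝ) 1).indicator f) volume :=
  (integrable_indicator_iff measurableSet_Ico).2 (integrable_cell f)

theorem continuous_integral_indicator (f : L2k) :
    Continuous fun x : ℝ => ∫ t in (0 : ℝ)..x, (Set.Ico (0 : ℝ) 1).indicator f t :=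
  intervalIntegral.continuous_primitive
    (fun _ _ => (integrable_indicator_cell f).intervalIntegrable) 0

theorem intervalIntegral_congr_cell {f g : ℝ → ℂ} (h : f =ᵐ[cell] g) {x : ℝ}
    (hx : x ∈ Set.Icc (0 : ℝ) 1) : ∫ t in (0 : ℝ)..x, f t = ∫ t in (0 : ℝ)..x, g t := by
  rw [intervalIntegral.integral_of_le hx.1, intervalIntegral.integral_of_le hx.1,
    integral_Ioc_eq_integral_Ioo, integral_Ioc_eq_integral_Ioo]
  have hsub : Set.Ioo 0 x ⊆ Set.Ico (0 : ℝ) 1 := fun t ht => ⟨ht.1.le, ht.2.trans_le hx.2⟩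
  exact integral_congr_ae (ae_restrict_of_ae_restrict_of_subset hsub h)

theorem indicator_cell_ae (f : ℝ → ℂ) : (Set.Ico (0 : ℝ) 1).indicator f =ᵐ[cell] f := by
  filter_upwards [ae_restrict_mem measurableSet_Ico] with x hx
  rw [Set.indicator_of_mem hx]

/-- The Volterra operator `f ↦ ∫₀ˣ f` on `L²_k`, before continuity is established. -/
def volterraAux (f : L2k) : L2k :=
  BoundedContinuousFunction.toLp 2 cell ℂ
    (clamp (fun x => ∫ t in (0 : ℝ)..x, (Set.Ico (0 : ℝ) 1).indicator f t)
      (continuous_integral_indicator f))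

theorem volterraAux_apply {f : L2k} {F : ℝ → ℂ} (h : f =ᵐ[cell] F) :
    volterraAux f =ᵐ[cell] fun x => ∫ t in (0 : ℝ)..x, F t := by
  filter_upwards [BoundedContinuousFunction.coeFn_toLp 2 cell ℂ
    (clamp (fun x => ∫ t in (0 : ℝ)..x, (Set.Ico (0 : ℝ) 1).indicator f t)
      (continuous_integral_indicator f)), ae_restrict_mem measurableSet_Ico] with x hx hx'
  rw [volterraAux, hx, clamp_apply_of_mem _ _ hx']
  exact intervalIntegral_congr_cell ((indicator_cell_ae f).trans h) (Set.Ico_subset_Icc_self hx')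

theorem intervalIntegrable_cell (f : L2k) {x : ℝ} (hx : x ∈ Set.Icc (0 : ℝ) 1) :
    IntervalIntegrable f volume 0 x := by
  rw [intervalIntegrable_iff_integrableOn_Ioc_of_le hx.1, integrableOn_Ioc_iff_integrableOn_Ioo]
  exact IntegrableOn.mono_set (integrable_cell f) fun t ht => ⟨ht.1.le, ht.2.trans_le hx.2⟩

/-- The Volterra operator `f ↦ ∫₀ˣ f` on `L²_k`. -/
def volterra : L2k →L[ℂ] L2k :=
  LinearMap.mkContinuous
    { toFun := volterraAux
      map_add' := fun f g => by
        refine Lp.ext ?_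
        filter_upwards [volterraAux_apply (Lp.coeFn_add f g),
          Lp.coeFn_add (volterraAux f) (volterraAux g),
          volterraAux_apply (f := f) (ae_eq_refl _), volterraAux_apply (f := g) (ae_eq_refl _),
          ae_restrict_mem measurableSet_Ico] with x h1 h2 h3 h4 h5
        have h5' := Set.Ico_subset_Icc_self h5
        rw [h1, h2, Pi.add_apply, h3, h4, ← intervalIntegral.integral_add
          (intervalIntegrable_cell f h5') (intervalIntegrable_cell g h5')]
        rfl
      map_smul' := fun c f => by
        refine Lp.ext ?_
        filter_upwards [volterraAux_apply (Lp.coeFn_smul c f), Lp.coeFn_smul c (volterraAux f),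
          volterraAux_apply (f := f) (ae_eq_refl _)] with x h1 h2 h3
        rw [h1, RingHom.id_apply, h2, Pi.smul_apply, h3, ← intervalIntegral.integral_smul]
        rfl } 1
    fun f => by
      have := Lp.norm_le_of_ae_bound (f := volterraAux f) (C := ‖f‖) (norm_nonneg f) (by
        filter_upwards [volterraAux_apply (f := f) (ae_eq_refl _),
          ae_restrict_mem measurableSet_Ico] with x h1 h5
        rw [h1, intervalIntegral.integral_of_le h5.1, integral_Ioc_eq_integral_Ioo]
        refine (norm_integral_le_integral_norm _).trans (le_trans ?_ (integral_norm_le f))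
        exact setIntegral_mono_set (integrable_cell f).norm
          (Filter.Eventually.of_forall fun _ => norm_nonneg _)
          (LE.le.eventuallyLE fun t ht => ⟨ht.1.le, ht.2.trans h5.2⟩))
      simpa [measureUnivNNReal] using this

theorem volterra_apply {f : L2k} {F : ℝ → ℂ} (h : f =ᵐ[cell] F) :
    volterra f =ᵐ[cell] fun x => ∫ t in (0 : ℝ)..x, F t := volterraAux_apply h

/-! ### Quasi-periodic extension -/

theorem floquet_ne_zero (k : ℂ) (h : ℝ) : floquet k h ≠ 0 := Complex.exp_ne_zero _

/-- The quasi-periodic extension of a function on `[0,1)`. -/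
def quasiExtension (k : ℂ) (h : ℝ) (f : ℝ → ℂ) (x : ℝ) : ℂ :=
  floquet k h ^ ⌊x⌋ * f (Int.fract x)

theorem quasiExtension_of_mem (k : ℂ) (h : ℝ) (f : ℝ → ℂ) {x : ℝ} (hx : x ∈ Set.Ico (0 : ℝ) 1) :
    quasiExtension k h f x = f x := by
  rw [quasiExtension, Int.floor_eq_zero_iff.2 hx, Int.fract_eq_self.2 hx, zpow_zero, one_mul]

theorem isQuasiPeriodic_quasiExtension (k : ℂ) (h : ℝ) (f : ℝ → ℂ) :
    IsQuasiPeriodic k h (quasiExtension k h f) := by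
  intro x
  rw [quasiExtension, quasiExtension, Int.floor_add_one, Int.fract_add_one,
    zpow_add_one₀ (floquet_ne_zero k h), floquet]
  ring

theorem quasiExtension_ae (k : ℂ) (h : ℝ) (f : ℝ → ℂ) : quasiExtension k h f =ᵐ[cell] f := by
  filter_upwards [ae_restrict_mem measurableSet_Ico] with x hx using quasiExtension_of_mem k h f hx

/-- On [n, n+1) the extension is the translate of f times a power of the multiplier, and a compact
set meets only finitely many of these intervals. -/
theorem isL2loc_quasiExtension (k : ℂ) (h : ℝ) (f : L2k) : IsL2loc (quasiExtension k h f) := by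
  have hm : Measurable (quasiExtension k h f) := by
    have h1 : Measurable fun n : ℤ => floquet k h ^ n := measurable_from_top
    exact (h1.comp Int.measurable_floor).mul
      ((Lp.stronglyMeasurable f).measurable.comp measurable_fract)
  have hsq : ∀ n : ℤ, IntegrableOn (fun x => ‖quasiExtension k h f x‖ ^ 2)
      (Set.Ico (n : ℝ) (n + 1)) := by
    intro n
    have h1 : Integrable (fun x => ‖f x‖ ^ 2) cell :=
      (memLp_two_iff_integrable_sq_norm (Lp.aestronglyMeasurable f)).1 (Lp.memLp f)
    have hpre : (fun x : ℝ => x + (-n : ℝ)) ⁻¹' Set.Ico 0 1 = Set.Ico (n : ℝ) (n + 1) := by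
      ext x
      simp only [Set.mem_preimage, Set.mem_Ico]
      constructor <;> rintro ⟨h1, h2⟩ <;> constructor <;> linarith
    have h2 := (measurePreserving_add_right volume (-n : ℝ)).restrict_preimage
      (s := Set.Ico (0 : ℝ) 1) measurableSet_Ico
    rw [hpre] at h2
    have h3 := ((h2.integrable_comp h1.aestronglyMeasurable).2 h1).const_mul (‖floquet k h ^ n‖ ^ 2)
    refine h3.congr ?_
    filter_upwards [ae_restrict_mem measurableSet_Ico] with x hx
    have hfl : ⌊x⌋ = n := Int.floor_eq_iff.2 hx
    rw [quasiExtension, Int.fract, hfl, norm_mul, mul_pow, Function.comp_apply, sub_eq_add_neg]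
  intro K hK
  rw [memLp_two_iff_integrable_sq_norm hm.aestronglyMeasurable]
  obtain ⟨R, hR⟩ := hK.isBounded.subset_closedBall 0
  have h1 : IntegrableOn (fun x => ‖quasiExtension k h f x‖ ^ 2)
      (⋃ n ∈ Set.Icc ⌊-R⌋ ⌊R⌋, Set.Ico (n : ℝ) (n + 1)) :=
    (integrableOn_finite_biUnion (Set.finite_Icc _ _)).2 fun n _ => hsq n
  refine h1.mono_set fun x hx => ?_
  have hx' : |x| ≤ R := by simpa using hR hx
  rw [abs_le] at hx'
  exact Set.mem_biUnion (x := ⌊x⌋) ⟨Int.floor_mono hx'.1, Int.floor_mono hx'.2⟩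
    ⟨Int.floor_le x, Int.lt_floor_add_one x⟩

/-! ### The fundamental solutions on the real line -/

/-- Holomorphy in μ for the supremum norm on [0,1], not only pointwise: the Dyson series converges
uniformly there. It makes the multiplication operators, and with them `greenVolterra`, holomorphic
in operator norm. -/
theorem differentiable_clamp_sol {q u₀ : ℂ → ℂ} (hq : Differentiable ℂ q)
    (hu : Differentiable ℂ u₀) : Differentiable ℂ fun μ => clamp (fun x : ℝ => sol q u₀ μ x)
      ((differentiable_sol hq hu μ).continuous.comp Complex.continuous_ofReal) := by
  have hc : ∀ n, Continuous fun x : ℝ => dyson q u₀ n x := fun n =>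
    (differentiable_dyson hq hu n).continuous.comp Complex.continuous_ofReal
  intro μ
  obtain ⟨b, hb, hle⟩ := exists_summable_dyson_bound hq hu 1 (‖μ‖ + 1)
  have hbd : ∀ (n : ℕ) (ν : ℂ), ν ∈ Metric.ball 0 (‖μ‖ + 1) →
      ‖ν ^ n • clamp (fun x : ℝ => dyson q u₀ n x) (hc n)‖ ≤ b n := by
    intro n ν hν
    have hν' : ‖ν‖ ≤ ‖μ‖ + 1 := (mem_ball_zero_iff.1 hν).le
    have hb0 : 0 ≤ b n := (norm_nonneg _).trans (hle n 0 ν (by simp) hν').1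
    refine (BoundedContinuousFunction.norm_le hb0).2 fun x => ?_
    refine (hle n (Set.projIcc (0 : ℝ) 1 zero_le_one x : ℝ) ν ?_ hν').1
    have := (Set.projIcc (0 : ℝ) 1 zero_le_one x).2
    rw [Complex.norm_real, Real.norm_of_nonneg this.1]
    exact this.2
  have hd := Complex.differentiableOn_tsum_of_summable_norm (U := Metric.ball 0 (‖μ‖ + 1)) hb
    (F := fun n ν => ν ^ n • clamp (fun x : ℝ => dyson q u₀ n x) (hc n))
    (fun n => ((differentiable_id.pow n).smul_const _).differentiableOn) Metric.isOpen_ball hbd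
  have hmem : Metric.ball 0 (‖μ‖ + 1) ∈ 𝓝 μ := Metric.isOpen_ball.mem_nhds (by simp)
  refine (hd.differentiableAt hmem).congr_of_eventuallyEq ?_
  filter_upwards [hmem] with ν hν
  have hs : Summable fun n => ν ^ n • clamp (fun x : ℝ => dyson q u₀ n x) (hc n) :=
    Summable.of_norm_bounded hb fun n => hbd n ν hν
  ext x
  have h1 := (BoundedContinuousFunction.evalCLM ℂ x).hasSum hs.hasSum
  refine (hasSum_sol hq hu ν _).unique ?_
  simpa [clamp_apply, Function.comp_def] using h1

section realLine

variable {q : ℂ → ℂ} (hq : Differentiable ℂ q) (μ : ℂ)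

include hq

theorem continuous_cosSol : Continuous fun x : ℝ => cosSol q μ x :=
  (differentiable_cosSol hq μ).continuous.comp Complex.continuous_ofReal

theorem continuous_sinSol : Continuous fun x : ℝ => sinSol q μ x :=
  (differentiable_sinSol hq μ).continuous.comp Complex.continuous_ofReal

theorem continuous_deriv_cosSol : Continuous fun x : ℝ => deriv (cosSol q μ) x :=
  (continuous_iff_continuousAt.2 fun z => (hasDerivAt_deriv_cosSol hq μ z).continuousAt).comp
    Complex.continuous_ofReal

theorem continuous_deriv_sinSol : Continuous fun x : ℝ => deriv (sinSol q μ) x :=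
  (continuous_iff_continuousAt.2 fun z => (hasDerivAt_deriv_sinSol hq μ z).continuousAt).comp
    Complex.continuous_ofReal

theorem continuous_potential : Continuous fun x : ℝ => q x :=
  hq.continuous.comp Complex.continuous_ofReal

theorem hasDerivAt_real_cosSol (x : ℝ) :
    HasDerivAt (fun x : ℝ => cosSol q μ x) (deriv (cosSol q μ) x) x :=
  (differentiable_cosSol hq μ x).hasDerivAt.comp_ofReal

theorem hasDerivAt_real_sinSol (x : ℝ) :
    HasDerivAt (fun x : ℝ => sinSol q μ x) (deriv (sinSol q μ) x) x :=
  (differentiable_sinSol hq μ x).hasDerivAt.comp_ofReal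

theorem hasDerivAt_real_deriv_cosSol (x : ℝ) :
    HasDerivAt (fun x : ℝ => deriv (cosSol q μ) x) (μ * q x * cosSol q μ x) x :=
  (hasDerivAt_deriv_cosSol hq μ x).comp_ofReal

theorem hasDerivAt_real_deriv_sinSol (x : ℝ) :
    HasDerivAt (fun x : ℝ => deriv (sinSol q μ) x) (μ * q x * sinSol q μ x) x :=
  (hasDerivAt_deriv_sinSol hq μ x).comp_ofReal

theorem continuous_mul_cosSol : Continuous fun x : ℝ => μ * q x * cosSol q μ x :=
  (continuous_const.mul (continuous_potential hq)).mul (continuous_cosSol hq μ)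

theorem continuous_mul_sinSol : Continuous fun x : ℝ => μ * q x * sinSol q μ x :=
  (continuous_const.mul (continuous_potential hq)).mul (continuous_sinSol hq μ)

/-- Variation of constants. -/
theorem variation_of_constants {v v' g : ℝ → ℂ} (h1 : HasACDeriv v v')
    (h2 : HasACDeriv v' fun x => μ * q x * v x + g x) (x : ℝ) :
    v x * deriv (sinSol q μ) x - v' x * sinSol q μ x =
        v 0 - ∫ t in (0 : ℝ)..x, sinSol q μ t * g t ∧
      v' x * cosSol q μ x - v x * deriv (cosSol q μ) x =
        v' 0 + ∫ t in (0 : ℝ)..x, cosSol q μ t * g t := by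
  -- In the derivatives of both Wronskian-type combinations the terms with μq cancel, and only the
  -- source g survives.
  have a1 := (h1.mul (hasDerivAt_real_deriv_sinSol hq μ) (continuous_mul_sinSol hq μ)).add
    (h2.mul (hasDerivAt_real_sinSol hq μ) (continuous_deriv_sinSol hq μ)).neg
  have a2 := (h2.mul (hasDerivAt_real_cosSol hq μ) (continuous_deriv_cosSol hq μ)).add
    (h1.mul (hasDerivAt_real_deriv_cosSol hq μ) (continuous_mul_cosSol hq μ)).neg
  have e1 := (a1.congr (g := fun x => -(sinSol q μ x * g x))
    (Filter.Eventually.of_forall fun x => by ring)).sub_eq 0 x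
  have e2 := (a2.congr (g := fun x => cosSol q μ x * g x)
    (Filter.Eventually.of_forall fun x => by ring)).sub_eq 0 x
  rw [intervalIntegral.integral_neg] at e1
  simp only [Complex.ofReal_zero, cosSol_zero hq, sinSol_zero hq, deriv_cosSol_zero hq,
    deriv_sinSol_zero hq] at e1 e2
  exact ⟨by linear_combination e1, by linear_combination e2⟩

theorem eq_of_variation_of_constants {v v' g : ℝ → ℂ} (h1 : HasACDeriv v v')
    (h2 : HasACDeriv v' fun x => μ * q x * v x + g x) (x : ℝ) :
    v x = cosSol q μ x * (v 0 - ∫ t in (0 : ℝ)..x, sinSol q μ t * g t) +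
        sinSol q μ x * (v' 0 + ∫ t in (0 : ℝ)..x, cosSol q μ t * g t) ∧
      v' x = deriv (cosSol q μ) x * (v 0 - ∫ t in (0 : ℝ)..x, sinSol q μ t * g t) +
        deriv (sinSol q μ) x * (v' 0 + ∫ t in (0 : ℝ)..x, cosSol q μ t * g t) := by
  obtain ⟨e1, e2⟩ := variation_of_constants hq μ h1 h2 x
  have hw := wronskian_eq_one hq μ x
  rw [← e1, ← e2]
  exact ⟨by linear_combination -v x * hw, by linear_combination -v' x * hw⟩

end realLine

/-! ### The Green operator -/

section green

variable {q : ℂ → ℂ} (hq : Differentiable ℂ q) (μ : ℂ)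

/-- Multiplication by `cosSol`. -/
def cosMul : L2k →L[ℂ] L2k := mulCont (fun x : ℝ => cosSol q μ x) (continuous_cosSol hq μ)

/-- Multiplication by `sinSol`. -/
def sinMul : L2k →L[ℂ] L2k := mulCont (fun x : ℝ => sinSol q μ x) (continuous_sinSol hq μ)

/-- Multiplication by the derivative of `cosSol`. -/
def derivCosMul : L2k →L[ℂ] L2k :=
  mulCont (fun x : ℝ => deriv (cosSol q μ) x) (continuous_deriv_cosSol hq μ)

/-- Multiplication by the derivative of `sinSol`. -/
def derivSinMul : L2k →L[ℂ] L2k :=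
  mulCont (fun x : ℝ => deriv (sinSol q μ) x) (continuous_deriv_sinSol hq μ)

/-- Multiplication by the potential `q`. -/
def potMul : L2k →L[ℂ] L2k := mulCont (fun x : ℝ => q x) (continuous_potential hq)

/-- The solution operator of `w'' = μ q w + g`, `w(0) = w'(0) = 0`. -/
def greenVolterra : L2k →L[ℂ] L2k :=
  sinMul hq μ ∘L volterra ∘L cosMul hq μ - cosMul hq μ ∘L volterra ∘L sinMul hq μ

/-- The derivative of `greenVolterra`. -/
def derivGreenVolterra : L2k →L[ℂ] L2k :=
  derivSinMul hq μ ∘L volterra ∘L cosMul hq μ - derivCosMul hq μ ∘L volterra ∘L sinMul hq μ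

/-- The fundamental solutions as elements of `L²`. -/
def fundVec (i : Fin 2) : L2k := (![cosMul hq μ cellOne, sinMul hq μ cellOne] : Fin 2 → L2k) i

/-- The increments over a period of the varied constants. -/
def increment (i : Fin 2) : StrongDual ℂ L2k :=
  (![-(cellIntegral ∘L sinMul hq μ), cellIntegral ∘L cosMul hq μ] : Fin 2 → StrongDual ℂ L2k) i

theorem differentiable_cosMul : Differentiable ℂ (cosMul hq) :=
  cellMul.differentiable.comp (differentiable_clamp_sol hq (differentiable_const 1))

theorem differentiable_sinMul : Differentiable ℂ (sinMul hq) :=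
  cellMul.differentiable.comp (differentiable_clamp_sol hq differentiable_fun_id)

theorem differentiable_greenVolterra : Differentiable ℂ (greenVolterra hq) := by
  have h1 := differentiable_cosMul hq
  have h2 := differentiable_sinMul hq
  unfold greenVolterra
  exact (h2.clm_comp ((differentiable_const _).clm_comp h1)).sub
    (h1.clm_comp ((differentiable_const _).clm_comp h2))

theorem differentiable_fundVec (i : Fin 2) : Differentiable ℂ fun μ => fundVec hq μ i := by
  fin_cases i
  exacts [(differentiable_cosMul hq).clm_apply (differentiable_const _),
    (differentiable_sinMul hq).clm_apply (differentiable_const _)]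

theorem differentiable_increment (i : Fin 2) : Differentiable ℂ fun μ => increment hq μ i := by
  fin_cases i
  exacts [((differentiable_const cellIntegral).clm_comp (differentiable_sinMul hq)).neg,
    (differentiable_const cellIntegral).clm_comp (differentiable_cosMul hq)]

theorem mulCont_comp_volterra_apply {a b : ℝ → ℂ} (ha : Continuous a) (hb : Continuous b)
    {g : L2k} {G : ℝ → ℂ} (hG : g =ᵐ[cell] G) :
    mulCont a ha (volterra (mulCont b hb g)) =ᵐ[cell]
      fun x => a x * ∫ t in (0 : ℝ)..x, b t * G t := by
  have h1 : mulCont b hb g =ᵐ[cell] fun x => b x * G x := by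
    filter_upwards [mulCont_apply b hb g, hG] with x hx hx'
    rw [hx, hx']
  filter_upwards [mulCont_apply a ha (volterra (mulCont b hb g)), volterra_apply h1] with x h2 h3
  rw [h2, h3]

theorem cellIntegral_mulCont {b : ℝ → ℂ} (hb : Continuous b) {g : L2k} {G : ℝ → ℂ}
    (hG : g =ᵐ[cell] G) :
    cellIntegral (mulCont b hb g) = ∫ t in (0 : ℝ)..1, b t * G t := by
  refine cellIntegral_eq ?_
  filter_upwards [mulCont_apply b hb g, hG] with x hx hx'
  rw [hx, hx']

/-- The value, first and second derivative of the solution of `w'' = μ q w + g`, `w(0) = c 0`,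
`w'(0) = c 1`. -/
def solTriple (c : Fin 2 → ℂ) (g : L2k) : L2k × L2k × L2k :=
  (∑ i, c i • fundVec hq μ i + greenVolterra hq μ g,
    c 0 • derivCosMul hq μ cellOne + c 1 • derivSinMul hq μ cellOne + derivGreenVolterra hq μ g,
    μ • potMul hq (∑ i, c i • fundVec hq μ i + greenVolterra hq μ g) + g)

theorem combination_ae (c : Fin 2 → ℂ) {g : L2k} {G : ℝ → ℂ} (hG : g =ᵐ[cell] G) {a b : ℝ → ℂ}
    (ha : Continuous a) (hb : Continuous b) :
    ((c 0 • mulCont a ha cellOne + c 1 • mulCont b hb cellOne +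
      (mulCont b hb (volterra (cosMul hq μ g)) - mulCont a ha (volterra (sinMul hq μ g))) : L2k) :
        ℝ → ℂ) =ᵐ[cell]
      fun x => a x * (c 0 - ∫ t in (0 : ℝ)..x, sinSol q μ t * G t) +
        b x * (c 1 + ∫ t in (0 : ℝ)..x, cosSol q μ t * G t) := by
  filter_upwards [Lp.coeFn_add (c 0 • mulCont a ha cellOne + c 1 • mulCont b hb cellOne)
      (mulCont b hb (volterra (cosMul hq μ g)) - mulCont a ha (volterra (sinMul hq μ g))),
    Lp.coeFn_add (c 0 • mulCont a ha cellOne) (c 1 • mulCont b hb cellOne),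
    Lp.coeFn_smul (c 0) (mulCont a ha cellOne), Lp.coeFn_smul (c 1) (mulCont b hb cellOne),
    Lp.coeFn_sub (mulCont b hb (volterra (cosMul hq μ g)))
      (mulCont a ha (volterra (sinMul hq μ g))),
    mulCont_one a ha, mulCont_one b hb,
    mulCont_comp_volterra_apply hb (continuous_cosSol hq μ) hG,
    mulCont_comp_volterra_apply ha (continuous_sinSol hq μ) hG] with x h1 h2 h3 h4 h5 h6 h7 h8 h9
  rw [h1, Pi.add_apply, h2, Pi.add_apply, h3, h4, Pi.smul_apply, Pi.smul_apply, h5, Pi.sub_apply,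
    h6, h7, cosMul, sinMul, h8, h9, smul_eq_mul, smul_eq_mul]
  ring

/-- The source is extended quasi-periodically and the equation is solved on all of ℝ. The left side
of `hc` is the Cauchy data of the solution at 1, so `hc` asks that it be ρ times the data at 0; as
equation and source are compatible with the translation, quasi-periodicity propagates to all x. -/
theorem solTriple_mem (hper : ∀ z, q (z + 1) = q z) (k : ℂ) (h : ℝ) (c : Fin 2 → ℂ) (g : L2k)
    (hc : monodromy q μ *ᵥ (fun i => c i + increment hq μ i g) = floquet k h • c) :
    solTriple hq μ c g ∈ H2kSubmodule k h := by
  set F := quasiExtension k h g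
  have hFg : g =ᵐ[cell] F := (quasiExtension_ae k h g).symm
  have hFl : IsL2loc F := isL2loc_quasiExtension k h g
  have hFq : ∀ x, F (x + 1) = floquet k h * F x := isQuasiPeriodic_quasiExtension k h g
  have cC := continuous_cosSol hq μ
  have cS := continuous_sinSol hq μ
  have lS : LocallyIntegrable fun t : ℝ => sinSol q μ t * F t :=
    hFl.locallyIntegrable.continuous_smul cS
  have lC : LocallyIntegrable fun t : ℝ => cosSol q μ t * F t :=
    hFl.locallyIntegrable.continuous_smul cC
  set a : ℝ → ℂ := fun x => c 0 - ∫ t in (0 : ℝ)..x, sinSol q μ t * F t with hadef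
  set b : ℝ → ℂ := fun x => c 1 + ∫ t in (0 : ℝ)..x, cosSol q μ t * F t with hbdef
  have ha : HasACDeriv a fun x => -(sinSol q μ x * F x) := by
    convert (hasACDeriv_integral lS (-(c 0))).neg using 2 with x
    simp only [hadef]; ring
  have hb : HasACDeriv b fun x => cosSol q μ x * F x := hasACDeriv_integral lC (c 1)
  set w : ℝ → ℂ := fun x => cosSol q μ x * a x + sinSol q μ x * b x with hwdef
  set w' : ℝ → ℂ := fun x => deriv (cosSol q μ) x * a x + deriv (sinSol q μ) x * b x with hwdef'
  have hw : HasACDeriv w w' :=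
    ((ha.mul (hasDerivAt_real_cosSol hq μ) (continuous_deriv_cosSol hq μ)).add
      (hb.mul (hasDerivAt_real_sinSol hq μ) (continuous_deriv_sinSol hq μ))).congr
      (Filter.Eventually.of_forall fun x => by simp only [hwdef']; ring)
  have hw' : HasACDeriv w' fun x => μ * q x * w x + F x :=
    ((ha.mul (hasDerivAt_real_deriv_cosSol hq μ) (continuous_mul_cosSol hq μ)).add
      (hb.mul (hasDerivAt_real_deriv_sinSol hq μ) (continuous_mul_sinSol hq μ))).congr
      (Filter.Eventually.of_forall fun x => by
        simp only [hwdef]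
        linear_combination F x * wronskian_eq_one hq μ x)
  have hwq : IsQuasiPeriodic k h w := by
    intro x
    change w (x + 1) = floquet k h * w x
    have hdet := wronskian_eq_one hq μ 1
    have hS : ∀ t : ℝ, sinSol q μ ((t + 1 : ℝ) : ℂ) =
        sinSol q μ 1 * cosSol q μ t + deriv (sinSol q μ) 1 * sinSol q μ t := fun t => by
      simpa using (sinSol_add_one hq μ hper t).1
    have hC : ∀ t : ℝ, cosSol q μ ((t + 1 : ℝ) : ℂ) =
        cosSol q μ 1 * cosSol q μ t + deriv (cosSol q μ) 1 * sinSol q μ t := fun t => by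
      simpa using (cosSol_add_one hq μ hper t).1
    have iS := locallyIntegrable_intervalIntegrable lS 0 x
    have iC := locallyIntegrable_intervalIntegrable lC 0 x
    -- The integral up to x + 1 is the increment over a full period plus the integral up to x of the
    -- translated integrand, which the addition formulas express through the original integrals.
    have hshift : ∀ f : ℝ → ℂ, LocallyIntegrable f → ∫ t in (0 : ℝ)..(x + 1), f t =
        (∫ t in (0 : ℝ)..1, f t) + ∫ t in (0 : ℝ)..x, f (t + 1) := fun f hf => by
      rw [intervalIntegral.integral_comp_add_right, zero_add,
        intervalIntegral.integral_add_adjacent_intervals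
          (locallyIntegrable_intervalIntegrable hf 0 1)
          (locallyIntegrable_intervalIntegrable hf 1 (x + 1))]
    have hcomb : ∀ α β : ℂ, ∫ t in (0 : ℝ)..x,
        (α * cosSol q μ t + β * sinSol q μ t) * (floquet k h * F t) =
          floquet k h * (α * (∫ t in (0 : ℝ)..x, cosSol q μ t * F t) +
            β * ∫ t in (0 : ℝ)..x, sinSol q μ t * F t) := by
      intro α β
      have e : ∀ t : ℝ, (α * cosSol q μ t + β * sinSol q μ t) * (floquet k h * F t) =
          floquet k h * (α * (cosSol q μ t * F t) + β * (sinSol q μ t * F t)) := fun t => by ring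
      simp only [e]
      rw [intervalIntegral.integral_const_mul, intervalIntegral.integral_add (iC.const_mul α)
        (iS.const_mul β), intervalIntegral.integral_const_mul, intervalIntegral.integral_const_mul]
    have i1 := hshift _ lS
    have i2 := hshift _ lC
    simp only [hS, hC, hFq, hcomb] at i1 i2
    have g1 : cellIntegral (sinMul hq μ g) = ∫ t in (0 : ℝ)..1, sinSol q μ t * F t :=
      cellIntegral_mulCont cS hFg
    have g2 : cellIntegral (cosMul hq μ g) = ∫ t in (0 : ℝ)..1, cosSol q μ t * F t :=
      cellIntegral_mulCont cC hFg
    have c1 := congrFun hc 0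
    have c2 := congrFun hc 1
    simp [Matrix.mulVec, dotProduct, Fin.sum_univ_two, monodromy, cauchyMatrix, increment, g1,
      g2] at c1 c2
    simp only [hwdef, hadef, hbdef, hS, hC, i1, i2]
    set X := ∫ t in (0 : ℝ)..x, cosSol q μ t * F t
    set Y := ∫ t in (0 : ℝ)..x, sinSol q μ t * F t
    -- The two components of `hc` settle the constants and the full-period increments; det Φ(1) = 1
    -- settles the integrals X and Y.
    linear_combination cosSol q μ x * c1 + sinSol q μ x * c2 +
      floquet k h * (sinSol q μ x * X - cosSol q μ x * Y) * hdet
  have hsum : ∑ i, c i • fundVec hq μ i =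
      c 0 • cosMul hq μ cellOne + c 1 • sinMul hq μ cellOne := by
    simp [Fin.sum_univ_two, fundVec]
  have p1 : (solTriple hq μ c g).1 =ᵐ[cell] w := by
    rw [solTriple, hsum]
    exact combination_ae hq μ c hFg cC cS
  have hwF : IsL2loc fun x => μ * q x * w x + F x := fun K hK =>
    (((continuous_const.mul (continuous_potential hq)).mul hw.continuous).isL2loc K hK).add
      (hFl K hK)
  refine ⟨w, w', fun x => μ * q x * w x + F x, hwq, hw.hasWeakDerivL2loc hw'.continuous.isL2loc,
    hw'.hasWeakDerivL2loc hwF, p1, ?_, ?_⟩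
  · exact combination_ae hq μ c hFg (continuous_deriv_cosSol hq μ) (continuous_deriv_sinSol hq μ)
  · change ((μ • potMul hq (solTriple hq μ c g).1 + g : L2k) : ℝ → ℂ) =ᵐ[cell] _
    filter_upwards [p1, hFg, Lp.coeFn_add (μ • potMul hq (solTriple hq μ c g).1) g,
      Lp.coeFn_smul μ (potMul hq (solTriple hq μ c g).1),
      mulCont_apply _ (continuous_potential hq) (solTriple hq μ c g).1] with x h1 h2 h3 h4 h5
    rw [h3, Pi.add_apply, h4, Pi.smul_apply, potMul, h5, h1, h2, smul_eq_mul]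
    ring

end green

/-! ### The derivative of the monodromy matrix -/

section monodromyDerivative

variable {q : ℂ → ℂ} (hq : Differentiable ℂ q)

theorem potMul_fundVec_ae (ν : ℂ) :
    potMul hq (fundVec hq ν 0) =ᵐ[cell] (fun x : ℝ => q x * cosSol q ν x) ∧
    potMul hq (fundVec hq ν 1) =ᵐ[cell] fun x : ℝ => q x * sinSol q ν x := by
  constructor
  · filter_upwards [mulCont_apply _ (continuous_potential hq) (cosMul hq ν cellOne),
      mulCont_one _ (continuous_cosSol hq ν)] with x h1 h2
    exact h1.trans (congrArg _ h2)
  · filter_upwards [mulCont_apply _ (continuous_potential hq) (sinMul hq ν cellOne),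
      mulCont_one _ (continuous_sinSol hq ν)] with x h1 h2
    exact h1.trans (congrArg _ h2)

/-- Duhamel's principle: a solution u for the parameter ν solves the equation for μ with source (ν -
μ)qu. The identity is exact, with no error term to estimate. -/
theorem monodromy_eq (μ ν : ℂ) (i j : Fin 2) : monodromy q ν i j = monodromy q μ i j +
    (ν - μ) * ∑ l, monodromy q μ i l * increment hq μ l (potMul hq (fundVec hq ν j)) := by
  have key : ∀ {v v' : ℝ → ℂ} (f : L2k), (∀ x, HasDerivAt v (v' x) x) →
      (∀ x : ℝ, HasDerivAt v' (ν * q x * v x) x) → (f =ᵐ[cell] fun x : ℝ => q x * v x) →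
      v 1 = cosSol q μ 1 * (v 0 - (ν - μ) * cellIntegral (sinMul hq μ f)) +
        sinSol q μ 1 * (v' 0 + (ν - μ) * cellIntegral (cosMul hq μ f)) ∧
      v' 1 = deriv (cosSol q μ) 1 * (v 0 - (ν - μ) * cellIntegral (sinMul hq μ f)) +
        deriv (sinSol q μ) 1 * (v' 0 + (ν - μ) * cellIntegral (cosMul hq μ f)) := by
    intro v v' f hv hv' hf
    have hvc : Continuous v := continuous_iff_continuousAt.2 fun x => (hv x).continuousAt
    have hvc' : Continuous v' := continuous_iff_continuousAt.2 fun x => (hv' x).continuousAt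
    have hp := continuous_potential hq
    have := eq_of_variation_of_constants hq μ (g := fun x => (ν - μ) * (q x * v x))
      (hasACDeriv_of_hasDerivAt hv hvc')
      ((hasACDeriv_of_hasDerivAt hv' ((continuous_const.mul hp).mul hvc)).congr
        (Filter.Eventually.of_forall fun x => by ring)) 1
    have e1 : ∫ t in (0 : ℝ)..1, sinSol q μ t * ((ν - μ) * (q t * v t)) =
        (ν - μ) * cellIntegral (sinMul hq μ f) := by
      rw [sinMul, cellIntegral_mulCont _ hf, ← intervalIntegral.integral_const_mul]
      congr 1; funext t; ring
    have e2 : ∫ t in (0 : ℝ)..1, cosSol q μ t * ((ν - μ) * (q t * v t)) =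
        (ν - μ) * cellIntegral (cosMul hq μ f) := by
      rw [cosMul, cellIntegral_mulCont _ hf, ← intervalIntegral.integral_const_mul]
      congr 1; funext t; ring
    rw [e1, e2] at this
    simpa using this
  have kc := key _ (hasDerivAt_real_cosSol hq ν) (hasDerivAt_real_deriv_cosSol hq ν)
    (potMul_fundVec_ae hq ν).1
  have ks := key _ (hasDerivAt_real_sinSol hq ν) (hasDerivAt_real_deriv_sinSol hq ν)
    (potMul_fundVec_ae hq ν).2
  simp only [Complex.ofReal_zero, Complex.ofReal_one, cosSol_zero hq, sinSol_zero hq,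
    deriv_cosSol_zero hq, deriv_sinSol_zero hq] at kc ks
  fin_cases i <;> fin_cases j <;>
    simp [monodromy, cauchyMatrix, Fin.sum_univ_two, increment]
  · linear_combination kc.1
  · linear_combination ks.1
  · linear_combination kc.2
  · linear_combination ks.2

/-- In `monodromy_eq` the factor ν - μ vanishes at ν = μ, so the product rule leaves only the value
of the other factor there. -/
theorem hasDerivAt_monodromy (μ : ℂ) (i j : Fin 2) : HasDerivAt (fun ν => monodromy q ν i j)
    (∑ l, monodromy q μ i l * increment hq μ l (potMul hq (fundVec hq μ j))) μ := by
  set f : ℂ → ℂ := fun ν =>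
    ∑ l, monodromy q μ i l * increment hq μ l (potMul hq (fundVec hq ν j)) with hf
  have hfd : Differentiable ℂ f := by
    refine Differentiable.fun_sum fun l _ => ?_
    exact ((increment hq μ l ∘L potMul hq).differentiable.comp
      (differentiable_fundVec hq j)).const_mul _
  have h1 := (((hasDerivAt_id' μ).sub_const μ).fun_mul (hfd μ).hasDerivAt).const_add
    (monodromy q μ i j)
  simp only [sub_self, zero_mul, one_mul, add_zero] at h1
  exact h1.congr_of_eventuallyEq (Filter.Eventually.of_forall fun ν => monodromy_eq hq μ ν i j)

end monodromyDerivative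

/-! ### Invertibility of `P_k(β,h)` -/

theorem mulPotential_eq {W : ℂ → ℂ} (hW : Differentiable ℂ W) :
    mulPotential hW = potMul (hW.fun_pow 2) := by
  ext1 f
  refine Lp.ext ?_
  filter_upwards [mulPotential_apply hW f,
    mulCont_apply _ (continuous_potential (hW.fun_pow 2)) f] with x h1 h2
  rw [h1, potMul, h2]

theorem sq_mul_specParam {h : ℝ} (hh : 0 < h) (β : ℂ) :
    (h : ℂ) ^ 2 * specParam h β = -(β ^ 2) := by
  have : (h : ℂ) ≠ 0 := by exact_mod_cast hh.ne'
  rw [specParam]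
  field_simp

section numerator

variable {q : ℂ → ℂ} (hq : Differentiable ℂ q) (k : ℂ) (h : ℝ)

/-- `-adj(Φ(1) - e^{ik/h}) Φ(1)`. -/
def numeratorMatrix (q : ℂ → ℂ) (k : ℂ) (h : ℝ) (μ : ℂ) : Matrix (Fin 2) (Fin 2) ℂ :=
  -((monodromy q μ - floquet k h • (1 : Matrix (Fin 2) (Fin 2) ℂ)).adjugate * monodromy q μ)

/-- The functionals such that the quasi-periodic solution of `w'' = μ q w + g` has the initial data
`det (Φ(1) - e^{ik/h})⁻¹ • numerator g`. -/
def numerator (μ : ℂ) (i : Fin 2) : StrongDual ℂ L2k :=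
  ∑ j, numeratorMatrix q k h μ i j • increment hq μ j

include hq in
theorem differentiable_numeratorMatrix (i j : Fin 2) :
    Differentiable ℂ fun μ => numeratorMatrix q k h μ i j := by
  have hd : ∀ i j, Differentiable ℂ fun μ => monodromy q μ i j :=
    differentiable_cauchyMatrix hq 1 1
  simp only [numeratorMatrix, Matrix.neg_apply, Matrix.mul_apply, Fin.sum_univ_two,
    Matrix.adjugate_fin_two]
  fin_cases i <;> simp <;> fun_prop

theorem differentiable_numerator (i : Fin 2) : Differentiable ℂ fun μ => numerator hq k h μ i :=
  Differentiable.fun_sum fun j _ =>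
    (differentiable_numeratorMatrix hq k h i j).smul (differentiable_increment hq j)

/-- The condition Φ(1)(c + ℓ) = ρc says (Φ(1) - ρ)c = -Φ(1)ℓ, which the adjugate solves up to the
factor det(Φ(1) - ρ). -/
theorem monodromy_mulVec_numerator {μ : ℂ}
    (hd : (monodromy q μ - floquet k h • (1 : Matrix (Fin 2) (Fin 2) ℂ)).det ≠ 0) (g : L2k) :
    monodromy q μ *ᵥ (fun i =>
      (monodromy q μ - floquet k h • (1 : Matrix (Fin 2) (Fin 2) ℂ)).det⁻¹ *
        numerator hq k h μ i g +
        increment hq μ i g) =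
      floquet k h • fun i => (monodromy q μ - floquet k h • (1 : Matrix (Fin 2) (Fin 2) ℂ)).det⁻¹ *
        numerator hq k h μ i g := by
  set N := monodromy q μ
  set D := N - floquet k h • (1 : Matrix (Fin 2) (Fin 2) ℂ) with hD
  set l : Fin 2 → ℂ := fun i => increment hq μ i g
  set c : Fin 2 → ℂ := fun i => D.det⁻¹ * numerator hq k h μ i g with hcdef
  have hc : c = D.det⁻¹ • (-(D.adjugate * N) *ᵥ l) := by
    funext i
    fin_cases i <;>
      simp [hcdef, numerator, numeratorMatrix, l, N, D, Fin.sum_univ_two]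
  have h1 : D *ᵥ c = -(N *ᵥ l) := by
    rw [hc, Matrix.mulVec_smul, Matrix.neg_mulVec, Matrix.mulVec_neg, Matrix.mulVec_mulVec,
      ← Matrix.mul_assoc, Matrix.mul_adjugate, Matrix.smul_mul, Matrix.one_mul, Matrix.smul_mulVec,
      smul_neg, smul_smul, inv_mul_cancel₀ hd, one_smul]
  have h2 : D *ᵥ c = N *ᵥ c - floquet k h • c := by
    rw [hD, Matrix.sub_mulVec, Matrix.smul_mulVec, Matrix.one_mulVec]
  change N *ᵥ (c + l) = floquet k h • c
  rw [Matrix.mulVec_add]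
  rw [h2] at h1
  rw [sub_eq_iff_eq_add.1 h1]
  abel

end numerator

section invertibility

variable {W : ℂ → ℂ} (hW : Differentiable ℂ W) (k : ℂ) (h : ℝ)

theorem opP_mk (β : ℂ) (p : H2k k h) : opP hW k h β p =
    (-(h : ℂ) ^ 2) • (H2k.triple k h p).2.2 - β ^ 2 • mulPotential hW (H2k.triple k h p).1 := rfl

theorem triple_injective : Function.Injective (H2k.triple k h) := Subtype.val_injective

/-- With w'' = μqw + g the potential terms cancel because h²μ = -β². The remaining -h²g is the
source of the factor -h⁻² in the inverse. -/
theorem opP_solTriple {h : ℝ} (hh : 0 < h) (β : ℂ) (c : Fin 2 → ℂ) (g : L2k) (p : H2k k h)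
    (hp : H2k.triple k h p = solTriple (hW.fun_pow 2) (specParam h β) c g) :
    opP hW k h β p = (-(h : ℂ) ^ 2) • g := by
  rw [opP_mk, hp, mulPotential_eq]
  simp only [solTriple, smul_add, smul_smul]
  rw [neg_mul, sq_mul_specParam hh, neg_neg]
  abel

/-- A kernel vector of Φ(1) - ρ is the Cauchy data of a nonzero quasi-periodic solution of the
homogeneous equation. -/
theorem not_isInvertible_opP {h : ℝ} (hh : 0 < h) (hper : ∀ z, W (z + 1) = W z) {β : ℂ}
    (hd : floquetDet (fun z => W z ^ 2) k h β = 0) : ¬(opP hW k h β).IsInvertible := by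
  have hq := hW.fun_pow 2
  obtain ⟨c, hc0, hc⟩ := Matrix.exists_mulVec_eq_zero_iff.2 hd
  rw [Matrix.sub_mulVec, Matrix.smul_mulVec, Matrix.one_mulVec, sub_eq_zero] at hc
  have hmem : solTriple hq (specParam h β) c 0 ∈ H2kSubmodule k h :=
    solTriple_mem hq _ (fun z => by simp [hper]) k h c 0 (by simpa using hc)
  rintro ⟨e, he⟩
  let p : H2k k h := ⟨_, hmem⟩
  have hp : opP hW k h β p = 0 := by
    rw [opP_solTriple hW k hh β c 0 p rfl, smul_zero]
  have hp0 : p = 0 := by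
    rw [← he] at hp
    exact e.injective (hp.trans (map_zero e).symm)
  have ht : solTriple hq (specParam h β) c 0 = 0 := by
    change H2k.triple k h p = 0
    rw [hp0, map_zero]
  -- Vanishing almost everywhere on the cell gives vanishing at the endpoint 0 by continuity; for w
  -- and w' together this returns c = 0.
  have key : ∀ {a b : ℝ → ℂ} (ha : Continuous a) (hb : Continuous b),
      (c 0 • mulCont a ha cellOne + c 1 • mulCont b hb cellOne : L2k) = 0 →
      c 0 * a 0 + c 1 * b 0 = 0 := by
    intro a b ha hb hz
    have h1 : (fun x => c 0 * a x + c 1 * b x) =ᵐ[volume.restrict (Set.Icc (0 : ℝ) 1)]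
        fun _ => 0 := by
      rw [← Measure.restrict_congr_set Ico_ae_eq_Icc]
      have := Lp.coeFn_zero ℂ 2 cell
      rw [← hz] at this
      filter_upwards [this, Lp.coeFn_add (c 0 • mulCont a ha cellOne) (c 1 • mulCont b hb cellOne),
        Lp.coeFn_smul (c 0) (mulCont a ha cellOne), Lp.coeFn_smul (c 1) (mulCont b hb cellOne),
        mulCont_one a ha, mulCont_one b hb] with x e1 e2 e3 e4 e5 e6
      rw [e2, Pi.add_apply, e3, e4, Pi.smul_apply, Pi.smul_apply, e5, e6] at e1
      simpa using e1
    exact Measure.eqOn_Icc_of_ae_eq volume zero_ne_one h1 (by fun_prop) continuousOn_const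
      (Set.left_mem_Icc.2 zero_le_one)
  have e1 : c 0 • cosMul hq (specParam h β) cellOne +
      c 1 • sinMul hq (specParam h β) cellOne = 0 := by
    simpa [solTriple, Fin.sum_univ_two, fundVec] using congrArg Prod.fst ht
  have e2 : c 0 • derivCosMul hq (specParam h β) cellOne +
      c 1 • derivSinMul hq (specParam h β) cellOne = 0 := by
    simpa [solTriple] using congrArg (fun p => p.2.1) ht
  have k1 := key (continuous_cosSol hq _) (continuous_sinSol hq _) e1
  have k2 := key (continuous_deriv_cosSol hq _) (continuous_deriv_sinSol hq _) e2
  simp only [Complex.ofReal_zero, cosSol_zero hq, sinSol_zero hq, deriv_cosSol_zero hq,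
    deriv_sinSol_zero hq] at k1 k2
  refine hc0 (funext fun i => ?_)
  fin_cases i
  · simpa using k1
  · simpa using k2

/-- An element of the kernel has a C¹ representative that solves the homogeneous equation on the
cell. Quasi-periodicity puts its Cauchy data at 0 into the kernel of Φ(1) - ρ, which is trivial, and
variation of constants then makes it vanish on the cell. -/
theorem opP_injective {h : ℝ} (hh : 0 < h) {β : ℂ}
    (hd : floquetDet (fun z => W z ^ 2) k h β ≠ 0) {p : H2k k h} (hp : opP hW k h β p = 0) :
    p = 0 := by
  have hq := hW.fun_pow 2
  have hh' : (h : ℂ) ≠ 0 := by exact_mod_cast hh.ne'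
  obtain ⟨w, w', w'', hwq, hw, hw', p1, p2, p3⟩ := p.2
  set μ := specParam h β with hμ
  -- The representative v' of w' is chosen first; replacing w' by it in the derivative of v makes v
  -- continuously differentiable with derivative v' everywhere.
  obtain ⟨v', hv', hvw'⟩ := hw'.exists_hasACDeriv
  obtain ⟨v, hv, hvw⟩ := hw.exists_hasACDeriv
  replace hv := hv.congr hvw'.symm
  have hcell : ∀ {f g : ℝ → ℂ}, f =ᵐ[volume] g → f =ᵐ[cell] g := fun h => ae_restrict_of_ae h
  -- the equation on the period cell
  have hg0 : (fun x : ℝ => w'' x - μ * W x ^ 2 * v x) =ᵐ[cell] fun _ => 0 := by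
    rw [opP_mk, mulPotential_eq] at hp
    have e := Lp.coeFn_zero ℂ 2 cell
    rw [← hp] at e
    filter_upwards [e, p1, p3, hcell hvw,
      Lp.coeFn_sub ((-(h : ℂ) ^ 2) • (H2k.triple k h p).2.2)
        (β ^ 2 • potMul hq (H2k.triple k h p).1),
      Lp.coeFn_smul (-(h : ℂ) ^ 2) (H2k.triple k h p).2.2,
      Lp.coeFn_smul (β ^ 2) (potMul hq (H2k.triple k h p).1),
      mulCont_apply _ (continuous_potential hq) (H2k.triple k h p).1] with x e0 e1 e2 e3 e4 e5 e6 e7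
    rw [e4, Pi.sub_apply, e5, e6, Pi.smul_apply, Pi.smul_apply, potMul, e7] at e0
    change (H2k.triple k h p).1 x = w x at e1
    change (H2k.triple k h p).2.2 x = w'' x at e2
    rw [e1, e2, ← e3] at e0
    simp only [smul_eq_mul, Pi.zero_apply] at e0
    refine (mul_eq_zero.1 ?_).resolve_left (pow_ne_zero 2 hh')
    linear_combination -e0 - W x ^ 2 * v x * sq_mul_specParam hh β
  -- The residual of the equation serves as the source on all of ℝ; it is known to vanish only on
  -- the cell, so the formula is used only for x in [0,1].
  have hvar := eq_of_variation_of_constants hq μ (g := fun x : ℝ => w'' x - μ * W x ^ 2 * v x) hv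
    (hv'.congr (Filter.Eventually.of_forall fun x => by ring))
  have hint : ∀ {b : ℝ → ℂ} {x : ℝ}, x ∈ Set.Icc (0 : ℝ) 1 →
      ∫ t in (0 : ℝ)..x, b t * (w'' t - μ * W t ^ 2 * v t) = 0 := by
    intro b x hx
    rw [intervalIntegral_congr_cell (g := fun _ => 0) ?_ hx, intervalIntegral.integral_zero]
    filter_upwards [hg0] with t ht
    rw [ht, mul_zero]
  -- quasi-periodicity of the representatives
  have hvq : ∀ x, v (x + 1) = floquet k h * v x := by
    have h1 : (fun x => v (x + 1)) =ᵐ[volume] fun x => floquet k h * v x := by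
      have := (measurePreserving_add_right volume (1 : ℝ)).quasiMeasurePreserving.ae hvw
      filter_upwards [this, hvw] with x e1 e2
      rw [e1, e2]
      exact hwq x
    exact congrFun (Continuous.ae_eq_iff_eq volume
      (hv.continuous.comp (continuous_add_const 1)) (continuous_const.mul hv.continuous) |>.1 h1)
  have hvd := hv.hasDerivAt hv'.continuous
  have hvq' : ∀ x, v' (x + 1) = floquet k h * v' x := by
    intro x
    have h1 := (hvd (x + 1)).comp_add_const x 1
    have h2 := (hvd x).const_mul (floquet k h)
    rw [funext hvq] at h1
    exact h1.unique h2
  have b1 := hvar 1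
  rw [hint (by simp), hint (by simp)] at b1
  have q1 := hvq 0
  have q2 := hvq' 0
  rw [zero_add] at q1 q2
  have hker : (monodromy (fun z => W z ^ 2) μ -
      floquet k h • (1 : Matrix (Fin 2) (Fin 2) ℂ)) *ᵥ ![v 0, v' 0] = 0 := by
    rw [Matrix.sub_mulVec, Matrix.smul_mulVec, Matrix.one_mulVec, sub_eq_zero]
    simp only [Complex.ofReal_one, sub_zero, add_zero] at b1
    funext i
    fin_cases i
    · simp [monodromy, cauchyMatrix, Matrix.mulVec, dotProduct, Fin.sum_univ_two]
      linear_combination q1 - b1.1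
    · simp [monodromy, cauchyMatrix, Matrix.mulVec, dotProduct, Fin.sum_univ_two]
      linear_combination q2 - b1.2
  have hzero : ![v 0, v' 0] = 0 := by
    by_contra hne
    exact hd (Matrix.exists_mulVec_eq_zero_iff.1 ⟨_, hne, hker⟩)
  have z0 : v 0 = 0 := congrFun hzero 0
  have z1 : v' 0 = 0 := congrFun hzero 1
  have hvan : ∀ x ∈ Set.Ico (0 : ℝ) 1, v x = 0 ∧ v' x = 0 := by
    intro x hx
    have := hvar x
    rw [hint (Set.Ico_subset_Icc_self hx), hint (Set.Ico_subset_Icc_self hx), z0, z1] at this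
    simpa using this
  have hae : ∀ᵐ x ∂cell, v x = 0 ∧ v' x = 0 := by
    filter_upwards [ae_restrict_mem measurableSet_Ico] with x hx using hvan x hx
  have hext : ∀ {f : L2k} {g : ℝ → ℂ}, f =ᵐ[cell] g → (∀ᵐ x ∂cell, g x = 0) → f = 0 := by
    intro f g h1 h2
    refine Lp.ext ?_
    filter_upwards [h1, h2, Lp.coeFn_zero ℂ 2 cell] with x e1 e2 e3
    rw [e1, e2, e3]; rfl
  refine triple_injective k h (Prod.ext ?_ (Prod.ext ?_ ?_))
  · refine hext p1 ?_
    filter_upwards [hcell hvw, hae] with x e1 e2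
    rw [← e1, e2.1]
  · refine hext p2 ?_
    filter_upwards [hcell hvw', hae] with x e1 e2
    rw [← e1, e2.2]
  · refine hext p3 ?_
    filter_upwards [hg0, hae] with x e1 e2
    rw [e2.1, mul_zero, sub_zero] at e1
    exact e1

open ContinuousLinearMap in
/-- The Green operator `g ↦ w` for quasi-periodic solutions of `w'' = μ q w + g`, `μ = -β²/h²`. -/
def greenOp (β : ℂ) : L2k →L[ℂ] L2k :=
  greenVolterra (hW.fun_pow 2) (specParam h β) + (floquetDet (fun z => W z ^ 2) k h β)⁻¹ •
    ∑ i, smulRightL ℂ L2k L2k (numerator (hW.fun_pow 2) k h (specParam h β) i)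
      (fundVec (hW.fun_pow 2) (specParam h β) i)

open ContinuousLinearMap in
theorem greenOp_apply (β : ℂ) (g : L2k) : greenOp hW k h β g =
    ∑ i, ((floquetDet (fun z => W z ^ 2) k h β)⁻¹ *
      numerator (hW.fun_pow 2) k h (specParam h β) i g) • fundVec (hW.fun_pow 2) (specParam h β) i +
        greenVolterra (hW.fun_pow 2) (specParam h β) g := by
  simp only [greenOp, add_apply, smul_apply, sum_apply, smulRightL_apply_apply, smulRight_apply,
    Finset.smul_sum, smul_smul]
  rw [add_comm]

open ContinuousLinearMap in
/-- The derivative of `greenOp`. -/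
def derivGreenOp (β : ℂ) : L2k →L[ℂ] L2k :=
  derivGreenVolterra (hW.fun_pow 2) (specParam h β) + (floquetDet (fun z => W z ^ 2) k h β)⁻¹ •
    (smulRightL ℂ L2k L2k (numerator (hW.fun_pow 2) k h (specParam h β) 0)
        (derivCosMul (hW.fun_pow 2) (specParam h β) cellOne) +
      smulRightL ℂ L2k L2k (numerator (hW.fun_pow 2) k h (specParam h β) 1)
        (derivSinMul (hW.fun_pow 2) (specParam h β) cellOne))

open ContinuousLinearMap in
theorem derivGreenOp_apply (β : ℂ) (g : L2k) : derivGreenOp hW k h β g =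
    ((floquetDet (fun z => W z ^ 2) k h β)⁻¹ *
        numerator (hW.fun_pow 2) k h (specParam h β) 0 g) •
          derivCosMul (hW.fun_pow 2) (specParam h β) cellOne +
      ((floquetDet (fun z => W z ^ 2) k h β)⁻¹ *
        numerator (hW.fun_pow 2) k h (specParam h β) 1 g) •
          derivSinMul (hW.fun_pow 2) (specParam h β) cellOne +
      derivGreenVolterra (hW.fun_pow 2) (specParam h β) g := by
  simp only [derivGreenOp, add_apply, smul_apply, smulRightL_apply_apply, smulRight_apply,
    smul_add, smul_smul]
  rw [add_comm]

/-- The Green operator together with the derivatives of the solution. -/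
def greenTriple (β : ℂ) : L2k →L[ℂ] L2k × L2k × L2k :=
  (greenOp hW k h β).prod ((derivGreenOp hW k h β).prod
    (specParam h β • (potMul (hW.fun_pow 2) ∘L greenOp hW k h β) + ContinuousLinearMap.id ℂ L2k))

theorem greenTriple_apply (β : ℂ) (g : L2k) : greenTriple hW k h β g =
    solTriple (hW.fun_pow 2) (specParam h β) (fun i => (floquetDet (fun z => W z ^ 2) k h β)⁻¹ *
      numerator (hW.fun_pow 2) k h (specParam h β) i g) g := by
  rw [solTriple, ← greenOp_apply, ← derivGreenOp_apply, greenTriple,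
    ContinuousLinearMap.prod_apply, ContinuousLinearMap.prod_apply, add_apply, smul_apply,
    ContinuousLinearMap.comp_apply, ContinuousLinearMap.id_apply]

theorem greenTriple_mem {k : ℂ} {h : ℝ} (hper : ∀ z, W (z + 1) = W z) {β : ℂ}
    (hd : floquetDet (fun z => W z ^ 2) k h β ≠ 0) (g : L2k) :
    greenTriple hW k h β g ∈ H2kSubmodule k h := by
  rw [greenTriple_apply]
  exact solTriple_mem _ _ (fun z => by simp [hper]) k h _ g
    (monodromy_mulVec_numerator (hW.fun_pow 2) k h hd g)

/-- The corestriction to `H²_k` of an operator with values in the triples `(w, w', w'')`. -/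
def corestrict {k : ℂ} {h : ℝ} (T : L2k →L[ℂ] L2k × L2k × L2k)
    (hT : ∀ g, T g ∈ H2kSubmodule k h) : L2k →L[ℂ] H2k k h :=
  T.codRestrict (H2kSubmodule k h) hT

theorem triple_corestrict {k : ℂ} {h : ℝ} (T : L2k →L[ℂ] L2k × L2k × L2k)
    (hT : ∀ g, T g ∈ H2kSubmodule k h) (g : L2k) :
    H2k.triple k h (corestrict T hT g) = T g := rfl

/-- The inverse of `P_k(β,h)`. -/
def resolventOp {k : ℂ} {h : ℝ} (hper : ∀ z, W (z + 1) = W z) {β : ℂ}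
    (hd : floquetDet (fun z => W z ^ 2) k h β ≠ 0) : L2k →L[ℂ] H2k k h :=
  (-((h : ℂ) ^ 2)⁻¹) •
    corestrict (greenTriple hW k h β) (greenTriple_mem hW hper hd)

theorem opP_comp_resolventOp {h : ℝ} (hh : 0 < h) (hper : ∀ z, W (z + 1) = W z) {β : ℂ}
    (hd : floquetDet (fun z => W z ^ 2) k h β ≠ 0) :
    opP hW k h β ∘L resolventOp hW hper hd = ContinuousLinearMap.id ℂ L2k := by
  have hh' : (h : ℂ) ^ 2 ≠ 0 := pow_ne_zero 2 (by exact_mod_cast hh.ne')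
  ext1 g
  rw [ContinuousLinearMap.comp_apply, resolventOp, smul_apply, map_smul,
    opP_solTriple hW k hh β _ g _ ((triple_corestrict _ _ g).trans (greenTriple_apply hW k h β g)),
    smul_smul]
  simp [hh']

theorem resolventOp_comp_opP {h : ℝ} (hh : 0 < h) (hper : ∀ z, W (z + 1) = W z) {β : ℂ}
    (hd : floquetDet (fun z => W z ^ 2) k h β ≠ 0) :
    resolventOp hW hper hd ∘L opP hW k h β = ContinuousLinearMap.id ℂ (H2k k h) := by
  ext1 p
  refine sub_eq_zero.1 (opP_injective hW k hh hd ?_)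
  have := DFunLike.congr_fun (opP_comp_resolventOp hW k hh hper hd) (opP hW k h β p)
  rw [map_sub]
  exact sub_eq_zero.2 this

theorem isInvertible_opP_iff {h : ℝ} (hh : 0 < h) (hper : ∀ z, W (z + 1) = W z) (β : ℂ) :
    (opP hW k h β).IsInvertible ↔ floquetDet (fun z => W z ^ 2) k h β ≠ 0 :=
  ⟨fun H hd => not_isInvertible_opP hW k hh hper hd H, fun hd =>
    .of_inverse (opP_comp_resolventOp hW k hh hper hd) (resolventOp_comp_opP hW k hh hper hd)⟩

theorem incl_comp_inverse {h : ℝ} (hh : 0 < h) (hper : ∀ z, W (z + 1) = W z) {β : ℂ}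
    (hd : floquetDet (fun z => W z ^ 2) k h β ≠ 0) :
    incl k h ∘L (opP hW k h β).inverse = (-((h : ℂ) ^ 2)⁻¹) • greenOp hW k h β := by
  rw [ContinuousLinearMap.inverse_eq (opP_comp_resolventOp hW k hh hper hd)
    (resolventOp_comp_opP hW k hh hper hd)]
  rfl

end invertibility

/-! ### Meromorphy of the inverse and equality of the multiplicities -/

theorem analyticOrderAt_ne_top_of_exists_ne {d : ℂ → ℂ} (hd : Differentiable ℂ d)
    (h0 : ∃ z, d z ≠ 0) (a : ℂ) : analyticOrderAt d a ≠ ⊤ := by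
  intro h
  obtain ⟨z, hz⟩ := h0
  refine hz ?_
  have := AnalyticOnNhd.eq_of_eventuallyEq (fun z _ => hd.analyticAt z)
    (fun z _ => analyticAt_const (v := (0 : ℂ))) (analyticOrderAt_eq_top.1 h)
  exact congrFun this z

theorem eventually_ne_zero_of_exists_ne {d : ℂ → ℂ} (hd : Differentiable ℂ d)
    (h0 : ∃ z, d z ≠ 0) (a : ℂ) : ∀ᶠ z in 𝓝[≠] a, d z ≠ 0 :=
  (hd.analyticAt a).eventually_eq_zero_or_eventually_ne_zero.resolve_left fun h =>
    analyticOrderAt_ne_top_of_exists_ne hd h0 a (analyticOrderAt_eq_top.2 h)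

theorem exists_isolatingCircle {d : ℂ → ℂ} (hd : Differentiable ℂ d) (h0 : ∃ z, d z ≠ 0) (a : ℂ) :
    ∃ c r, IsolatingCircle (fun z => d z ≠ 0) a c r := by
  have h := eventually_ne_zero_of_exists_ne hd h0 a
  rw [eventually_nhdsWithin_iff] at h
  obtain ⟨ε, hε, hb⟩ := Metric.eventually_nhds_iff_ball.1 h
  exact ⟨a, ε / 2, Metric.mem_ball_self (by linarith), fun z hz hza =>
    hb z (Metric.closedBall_subset_ball (by linarith) hz) hza⟩

section main

variable {W : ℂ → ℂ} (hW : Differentiable ℂ W) (k : ℂ) {h : ℝ} (hh : 0 < h)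
  (hper : ∀ z, W (z + 1) = W z)

theorem opP_sub (β₀ z : ℂ) : opP hW k h z =
    opP hW k h β₀ - (z ^ 2 - β₀ ^ 2) • (mulPotential hW ∘L incl k h) := by
  rw [opP, opP, sub_smul]
  abel

/-- On the right the inverse at z occurs only after inclusion into L²_k, and the fixed operator
P(β₀)⁻¹ restores the values in H²_k. Meromorphy into H²_k thus follows from that of the Green
operator on L²_k, without any study of `derivGreenOp` as a function of β. -/
theorem inverse_eq_resolvent {β₀ z : ℂ} (h0 : (opP hW k h β₀).IsInvertible)
    (hz : (opP hW k h z).IsInvertible) : (opP hW k h z).inverse = (opP hW k h β₀).inverse +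
      ((opP hW k h β₀).inverse ∘L mulPotential hW) ∘L
        ((z ^ 2 - β₀ ^ 2) • (incl k h ∘L (opP hW k h z).inverse)) := by
  ext1 f
  obtain ⟨e, he⟩ := hz
  obtain ⟨e₀, he₀⟩ := h0
  have h1 := DFunLike.congr_fun (opP_sub hW k (h := h) β₀ z) (e.symm f)
  rw [← he, ← he₀] at *
  simp only [ContinuousLinearMap.inverse_equiv, ContinuousLinearEquiv.coe_coe,
    ContinuousLinearEquiv.apply_symm_apply, sub_apply, smul_apply,
    ContinuousLinearMap.comp_apply, add_apply] at h1 ⊢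
  apply e₀.injective
  rw [map_add, e₀.apply_symm_apply, map_smul, map_smul, map_smul, e₀.apply_symm_apply]
  rw [eq_sub_iff_add_eq] at h1
  exact h1.symm

include hh hper

open ContinuousLinearMap in
theorem inverseIsMeromorphic_iff : InverseIsMeromorphic hW k h ↔
    ∃ β, floquetDet (fun z => W z ^ 2) k h β ≠ 0 := by
  have hq := hW.fun_pow 2
  have hd := differentiable_floquetDet hq k h
  constructor
  · rintro ⟨H, -⟩
    obtain ⟨z, hz⟩ := (H 0).exists
    exact ⟨z, (isInvertible_opP_iff hW k hh hper z).1 hz⟩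
  · intro h0
    have hinv : ∀ a : ℂ, ∀ᶠ z in 𝓝[≠] a, (opP hW k h z).IsInvertible := fun a =>
      (eventually_ne_zero_of_exists_ne hd h0 a).mono fun z hz =>
        (isInvertible_opP_iff hW k hh hper z).2 hz
    refine ⟨hinv, fun a => ?_⟩
    obtain ⟨N, hN⟩ := ENat.ne_top_iff_exists.1 (analyticOrderAt_ne_top_of_exists_ne hd h0 a)
    obtain ⟨β₀, hβ₀⟩ := h0
    have hs := differentiable_specParam h
    -- The scalar combines z² - β₀² from the resolvent identity with -h⁻² from `incl_comp_inverse`.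
    set f : ℂ → ℂ := fun z => (z ^ 2 - β₀ ^ 2) * -((h : ℂ) ^ 2)⁻¹ with hf
    have hfd : Differentiable ℂ f := by rw [hf]; fun_prop
    have key := hasFinitePrincipalPart_of_denominator hd (a := a) (E := L2k) (F := L2k)
      (A := fun z => f z • greenVolterra hq (specParam h z))
      (s := fun i z => f z • numerator hq k h (specParam h z) i)
      (r := fun i z => fundVec hq (specParam h z) i)
      ((hfd.smul ((differentiable_greenVolterra hq).comp hs)).analyticAt a)
      (fun i => hfd.smul ((differentiable_numerator hq k h i).comp hs))
      (fun i => (differentiable_fundVec hq i).comp hs) hN.symm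
    have hconst : HasFinitePrincipalPart (fun _ : ℂ => (opP hW k h β₀).inverse) a :=
      analyticAt_const.hasFinitePrincipalPart
    refine (hconst.add (key.clm_comp ((opP hW k h β₀).inverse ∘L mulPotential hW))).congr ?_
    filter_upwards [eventually_ne_zero_of_exists_ne hd ⟨β₀, hβ₀⟩ a] with z hz
    rw [inverse_eq_resolvent hW k ((isInvertible_opP_iff hW k hh hper β₀).2 hβ₀)
      ((isInvertible_opP_iff hW k hh hper z).2 hz), incl_comp_inverse hW k hh hper hz, smul_smul,
      greenOp]
    simp only [map_smul, smul_apply, smul_add, Finset.smul_sum, smul_smul, hf]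
    congr 3
    refine Finset.sum_congr rfl fun i _ => ?_
    rw [mul_comm]

omit hh hper in
-- By Duhamel, ∂_μ Φ(1) is Φ(1) times the matrix with entries ℓᵢ(qφⱼ), so the sum is tr(adj(Φ(1) -
-- ρ) ∂_β Φ(1)), which is d' by Jacobi's formula. The minus sign in `numeratorMatrix` and the one in
-- dμ/dβ = -2β/h² cancel.
theorem sum_numerator_eq_deriv (z : ℂ) :
    ∑ i, ((2 * z / (h : ℂ) ^ 2) • (numerator (hW.fun_pow 2) k h (specParam h z) i ∘L
      mulPotential hW)) (fundVec (hW.fun_pow 2) (specParam h z) i) =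
      deriv (floquetDet (fun z => W z ^ 2) k h) z := by
  have hq := hW.fun_pow 2
  have hsp : HasDerivAt (specParam h) (-(2 * z) / (h : ℂ) ^ 2) z := by
    change HasDerivAt (fun β : ℂ => -(β ^ 2) / (h : ℂ) ^ 2) _ z
    simpa using (hasDerivAt_pow 2 z).fun_neg.div_const ((h : ℂ) ^ 2)
  have hm : ∀ i j, HasDerivAt (fun z => monodromy (fun z => W z ^ 2) (specParam h z) i j -
      (floquet k h • (1 : Matrix (Fin 2) (Fin 2) ℂ)) i j) _ z := fun i j =>
    ((hasDerivAt_monodromy hq (specParam h z) i j).comp z hsp).sub_const _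
  have hdet := ((hm 0 0).fun_mul (hm 1 1)).fun_sub ((hm 0 1).fun_mul (hm 1 0))
  have e : floquetDet (fun z => W z ^ 2) k h = fun z => _ :=
    funext fun z => Matrix.det_fin_two _
  simp only [Matrix.sub_apply] at e
  rw [e, hdet.deriv]
  simp only [numerator, numeratorMatrix, mulPotential_eq, Fin.sum_univ_two, Matrix.neg_apply,
    Matrix.mul_apply, Matrix.adjugate_fin_two, smul_apply, ContinuousLinearMap.comp_apply,
    add_apply, smul_eq_mul, Matrix.of_apply, Matrix.cons_val', Matrix.cons_val_zero,
    Matrix.cons_val_one, Matrix.sub_apply, Matrix.smul_apply, Matrix.one_apply]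
  simp
  ring

theorem hasOperatorMultiplicity (h0 : ∃ β, floquetDet (fun z => W z ^ 2) k h β ≠ 0) {α : ℂ} {m : ℕ}
    (hm : analyticOrderAt (floquetDet (fun z => W z ^ 2) k h) α = m) :
    HasOperatorMultiplicity hW k h α m := by
  have hq := hW.fun_pow 2
  have hd := differentiable_floquetDet hq k h
  have hs := differentiable_specParam h
  unfold HasOperatorMultiplicity
  simp only [isInvertible_opP_iff hW k hh hper]
  refine ⟨exists_isolatingCircle hd h0 α, fun c r hc => ?_⟩
  have hfd : Differentiable ℂ fun z : ℂ => 2 * z / (h : ℂ) ^ 2 := by fun_prop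
  exact hasFiniteRankTrace_contour hd
    (A := fun z => (2 * z / (h : ℂ) ^ 2) • (greenVolterra hq (specParam h z) ∘L mulPotential hW))
    (s := fun i z => (2 * z / (h : ℂ) ^ 2) •
      (numerator hq k h (specParam h z) i ∘L mulPotential hW))
    (r := fun i z => fundVec hq (specParam h z) i)
    (hfd.smul (((differentiable_greenVolterra hq).comp hs).clm_comp (differentiable_const _)))
    (fun i => hfd.smul (((differentiable_numerator hq k h i).comp hs).clm_comp
      (differentiable_const _)))
    (fun i => (differentiable_fundVec hq i).comp hs)
    (fun z hz => by
      rw [logDerivOp, ← ContinuousLinearMap.comp_assoc, incl_comp_inverse hW k hh hper hz,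
        greenOp, derivOpP]
      -- The factor -2β comes from ∂_β P, the factor -h⁻² from the inverse.
      have hc : -(2 * z) * -((h : ℂ) ^ 2)⁻¹ = 2 * z / (h : ℂ) ^ 2 := by ring
      ext1 x
      simp only [ContinuousLinearMap.comp_apply, smul_apply, add_apply, sum_apply, map_smul,
        ContinuousLinearMap.smulRightL_apply_apply, ContinuousLinearMap.smulRight_apply, smul_add,
        Finset.smul_sum, smul_smul]
      rw [hc]
      congr 1
      refine Finset.sum_congr rfl fun i _ => ?_
      congr 1
      ring)
    (sum_numerator_eq_deriv hW k) hm hc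

include hW in
-- The integrand has trace d'/d by `trace_inv_mul_deriv`, so only the argument principle remains; ρ
-- is constant, whence ∂ℳ = ∂(ℳ - ρ).
theorem hasMonodromyMultiplicity (z₀ : ℂ) (h0 : ∃ β, floquetDet (fun z => W z ^ 2) k h β ≠ 0)
    {α : ℂ} {m : ℕ} (hm : analyticOrderAt (floquetDet (fun z => W z ^ 2) k h) α = m) :
    HasMonodromyMultiplicity W k h z₀ α m := by
  have hd := differentiable_floquetDet (hW.fun_pow 2) k h
  have hM : ∀ i j, Differentiable ℂ fun β => shiftedMonodromy W k h z₀ β i j := fun i j =>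
    (differentiable_transitionMatrix hW hh (z₀ + 1) z₀ i j).sub_const _
  have hdet := det_shiftedMonodromy hW hh hper k z₀
  have hder : ∀ β, derivMonodromy W h z₀ β =
      Matrix.of fun i j => deriv (fun b => shiftedMonodromy W k h z₀ b i j) β := by
    intro β
    ext i j
    exact (deriv_sub_const _).symm
  have hM' : ∀ i j, Differentiable ℂ fun β => derivMonodromy W h z₀ β i j := fun i j β =>
    ((differentiable_transitionMatrix hW hh (z₀ + 1) z₀ i j).analyticAt β).deriv.differentiableAt
  unfold HasMonodromyMultiplicity
  simp only [hdet]
  refine ⟨exists_isolatingCircle hd h0 α, fun c r hc => ?_⟩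
  have hlog := circleIntegral_deriv_div hd hm hc
  obtain ⟨ha, hne⟩ := hc
  have hr : 0 ≤ r := dist_nonneg.trans (Metric.mem_ball.1 ha).le
  have hne' : ∀ z ∈ Metric.sphere c r, floquetDet (fun z => W z ^ 2) k h z ≠ 0 := fun z hz =>
    hne z (Metric.sphere_subset_closedBall hz) (ne_of_mem_sphere_of_mem_ball ha hz)
  have hint : ∀ i j, CircleIntegrable
      (fun β => ((shiftedMonodromy W k h z₀ β)⁻¹ * derivMonodromy W h z₀ β) i j) c r := by
    intro i j
    refine ContinuousOn.circleIntegrable hr ?_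
    have hc0 : ContinuousOn (fun β => (floquetDet (fun z => W z ^ 2) k h β)⁻¹)
        (Metric.sphere c r) := hd.continuous.continuousOn.inv₀ hne'
    have hadj : ∀ i j, Continuous fun β => (shiftedMonodromy W k h z₀ β).adjugate i j := by
      have := fun i j => (hM i j).continuous
      intro i j
      simp only [Matrix.adjugate_fin_two]
      fin_cases i <;> fin_cases j <;> simp <;> fun_prop
    have hMc := fun i j => (hM' i j).continuous
    have e : ∀ β, ((shiftedMonodromy W k h z₀ β)⁻¹ * derivMonodromy W h z₀ β) i j =
        (floquetDet (fun z => W z ^ 2) k h β)⁻¹ *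
          ∑ l, (shiftedMonodromy W k h z₀ β).adjugate i l * derivMonodromy W h z₀ β l j := by
      intro β
      rw [Matrix.inv_def, hdet, Ring.inverse_eq_inv', Matrix.smul_mul, Matrix.smul_apply,
        smul_eq_mul, Matrix.mul_apply]
    simp only [e]
    exact hc0.mul (continuous_finsetSum _ fun l _ => (hadj i l).mul (hMc l j)).continuousOn
  refine ⟨hint, ?_⟩
  have htr : ∀ β, ((shiftedMonodromy W k h z₀ β)⁻¹ * derivMonodromy W h z₀ β) 0 0 +
      ((shiftedMonodromy W k h z₀ β)⁻¹ * derivMonodromy W h z₀ β) 1 1 =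
        deriv (floquetDet (fun z => W z ^ 2) k h) β / floquetDet (fun z => W z ^ 2) k h β := by
    intro β
    have := trace_inv_mul_deriv hM β
    simp only [hdet, ← hder, Matrix.trace_fin_two] at this
    exact this
  rw [monodromyTrace, Matrix.trace_fin_two, Matrix.of_apply, Matrix.of_apply, ← mul_add,
    ← circleIntegral.integral_add (hint 0 0) (hint 1 1)]
  simp only [htr]
  rw [hlog, inv_mul_cancel_left₀ Complex.two_pi_I_ne_zero]

end main

end PeriodicTransition

end

/-! ### The theorem, with all assertions expressed through `floquetDet` -/

theorem mainTheorem8 (W : ℂ → ℂ) (hW : Differentiable ℂ W) (hper : ∀ z, W (z + 1) = W z)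
    (k : ℂ) (h : ℝ) (hh : 0 < h) (z₀ : ℂ) :
    -- the transition matrix is well defined and entire in the parameter
    (∀ β : ℂ, ∃! M, PeriodicTransition.IsTransitionMatrix W β h (z₀ + 1) z₀ M) ∧
    (∀ i j, Differentiable ℂ
      fun β => PeriodicTransition.transitionMatrix W β h (z₀ + 1) z₀ i j) ∧
    -- meromorphy of the inverse
    (PeriodicTransition.InverseIsMeromorphic hW k h ↔
      ∃ β : ℂ, (PeriodicTransition.shiftedMonodromy W k h z₀ β).det ≠ 0) ∧
    -- equality of the multiplicities
    ((∃ β : ℂ, (PeriodicTransition.shiftedMonodromy W k h z₀ β).det ≠ 0) →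
      ∀ α : ℂ, ∃ m : ℕ,
        PeriodicTransition.HasOperatorMultiplicity hW k h α m ∧
        PeriodicTransition.HasMonodromyMultiplicity W k h z₀ α m ∧
        analyticOrderAt
          (fun β => (PeriodicTransition.shiftedMonodromy W k h z₀ β).det) α = m) := by
  refine ⟨fun β => PeriodicTransition.existsUnique_isTransitionMatrix hW hh β (z₀ + 1) z₀,
    PeriodicTransition.differentiable_transitionMatrix hW hh (z₀ + 1) z₀, ?_, ?_⟩
  · simp only [PeriodicTransition.det_shiftedMonodromy hW hh hper]
    exact PeriodicTransition.inverseIsMeromorphic_iff hW k hh hper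
  · simp only [PeriodicTransition.det_shiftedMonodromy hW hh hper]
    intro h0 α
    obtain ⟨m, hm⟩ := ENat.ne_top_iff_exists.1
      (PeriodicTransition.analyticOrderAt_ne_top_of_exists_ne
        (PeriodicTransition.differentiable_floquetDet (hW.fun_pow 2) k h) h0 α)
    exact ⟨m, PeriodicTransition.hasOperatorMultiplicity hW k hh hper h0 hm.symm,
      PeriodicTransition.hasMonodromyMultiplicity hW k hh hper z₀ h0 hm.symm, hm.symm⟩
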